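/- **Canonicity for $\mathrm T_{\mathrm{pr}}$.** Universe levels are the elements of a finite or countable initial segment $\{0<1<\dots\}$ of $\mathbb N$ containing $0$ and $1$; below $\alpha\le\beta\le\gamma$ range over levels. Work in the logical framework given by extensional dependent type theory: judgements (types of the framework) are closed under dependent products $(x:X)\to Y$ with $\beta$ and $\eta$, dependent sums $(x:X)\times Y$ with surjective pairing, a unit judgement $1$ with $\eta$, and extensional equality $a=_Xb$ with reflection and uniqueness of proofs; judgemental equality is a congruence and is stable under substitution. Primitive recursive dependent type theory $\mathrm T_{\mathrm{pr}}$ is the theory freely generated in it by the following constants and equations (for all levels for which they make sense). * Judgements $\mathrm{tp}_\alpha$, and $\mathrm{tm}_\alpha(A)$ for $A:\mathrm{tp}_\alpha$. * Lifts $\Uparrow_\alpha^\beta:\mathrm{tp}_\alpha\to\mathrm{tp}_\beta$ with $\Uparrow_\alpha^\alpha A=A$, $\Uparrow_\beta^\gamma\Uparrow_\alpha^\beta A=\Uparrow_\alpha^\gamma A$ and $\mathrm{tm}_\alpha(A)=\mathrm{tm}_\beta(\Uparrow_\alpha^\beta A)$; and $\Uparrow_\alpha^\beta A=\Uparrow_\alpha^\beta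 B$ implies $A=B$. * For $A:\mathrm{tp}_\alpha$ and $B:\mathrm{tm}_\alpha(A)\to\mathrm{tp}_\alpha$, a type $\Sigma_\alpha(A,B):\mathrm{tp}_\alpha$ and an isomorphism $\mathrm{pair}_\alpha:\bigl((a:\mathrm{tm}_\alpha(A))\times\mathrm{tm}_\alpha(B(a))\bigr)\cong\mathrm{tm}_\alpha(\Sigma_\alpha(A,B))$. * For $A:\mathrm{tp}_\alpha$ and $a,b:\mathrm{tm}_\alpha(A)$, a type $\mathrm{eq}_\alpha(A,a,b):\mathrm{tp}_\alpha$; $\mathrm{refl}_\alpha(a):\mathrm{tm}_\alpha(\mathrm{eq}_\alpha(A,a,a))$; and, for $P:(b:\mathrm{tm}_\alpha(A))\to\mathrm{tm}_\alpha(\mathrm{eq}_\alpha(A,a,b))\to\mathrm{tp}_\alpha$, $b:\mathrm{tm}_\alpha(A)$, $p:\mathrm{tm}_\alpha(\mathrm{eq}_\alpha(A,a,b))$ and $s:\mathrm{tm}_\alpha(P(a,\mathrm{refl}_\alpha(a)))$, a term $\mathrm{eqind}_\alpha(P,b,p,s):\mathrm{tm}_\alpha(P(b,p))$ with $\mathrm{eqind}_\alpha(P,a,\mathrm{refl}_\alpha(a),s)=s$.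 * For $A:\mathrm{tp}_\alpha$ and $B:\mathrm{tm}_\alpha(A)\to\mathrm{tp}_\alpha$, a type $\Pi_\alpha(A,B):\mathrm{tp}_{\max(1,\alpha)}$ and an isomorphism $\lambda_\alpha:\bigl((a:\mathrm{tm}_\alpha(A))\to\mathrm{tm}_\alpha(B(a))\bigr)\cong\mathrm{tm}_{\max(1,\alpha)}(\Pi_\alpha(A,B))$. * Lifts commute with these types: $\Uparrow_\alpha^\beta\Sigma_\alpha(A,B)=\Sigma_\beta(\Uparrow_\alpha^\beta A,\Uparrow_\alpha^\beta\circ B)$, $\Uparrow_\alpha^\beta\mathrm{eq}_\alpha(A,a,b)=\mathrm{eq}_\beta(\Uparrow_\alpha^\beta A,a,b)$ and, for $\alpha>0$, $\Uparrow_\alpha^\beta\Pi_\alpha(A,B)=\Pi_\beta(\Uparrow_\alpha^\beta A,\Uparrow_\alpha^\beta\circ B)$. Along these equalities the introduction forms agree: $\mathrm{pair}_\alpha=\mathrm{pair}_\beta$, $\mathrm{refl}_\alpha=\mathrm{refl}_\beta$ and, for $\alpha>0$, $\lambda_\alpha=\lambda_\beta$. * $\emptyset:\mathrm{tp}_0$,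 with $\mathrm{exfalso}(B,x):\mathrm{tm}_0(B(x))$ for $B:\mathrm{tm}_0(\emptyset)\to\mathrm{tp}_0$ and $x:\mathrm{tm}_0(\emptyset)$. * $\mathrm 1:\mathrm{tp}_0$ and $\star:\mathrm{tm}_0(\mathrm 1)$, with $\mathrm{unitind}(B,b,x):\mathrm{tm}_0(B(x))$ for $B:\mathrm{tm}_0(\mathrm 1)\to\mathrm{tp}_0$, $b:\mathrm{tm}_0(B(\star))$ and $x:\mathrm{tm}_0(\mathrm 1)$, and $\mathrm{unitind}(B,b,\star)=b$. * $\mathrm N:\mathrm{tp}_0$, $\mathsf z:\mathrm{tm}_0(\mathrm N)$ and $\mathsf s:\mathrm{tm}_0(\mathrm N)\to\mathrm{tm}_0(\mathrm N)$, with $\mathrm{ind}(B,b_{\mathsf z},b_{\mathsf s},x):\mathrm{tm}_0(B(x))$ for $B:\mathrm{tm}_0(\mathrm N)\to\mathrm{tp}_0$, $b_{\mathsf z}:\mathrm{tm}_0(B(\mathsf z))$, $b_{\mathsf s}:(n:\mathrm{tm}_0(\mathrm N))\to\mathrm{tm}_0(B(n))\to\mathrm{tm}_0(B(\mathsf s\,n))$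 and $x:\mathrm{tm}_0(\mathrm N)$, and equations $\mathrm{ind}(B,b_{\mathsf z},b_{\mathsf s},\mathsf z)=b_{\mathsf z}$ and $\mathrm{ind}(B,b_{\mathsf z},b_{\mathsf s},\mathsf s\,n)=b_{\mathsf s}(n,\mathrm{ind}(B,b_{\mathsf z},b_{\mathsf s},n))$. * Universes $\mathrm U_\alpha:\mathrm{tp}_{\alpha+1}$ (when $\alpha+1$ is a level) with $\mathrm{tm}_{\alpha+1}(\mathrm U_\alpha)=\mathrm{tp}_\alpha$. Write $\mathrm T_{\mathrm{pr}}$ also for the category whose objects are the closed judgements and whose morphisms $X\to Y$ are the terms $x:X\vdash t:Y$ modulo judgemental equality, with substitution as composition. **Theorem.** For every morphism $m:1\to\mathrm{tm}_0(\mathrm N)$ of $\mathrm T_{\mathrm{pr}}$ (a closed term of the natural numbers type) there is a natural number $n$ with $m=\mathsf s^n\circ\mathsf z$ in $\mathrm T_{\mathrm{pr}}$; that is, $m$ is judgementally equal to the $n$-th numeral. -/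

import Mathlib

namespace PRTT

/-- Raw expressions (judgements and terms alike) of the logical framework over the signature of
primitive recursive dependent type theory, with at most `n` free de Bruijn variables.
The constructors with prefix `lf` belong to the framework (dependent products, dependent sums,
unit and extensional equality); the others are the constants of the signature, applied to all of
their arguments.  Arguments such as `B` in `sigma α A B` are terms of the framework of function
type, so only `lfPi`, `lfLam`, `lfSig` and the annotations `B` in the framework's constructors
bind a variable. -/
inductive Expr : ℕ → Type
  | var {n : ℕ} (i : Fin n) : Expr n
  -- the framework
  | lfUnit {n : ℕ} : Expr n
  | lfStar {n : ℕ} : Expr n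
  | lfPi {n : ℕ} (A : Expr n) (B : Expr (n + 1)) : Expr n
  | lfLam {n : ℕ} (A : Expr n) (B : Expr (n + 1)) (t : Expr (n + 1)) : Expr n
  | lfApp {n : ℕ} (A : Expr n) (B : Expr (n + 1)) (f a : Expr n) : Expr n
  | lfSig {n : ℕ} (A : Expr n) (B : Expr (n + 1)) : Expr n
  | lfPair {n : ℕ} (A : Expr n) (B : Expr (n + 1)) (a b : Expr n) : Expr n
  | lfFst {n : ℕ} (A : Expr n) (B : Expr (n + 1)) (p : Expr n) : Expr n
  | lfSnd {n : ℕ} (A : Expr n) (B : Expr (n + 1)) (p : Expr n) : Expr n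
  | lfEq {n : ℕ} (A a b : Expr n) : Expr n
  | lfRefl {n : ℕ} (A a : Expr n) : Expr n
  -- the signature: types and terms of level `α`, and lifting
  | tp {n : ℕ} (α : ℕ) : Expr n
  | tm {n : ℕ} (α : ℕ) (A : Expr n) : Expr n
  | lift {n : ℕ} (α β : ℕ) (A : Expr n) : Expr n
  -- dependent pair types; `pair` and `unpair` are the two directions of the isomorphism
  | sigma {n : ℕ} (α : ℕ) (A B : Expr n) : Expr n
  | pair {n : ℕ} (α : ℕ) (A B x : Expr n) : Expr n
  | unpair {n : ℕ} (α : ℕ) (A B y : Expr n) : Expr n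
  -- intensional identity types
  | eq {n : ℕ} (α : ℕ) (A a b : Expr n) : Expr n
  | refl {n : ℕ} (α : ℕ) (A a : Expr n) : Expr n
  | eqind {n : ℕ} (α : ℕ) (A a P b p s : Expr n) : Expr n
  -- dependent function types; `abs` and `unabs` are the two directions of the isomorphism
  | pi {n : ℕ} (α : ℕ) (A B : Expr n) : Expr n
  | abs {n : ℕ} (α : ℕ) (A B f : Expr n) : Expr n
  | unabs {n : ℕ} (α : ℕ) (A B g : Expr n) : Expr n
  -- empty type, unit type, natural numbers
  | empty {n : ℕ} : Expr n
  | exfalso {n : ℕ} (B x : Expr n) : Expr n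
  | unit {n : ℕ} : Expr n
  | star {n : ℕ} : Expr n
  | unitind {n : ℕ} (B b x : Expr n) : Expr n
  | nat {n : ℕ} : Expr n
  | zero {n : ℕ} : Expr n
  | suc {n : ℕ} (x : Expr n) : Expr n
  | ind {n : ℕ} (B bz bs x : Expr n) : Expr n
  -- universes
  | univ {n : ℕ} (α : ℕ) : Expr n

/-- Extension of a renaming under a binder. -/
def upRen {m n : ℕ} (ρ : Fin m → Fin n) : Fin (m + 1) → Fin (n + 1) :=
  Fin.cases 0 (fun i => (ρ i).succ)

namespace Expr

/-- Renaming of the variables. -/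
def rename : {m n : ℕ} → (Fin m → Fin n) → Expr m → Expr n
  | _, _, ρ, var i => var (ρ i)
  | _, _, _, lfUnit => lfUnit
  | _, _, _, lfStar => lfStar
  | _, _, ρ, lfPi A B => lfPi (A.rename ρ) (B.rename (upRen ρ))
  | _, _, ρ, lfLam A B t => lfLam (A.rename ρ) (B.rename (upRen ρ)) (t.rename (upRen ρ))
  | _, _, ρ, lfApp A B f a => lfApp (A.rename ρ) (B.rename (upRen ρ)) (f.rename ρ) (a.rename ρ)
  | _, _, ρ, lfSig A B => lfSig (A.rename ρ) (B.rename (upRen ρ))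
  | _, _, ρ, lfPair A B a b => lfPair (A.rename ρ) (B.rename (upRen ρ)) (a.rename ρ) (b.rename ρ)
  | _, _, ρ, lfFst A B p => lfFst (A.rename ρ) (B.rename (upRen ρ)) (p.rename ρ)
  | _, _, ρ, lfSnd A B p => lfSnd (A.rename ρ) (B.rename (upRen ρ)) (p.rename ρ)
  | _, _, ρ, lfEq A a b => lfEq (A.rename ρ) (a.rename ρ) (b.rename ρ)
  | _, _, ρ, lfRefl A a => lfRefl (A.rename ρ) (a.rename ρ)
  | _, _, _, tp α => tp α
  | _, _, ρ, tm α A => tm α (A.rename ρ)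
  | _, _, ρ, lift α β A => lift α β (A.rename ρ)
  | _, _, ρ, sigma α A B => sigma α (A.rename ρ) (B.rename ρ)
  | _, _, ρ, pair α A B x => pair α (A.rename ρ) (B.rename ρ) (x.rename ρ)
  | _, _, ρ, unpair α A B y => unpair α (A.rename ρ) (B.rename ρ) (y.rename ρ)
  | _, _, ρ, eq α A a b => eq α (A.rename ρ) (a.rename ρ) (b.rename ρ)
  | _, _, ρ, refl α A a => refl α (A.rename ρ) (a.rename ρ)
  | _, _, ρ, eqind α A a P b p s =>
      eqind α (A.rename ρ) (a.rename ρ) (P.rename ρ) (b.rename ρ) (p.rename ρ) (s.rename ρ)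
  | _, _, ρ, pi α A B => pi α (A.rename ρ) (B.rename ρ)
  | _, _, ρ, abs α A B f => abs α (A.rename ρ) (B.rename ρ) (f.rename ρ)
  | _, _, ρ, unabs α A B g => unabs α (A.rename ρ) (B.rename ρ) (g.rename ρ)
  | _, _, _, empty => empty
  | _, _, ρ, exfalso B x => exfalso (B.rename ρ) (x.rename ρ)
  | _, _, _, unit => unit
  | _, _, _, star => star
  | _, _, ρ, unitind B b x => unitind (B.rename ρ) (b.rename ρ) (x.rename ρ)
  | _, _, _, nat => nat
  | _, _, _, zero => zero
  | _, _, ρ, suc x => suc (x.rename ρ)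
  | _, _, ρ, ind B bz bs x => ind (B.rename ρ) (bz.rename ρ) (bs.rename ρ) (x.rename ρ)
  | _, _, _, univ α => univ α

/-- Weakening by one fresh variable. -/
abbrev wk {n : ℕ} (t : Expr n) : Expr (n + 1) := t.rename Fin.succ

/-- The most recently bound variable. -/
abbrev v0 {n : ℕ} : Expr (n + 1) := var 0

end Expr

/-- Extension of a substitution under a binder. -/
def upSub {m n : ℕ} (σ : Fin m → Expr n) : Fin (m + 1) → Expr (n + 1) :=
  Fin.cases Expr.v0 (fun i => (σ i).wk)

namespace Expr

/-- Simultaneous capture-avoiding substitution. -/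
def subst : {m n : ℕ} → (Fin m → Expr n) → Expr m → Expr n
  | _, _, σ, var i => σ i
  | _, _, _, lfUnit => lfUnit
  | _, _, _, lfStar => lfStar
  | _, _, σ, lfPi A B => lfPi (A.subst σ) (B.subst (upSub σ))
  | _, _, σ, lfLam A B t => lfLam (A.subst σ) (B.subst (upSub σ)) (t.subst (upSub σ))
  | _, _, σ, lfApp A B f a => lfApp (A.subst σ) (B.subst (upSub σ)) (f.subst σ) (a.subst σ)
  | _, _, σ, lfSig A B => lfSig (A.subst σ) (B.subst (upSub σ))
  | _, _, σ, lfPair A B a b => lfPair (A.subst σ) (B.subst (upSub σ)) (a.subst σ) (b.subst σ)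
  | _, _, σ, lfFst A B p => lfFst (A.subst σ) (B.subst (upSub σ)) (p.subst σ)
  | _, _, σ, lfSnd A B p => lfSnd (A.subst σ) (B.subst (upSub σ)) (p.subst σ)
  | _, _, σ, lfEq A a b => lfEq (A.subst σ) (a.subst σ) (b.subst σ)
  | _, _, σ, lfRefl A a => lfRefl (A.subst σ) (a.subst σ)
  | _, _, _, tp α => tp α
  | _, _, σ, tm α A => tm α (A.subst σ)
  | _, _, σ, lift α β A => lift α β (A.subst σ)
  | _, _, σ, sigma α A B => sigma α (A.subst σ) (B.subst σ)
  | _, _, σ, pair α A B x => pair α (A.subst σ) (B.subst σ) (x.subst σ)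
  | _, _, σ, unpair α A B y => unpair α (A.subst σ) (B.subst σ) (y.subst σ)
  | _, _, σ, eq α A a b => eq α (A.subst σ) (a.subst σ) (b.subst σ)
  | _, _, σ, refl α A a => refl α (A.subst σ) (a.subst σ)
  | _, _, σ, eqind α A a P b p s =>
      eqind α (A.subst σ) (a.subst σ) (P.subst σ) (b.subst σ) (p.subst σ) (s.subst σ)
  | _, _, σ, pi α A B => pi α (A.subst σ) (B.subst σ)
  | _, _, σ, abs α A B f => abs α (A.subst σ) (B.subst σ) (f.subst σ)
  | _, _, σ, unabs α A B g => unabs α (A.subst σ) (B.subst σ) (g.subst σ)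
  | _, _, _, empty => empty
  | _, _, σ, exfalso B x => exfalso (B.subst σ) (x.subst σ)
  | _, _, _, unit => unit
  | _, _, _, star => star
  | _, _, σ, unitind B b x => unitind (B.subst σ) (b.subst σ) (x.subst σ)
  | _, _, _, nat => nat
  | _, _, _, zero => zero
  | _, _, σ, suc x => suc (x.subst σ)
  | _, _, σ, ind B bz bs x => ind (B.subst σ) (bz.subst σ) (bs.subst σ) (x.subst σ)
  | _, _, _, univ α => univ α

/-- `B.inst a` is `B` with its last variable replaced by `a`. -/
def inst {n : ℕ} (B : Expr (n + 1)) (a : Expr n) : Expr n :=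
  B.subst (Fin.cases a var)

/-- `B(x)` for a family `B : tm α A → tp α` and `x : tm α A`. -/
def fam {n : ℕ} (α : ℕ) (A B x : Expr n) : Expr n :=
  lfApp (tm α A) (tp α) B x

/-- The judgement `(x : tm α A) → tp α` of families of types of level `α` over `A`. -/
def Fam {n : ℕ} (α : ℕ) (A : Expr n) : Expr n :=
  lfPi (tm α A) (tp α)

/-- The judgement `(p : tm α (eq α A a b)) → tp α`, with `b` the last variable. -/
def EqFamAt {n : ℕ} (α : ℕ) (A a : Expr n) : Expr (n + 1) :=
  lfPi (tm α (eq α A.wk a.wk v0)) (tp α)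

/-- The judgement `(b : tm α A) → (p : tm α (eq α A a b)) → tp α` of motives of `eqind`. -/
def EqFam {n : ℕ} (α : ℕ) (A a : Expr n) : Expr n :=
  lfPi (tm α A) (EqFamAt α A a)

/-- `P(b, p)` for a motive `P` of `eqind`. -/
def eqFam {n : ℕ} (α : ℕ) (A a P b p : Expr n) : Expr n :=
  lfApp (tm α (eq α A a b)) (tp α) (lfApp (tm α A) (EqFamAt α A a) P b) p

/-- `tm 0 (B n) → tm 0 (B (suc n))`, with `n` the last variable. -/
def StepAt {n : ℕ} (B : Expr n) : Expr (n + 1) :=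
  lfPi (tm 0 (fam 0 nat B.wk v0)) (tm 0 (fam 0 nat B.wk.wk (suc (var 1))))

/-- The judgement `(n : tm 0 nat) → tm 0 (B n) → tm 0 (B (suc n))`. -/
def Step {n : ℕ} (B : Expr n) : Expr n :=
  lfPi (tm 0 nat) (StepAt B)

/-- `bs(x, y)` for `bs : Step B`, `x : tm 0 nat` and `y : tm 0 (B x)`. -/
def step {n : ℕ} (B bs x y : Expr n) : Expr n :=
  lfApp (tm 0 (fam 0 nat B x)) (tm 0 (fam 0 nat B.wk (suc x.wk)))
    (lfApp (tm 0 nat) (StepAt B) bs x) y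

/-- The judgement `(a : tm α A) × tm α (B a)`. -/
def Pairs {n : ℕ} (α : ℕ) (A B : Expr n) : Expr n :=
  lfSig (tm α A) (tm α (fam α A.wk B.wk v0))

/-- The judgement `(a : tm α A) → tm α (B a)`. -/
def Sections {n : ℕ} (α : ℕ) (A B : Expr n) : Expr n :=
  lfPi (tm α A) (tm α (fam α A.wk B.wk v0))

/-- The family `a ↦ lift α β (B a)`. -/
def liftFam {n : ℕ} (α β : ℕ) (A B : Expr n) : Expr n :=
  lfLam (tm α A) (tp β) (lift α β (fam α A.wk B.wk v0))

end Expr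

/-- Contexts of length `n`; each entry may depend on the previous ones. -/
inductive Ctx : ℕ → Type
  | nil : Ctx 0
  | snoc {n : ℕ} (Γ : Ctx n) (A : Expr n) : Ctx (n + 1)

/-- The judgement assigned to a variable by a context. -/
def Ctx.get : {n : ℕ} → Ctx n → Fin n → Expr n
  | _, .nil => Fin.elim0
  | _, .snoc Γ A => Fin.cases A.wk (fun i => (Γ.get i).wk)

/-- The assertions of the framework.  Well-formedness of a type `A` (an inhabitant of the
judgement classifier) is `tyEq Γ A A`, and typing of a term `t` is `tmEq Γ t t A`. -/
inductive Assertion : Type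
  | ctx {n : ℕ} (Γ : Ctx n) : Assertion
  | tyEq {n : ℕ} (Γ : Ctx n) (A B : Expr n) : Assertion
  | tmEq {n : ℕ} (Γ : Ctx n) (t u A : Expr n) : Assertion

open _root_.PRTT.Expr _root_.PRTT.Assertion

/-- Derivability for the theory with universe levels `{α : ℕ | α < ℓ}`, where `ℓ` is finite or
`⊤`.  Typing is the diagonal of judgemental equality, so every formation, introduction and
elimination rule is given together with its congruence rule; taking both sides equal gives the
usual rule. -/
inductive Der (ℓ : ℕ∞) : Assertion → Prop
  -- contexts, variables, equality, substitution
  | ctx_nil : Der ℓ (ctx .nil)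
  | ctx_snoc {n : ℕ} {Γ : Ctx n} {A : Expr n} :
      Der ℓ (ctx Γ) → Der ℓ (tyEq Γ A A) → Der ℓ (ctx (Γ.snoc A))
  | var {n : ℕ} {Γ : Ctx n} (i : Fin n) :
      Der ℓ (ctx Γ) → Der ℓ (tmEq Γ (.var i) (.var i) (Γ.get i))
  | ty_symm {n : ℕ} {Γ : Ctx n} {A B : Expr n} :
      Der ℓ (tyEq Γ A B) → Der ℓ (tyEq Γ B A)
  | ty_trans {n : ℕ} {Γ : Ctx n} {A B C : Expr n} :
      Der ℓ (tyEq Γ A B) → Der ℓ (tyEq Γ B C) → Der ℓ (tyEq Γ A C)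
  | tm_symm {n : ℕ} {Γ : Ctx n} {t u A : Expr n} :
      Der ℓ (tmEq Γ t u A) → Der ℓ (tmEq Γ u t A)
  | tm_trans {n : ℕ} {Γ : Ctx n} {t u v A : Expr n} :
      Der ℓ (tmEq Γ t u A) → Der ℓ (tmEq Γ u v A) → Der ℓ (tmEq Γ t v A)
  | tm_conv {n : ℕ} {Γ : Ctx n} {t u A B : Expr n} :
      Der ℓ (tmEq Γ t u A) → Der ℓ (tyEq Γ A B) → Der ℓ (tmEq Γ t u B)
  | ty_subst {m n : ℕ} {Γ : Ctx n} {Δ : Ctx m} {σ τ : Fin m → Expr n} {A B : Expr m} :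
      Der ℓ (ctx Γ) → (∀ i, Der ℓ (tmEq Γ (σ i) (τ i) ((Δ.get i).subst σ))) →
      Der ℓ (tyEq Δ A B) → Der ℓ (tyEq Γ (A.subst σ) (B.subst τ))
  | tm_subst {m n : ℕ} {Γ : Ctx n} {Δ : Ctx m} {σ τ : Fin m → Expr n} {t u A : Expr m} :
      Der ℓ (ctx Γ) → (∀ i, Der ℓ (tmEq Γ (σ i) (τ i) ((Δ.get i).subst σ))) →
      Der ℓ (tmEq Δ t u A) → Der ℓ (tmEq Γ (t.subst σ) (u.subst τ) (A.subst σ))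
  -- framework: unit
  | lfUnit {n : ℕ} {Γ : Ctx n} : Der ℓ (ctx Γ) → Der ℓ (tyEq Γ lfUnit lfUnit)
  | lfStar {n : ℕ} {Γ : Ctx n} : Der ℓ (ctx Γ) → Der ℓ (tmEq Γ lfStar lfStar lfUnit)
  | lfUnit_eta {n : ℕ} {Γ : Ctx n} {t : Expr n} :
      Der ℓ (tmEq Γ t t lfUnit) → Der ℓ (tmEq Γ t lfStar lfUnit)
  -- framework: dependent products
  | lfPi {n : ℕ} {Γ : Ctx n} {A A' : Expr n} {B B' : Expr (n + 1)} :
      Der ℓ (tyEq Γ A A') → Der ℓ (tyEq (Γ.snoc A) B B') →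
      Der ℓ (tyEq Γ (lfPi A B) (lfPi A' B'))
  | lfLam {n : ℕ} {Γ : Ctx n} {A A' : Expr n} {B B' t t' : Expr (n + 1)} :
      Der ℓ (tyEq Γ A A') → Der ℓ (tyEq (Γ.snoc A) B B') →
      Der ℓ (tmEq (Γ.snoc A) t t' B) →
      Der ℓ (tmEq Γ (lfLam A B t) (lfLam A' B' t') (lfPi A B))
  | lfApp {n : ℕ} {Γ : Ctx n} {A A' f f' a a' : Expr n} {B B' : Expr (n + 1)} :
      Der ℓ (tyEq Γ A A') → Der ℓ (tyEq (Γ.snoc A) B B') →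
      Der ℓ (tmEq Γ f f' (lfPi A B)) → Der ℓ (tmEq Γ a a' A) →
      Der ℓ (tmEq Γ (lfApp A B f a) (lfApp A' B' f' a') (B.inst a))
  | lfPi_beta {n : ℕ} {Γ : Ctx n} {A a : Expr n} {B t : Expr (n + 1)} :
      Der ℓ (tyEq Γ A A) → Der ℓ (tyEq (Γ.snoc A) B B) →
      Der ℓ (tmEq (Γ.snoc A) t t B) → Der ℓ (tmEq Γ a a A) →
      Der ℓ (tmEq Γ (lfApp A B (lfLam A B t) a) (t.inst a) (B.inst a))
  | lfPi_eta {n : ℕ} {Γ : Ctx n} {A f : Expr n} {B : Expr (n + 1)} :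
      Der ℓ (tyEq Γ A A) → Der ℓ (tyEq (Γ.snoc A) B B) →
      Der ℓ (tmEq Γ f f (lfPi A B)) →
      Der ℓ (tmEq Γ (lfLam A B (lfApp A.wk (B.rename (upRen Fin.succ)) f.wk v0)) f (lfPi A B))
  -- framework: dependent sums
  | lfSig {n : ℕ} {Γ : Ctx n} {A A' : Expr n} {B B' : Expr (n + 1)} :
      Der ℓ (tyEq Γ A A') → Der ℓ (tyEq (Γ.snoc A) B B') →
      Der ℓ (tyEq Γ (lfSig A B) (lfSig A' B'))
  | lfPair {n : ℕ} {Γ : Ctx n} {A A' a a' b b' : Expr n} {B B' : Expr (n + 1)} :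
      Der ℓ (tyEq Γ A A') → Der ℓ (tyEq (Γ.snoc A) B B') →
      Der ℓ (tmEq Γ a a' A) → Der ℓ (tmEq Γ b b' (B.inst a)) →
      Der ℓ (tmEq Γ (lfPair A B a b) (lfPair A' B' a' b') (lfSig A B))
  | lfFst {n : ℕ} {Γ : Ctx n} {A A' p p' : Expr n} {B B' : Expr (n + 1)} :
      Der ℓ (tyEq Γ A A') → Der ℓ (tyEq (Γ.snoc A) B B') →
      Der ℓ (tmEq Γ p p' (lfSig A B)) →
      Der ℓ (tmEq Γ (lfFst A B p) (lfFst A' B' p') A)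
  | lfSnd {n : ℕ} {Γ : Ctx n} {A A' p p' : Expr n} {B B' : Expr (n + 1)} :
      Der ℓ (tyEq Γ A A') → Der ℓ (tyEq (Γ.snoc A) B B') →
      Der ℓ (tmEq Γ p p' (lfSig A B)) →
      Der ℓ (tmEq Γ (lfSnd A B p) (lfSnd A' B' p') (B.inst (lfFst A B p)))
  | lfSig_fst {n : ℕ} {Γ : Ctx n} {A a b : Expr n} {B : Expr (n + 1)} :
      Der ℓ (tyEq Γ A A) → Der ℓ (tyEq (Γ.snoc A) B B) →
      Der ℓ (tmEq Γ a a A) → Der ℓ (tmEq Γ b b (B.inst a)) →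
      Der ℓ (tmEq Γ (lfFst A B (lfPair A B a b)) a A)
  | lfSig_snd {n : ℕ} {Γ : Ctx n} {A a b : Expr n} {B : Expr (n + 1)} :
      Der ℓ (tyEq Γ A A) → Der ℓ (tyEq (Γ.snoc A) B B) →
      Der ℓ (tmEq Γ a a A) → Der ℓ (tmEq Γ b b (B.inst a)) →
      Der ℓ (tmEq Γ (lfSnd A B (lfPair A B a b)) b (B.inst a))
  | lfSig_eta {n : ℕ} {Γ : Ctx n} {A p : Expr n} {B : Expr (n + 1)} :
      Der ℓ (tyEq Γ A A) → Der ℓ (tyEq (Γ.snoc A) B B) →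
      Der ℓ (tmEq Γ p p (lfSig A B)) →
      Der ℓ (tmEq Γ (lfPair A B (lfFst A B p) (lfSnd A B p)) p (lfSig A B))
  -- framework: extensional equality
  | lfEq {n : ℕ} {Γ : Ctx n} {A A' a a' b b' : Expr n} :
      Der ℓ (tyEq Γ A A') → Der ℓ (tmEq Γ a a' A) → Der ℓ (tmEq Γ b b' A) →
      Der ℓ (tyEq Γ (lfEq A a b) (lfEq A' a' b'))
  | lfRefl {n : ℕ} {Γ : Ctx n} {A A' a a' : Expr n} :
      Der ℓ (tyEq Γ A A') → Der ℓ (tmEq Γ a a' A) →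
      Der ℓ (tmEq Γ (lfRefl A a) (lfRefl A' a') (lfEq A a a))
  | lfEq_reflection {n : ℕ} {Γ : Ctx n} {A a b p : Expr n} :
      Der ℓ (tyEq Γ A A) → Der ℓ (tmEq Γ a a A) → Der ℓ (tmEq Γ b b A) →
      Der ℓ (tmEq Γ p p (lfEq A a b)) → Der ℓ (tmEq Γ a b A)
  | lfEq_eta {n : ℕ} {Γ : Ctx n} {A a b p : Expr n} :
      Der ℓ (tyEq Γ A A) → Der ℓ (tmEq Γ a a A) → Der ℓ (tmEq Γ b b A) →
      Der ℓ (tmEq Γ p p (lfEq A a b)) → Der ℓ (tmEq Γ p (lfRefl A a) (lfEq A a b))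
  -- types and terms of level `α`, lifting
  | tp {n : ℕ} {Γ : Ctx n} {α : ℕ} :
      (α : ℕ∞) < ℓ → Der ℓ (ctx Γ) → Der ℓ (tyEq Γ (tp α) (tp α))
  | tm {n : ℕ} {Γ : Ctx n} {α : ℕ} {A A' : Expr n} :
      Der ℓ (tmEq Γ A A' (tp α)) → Der ℓ (tyEq Γ (tm α A) (tm α A'))
  | lift {n : ℕ} {Γ : Ctx n} {α β : ℕ} {A A' : Expr n} :
      α ≤ β → (β : ℕ∞) < ℓ → Der ℓ (tmEq Γ A A' (tp α)) →
      Der ℓ (tmEq Γ (lift α β A) (lift α β A') (tp β))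
  | lift_self {n : ℕ} {Γ : Ctx n} {α : ℕ} {A : Expr n} :
      Der ℓ (tmEq Γ A A (tp α)) → Der ℓ (tmEq Γ (lift α α A) A (tp α))
  | lift_lift {n : ℕ} {Γ : Ctx n} {α β γ : ℕ} {A : Expr n} :
      α ≤ β → β ≤ γ → (γ : ℕ∞) < ℓ → Der ℓ (tmEq Γ A A (tp α)) →
      Der ℓ (tmEq Γ (lift β γ (lift α β A)) (lift α γ A) (tp γ))
  | tm_lift {n : ℕ} {Γ : Ctx n} {α β : ℕ} {A : Expr n} :
      α ≤ β → (β : ℕ∞) < ℓ → Der ℓ (tmEq Γ A A (tp α)) →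
      Der ℓ (tyEq Γ (tm α A) (tm β (lift α β A)))
  | lift_inj {n : ℕ} {Γ : Ctx n} {α β : ℕ} {A B : Expr n} :
      α ≤ β → (β : ℕ∞) < ℓ → Der ℓ (tmEq Γ A A (tp α)) → Der ℓ (tmEq Γ B B (tp α)) →
      Der ℓ (tmEq Γ (lift α β A) (lift α β B) (tp β)) → Der ℓ (tmEq Γ A B (tp α))
  -- dependent pair types; `pair_lift`, like `refl_lift` and `abs_lift` below, says that the
  -- introduction form is the same term at every level at which its type occurs
  | sigma {n : ℕ} {Γ : Ctx n} {α : ℕ} {A A' B B' : Expr n} :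
      Der ℓ (tmEq Γ A A' (tp α)) → Der ℓ (tmEq Γ B B' (Fam α A)) →
      Der ℓ (tmEq Γ (sigma α A B) (sigma α A' B') (tp α))
  | pair {n : ℕ} {Γ : Ctx n} {α : ℕ} {A A' B B' x x' : Expr n} :
      Der ℓ (tmEq Γ A A' (tp α)) → Der ℓ (tmEq Γ B B' (Fam α A)) →
      Der ℓ (tmEq Γ x x' (Pairs α A B)) →
      Der ℓ (tmEq Γ (pair α A B x) (pair α A' B' x') (tm α (sigma α A B)))
  | unpair {n : ℕ} {Γ : Ctx n} {α : ℕ} {A A' B B' y y' : Expr n} :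
      Der ℓ (tmEq Γ A A' (tp α)) → Der ℓ (tmEq Γ B B' (Fam α A)) →
      Der ℓ (tmEq Γ y y' (tm α (sigma α A B))) →
      Der ℓ (tmEq Γ (unpair α A B y) (unpair α A' B' y') (Pairs α A B))
  | unpair_pair {n : ℕ} {Γ : Ctx n} {α : ℕ} {A B x : Expr n} :
      Der ℓ (tmEq Γ A A (tp α)) → Der ℓ (tmEq Γ B B (Fam α A)) →
      Der ℓ (tmEq Γ x x (Pairs α A B)) →
      Der ℓ (tmEq Γ (unpair α A B (pair α A B x)) x (Pairs α A B))
  | pair_unpair {n : ℕ} {Γ : Ctx n} {α : ℕ} {A B y : Expr n} :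
      Der ℓ (tmEq Γ A A (tp α)) → Der ℓ (tmEq Γ B B (Fam α A)) →
      Der ℓ (tmEq Γ y y (tm α (sigma α A B))) →
      Der ℓ (tmEq Γ (pair α A B (unpair α A B y)) y (tm α (sigma α A B)))
  | lift_sigma {n : ℕ} {Γ : Ctx n} {α β : ℕ} {A B : Expr n} :
      α ≤ β → (β : ℕ∞) < ℓ →
      Der ℓ (tmEq Γ A A (tp α)) → Der ℓ (tmEq Γ B B (Fam α A)) →
      Der ℓ (tmEq Γ (lift α β (sigma α A B)) (sigma β (lift α β A) (liftFam α β A B)) (tp β))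
  | pair_lift {n : ℕ} {Γ : Ctx n} {α β : ℕ} {A B x : Expr n} :
      α ≤ β → (β : ℕ∞) < ℓ →
      Der ℓ (tmEq Γ A A (tp α)) → Der ℓ (tmEq Γ B B (Fam α A)) →
      Der ℓ (tmEq Γ x x (Pairs α A B)) →
      Der ℓ (tmEq Γ (pair α A B x) (pair β (lift α β A) (liftFam α β A B) x)
        (tm α (sigma α A B)))
  -- identity types
  | eq {n : ℕ} {Γ : Ctx n} {α : ℕ} {A A' a a' b b' : Expr n} :
      Der ℓ (tmEq Γ A A' (tp α)) → Der ℓ (tmEq Γ a a' (tm α A)) →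
      Der ℓ (tmEq Γ b b' (tm α A)) →
      Der ℓ (tmEq Γ (eq α A a b) (eq α A' a' b') (tp α))
  | refl {n : ℕ} {Γ : Ctx n} {α : ℕ} {A A' a a' : Expr n} :
      Der ℓ (tmEq Γ A A' (tp α)) → Der ℓ (tmEq Γ a a' (tm α A)) →
      Der ℓ (tmEq Γ (refl α A a) (refl α A' a') (tm α (eq α A a a)))
  | eqind {n : ℕ} {Γ : Ctx n} {α : ℕ} {A A' a a' P P' b b' p p' s s' : Expr n} :
      Der ℓ (tmEq Γ A A' (tp α)) → Der ℓ (tmEq Γ a a' (tm α A)) →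
      Der ℓ (tmEq Γ P P' (EqFam α A a)) → Der ℓ (tmEq Γ b b' (tm α A)) →
      Der ℓ (tmEq Γ p p' (tm α (eq α A a b))) →
      Der ℓ (tmEq Γ s s' (tm α (eqFam α A a P a (refl α A a)))) →
      Der ℓ (tmEq Γ (eqind α A a P b p s) (eqind α A' a' P' b' p' s')
        (tm α (eqFam α A a P b p)))
  | eqind_refl {n : ℕ} {Γ : Ctx n} {α : ℕ} {A a P s : Expr n} :
      Der ℓ (tmEq Γ A A (tp α)) → Der ℓ (tmEq Γ a a (tm α A)) →
      Der ℓ (tmEq Γ P P (EqFam α A a)) →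
      Der ℓ (tmEq Γ s s (tm α (eqFam α A a P a (refl α A a)))) →
      Der ℓ (tmEq Γ s (eqind α A a P a (refl α A a) s)
        (tm α (eqFam α A a P a (refl α A a))))
  | lift_eq {n : ℕ} {Γ : Ctx n} {α β : ℕ} {A a b : Expr n} :
      α ≤ β → (β : ℕ∞) < ℓ →
      Der ℓ (tmEq Γ A A (tp α)) → Der ℓ (tmEq Γ a a (tm α A)) →
      Der ℓ (tmEq Γ b b (tm α A)) →
      Der ℓ (tmEq Γ (lift α β (eq α A a b)) (eq β (lift α β A) a b) (tp β))
  | refl_lift {n : ℕ} {Γ : Ctx n} {α β : ℕ} {A a : Expr n} :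
      α ≤ β → (β : ℕ∞) < ℓ →
      Der ℓ (tmEq Γ A A (tp α)) → Der ℓ (tmEq Γ a a (tm α A)) →
      Der ℓ (tmEq Γ (refl α A a) (refl β (lift α β A) a) (tm α (eq α A a a)))
  -- dependent function types: a function type over types of level `0` has level `1`
  | pi {n : ℕ} {Γ : Ctx n} {α : ℕ} {A A' B B' : Expr n} :
      ((max 1 α : ℕ) : ℕ∞) < ℓ →
      Der ℓ (tmEq Γ A A' (tp α)) → Der ℓ (tmEq Γ B B' (Fam α A)) →
      Der ℓ (tmEq Γ (pi α A B) (pi α A' B') (tp (max 1 α)))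
  | abs {n : ℕ} {Γ : Ctx n} {α : ℕ} {A A' B B' f f' : Expr n} :
      ((max 1 α : ℕ) : ℕ∞) < ℓ →
      Der ℓ (tmEq Γ A A' (tp α)) → Der ℓ (tmEq Γ B B' (Fam α A)) →
      Der ℓ (tmEq Γ f f' (Sections α A B)) →
      Der ℓ (tmEq Γ (abs α A B f) (abs α A' B' f') (tm (max 1 α) (pi α A B)))
  | unabs {n : ℕ} {Γ : Ctx n} {α : ℕ} {A A' B B' g g' : Expr n} :
      ((max 1 α : ℕ) : ℕ∞) < ℓ →
      Der ℓ (tmEq Γ A A' (tp α)) → Der ℓ (tmEq Γ B B' (Fam α A)) →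
      Der ℓ (tmEq Γ g g' (tm (max 1 α) (pi α A B))) →
      Der ℓ (tmEq Γ (unabs α A B g) (unabs α A' B' g') (Sections α A B))
  | unabs_abs {n : ℕ} {Γ : Ctx n} {α : ℕ} {A B f : Expr n} :
      ((max 1 α : ℕ) : ℕ∞) < ℓ →
      Der ℓ (tmEq Γ A A (tp α)) → Der ℓ (tmEq Γ B B (Fam α A)) →
      Der ℓ (tmEq Γ f f (Sections α A B)) →
      Der ℓ (tmEq Γ (unabs α A B (abs α A B f)) f (Sections α A B))
  | abs_unabs {n : ℕ} {Γ : Ctx n} {α : ℕ} {A B g : Expr n} :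
      ((max 1 α : ℕ) : ℕ∞) < ℓ →
      Der ℓ (tmEq Γ A A (tp α)) → Der ℓ (tmEq Γ B B (Fam α A)) →
      Der ℓ (tmEq Γ g g (tm (max 1 α) (pi α A B))) →
      Der ℓ (tmEq Γ (abs α A B (unabs α A B g)) g (tm (max 1 α) (pi α A B)))
  | lift_pi {n : ℕ} {Γ : Ctx n} {α β : ℕ} {A B : Expr n} :
      0 < α → α ≤ β → (β : ℕ∞) < ℓ →
      Der ℓ (tmEq Γ A A (tp α)) → Der ℓ (tmEq Γ B B (Fam α A)) →
      Der ℓ (tmEq Γ (lift α β (pi α A B)) (pi β (lift α β A) (liftFam α β A B)) (tp β))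
  | abs_lift {n : ℕ} {Γ : Ctx n} {α β : ℕ} {A B f : Expr n} :
      0 < α → α ≤ β → (β : ℕ∞) < ℓ →
      Der ℓ (tmEq Γ A A (tp α)) → Der ℓ (tmEq Γ B B (Fam α A)) →
      Der ℓ (tmEq Γ f f (Sections α A B)) →
      Der ℓ (tmEq Γ (abs α A B f) (abs β (lift α β A) (liftFam α β A B) f)
        (tm (max 1 α) (pi α A B)))
  -- empty type
  | empty {n : ℕ} {Γ : Ctx n} :
      0 < ℓ → Der ℓ (ctx Γ) → Der ℓ (tmEq Γ empty empty (tp 0))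
  | exfalso {n : ℕ} {Γ : Ctx n} {B B' x x' : Expr n} :
      Der ℓ (tmEq Γ B B' (Fam 0 empty)) → Der ℓ (tmEq Γ x x' (tm 0 empty)) →
      Der ℓ (tmEq Γ (exfalso B x) (exfalso B' x') (tm 0 (fam 0 empty B x)))
  -- unit type
  | unit {n : ℕ} {Γ : Ctx n} :
      0 < ℓ → Der ℓ (ctx Γ) → Der ℓ (tmEq Γ unit unit (tp 0))
  | star {n : ℕ} {Γ : Ctx n} :
      0 < ℓ → Der ℓ (ctx Γ) → Der ℓ (tmEq Γ star star (tm 0 unit))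
  | unitind {n : ℕ} {Γ : Ctx n} {B B' b b' x x' : Expr n} :
      Der ℓ (tmEq Γ B B' (Fam 0 unit)) → Der ℓ (tmEq Γ b b' (tm 0 (fam 0 unit B star))) →
      Der ℓ (tmEq Γ x x' (tm 0 unit)) →
      Der ℓ (tmEq Γ (unitind B b x) (unitind B' b' x') (tm 0 (fam 0 unit B x)))
  | unitind_star {n : ℕ} {Γ : Ctx n} {B b : Expr n} :
      Der ℓ (tmEq Γ B B (Fam 0 unit)) → Der ℓ (tmEq Γ b b (tm 0 (fam 0 unit B star))) →
      Der ℓ (tmEq Γ (unitind B b star) b (tm 0 (fam 0 unit B star)))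
  -- natural numbers, with elimination into types of level `0` only
  | nat {n : ℕ} {Γ : Ctx n} :
      0 < ℓ → Der ℓ (ctx Γ) → Der ℓ (tmEq Γ nat nat (tp 0))
  | zero {n : ℕ} {Γ : Ctx n} :
      0 < ℓ → Der ℓ (ctx Γ) → Der ℓ (tmEq Γ zero zero (tm 0 nat))
  | suc {n : ℕ} {Γ : Ctx n} {x x' : Expr n} :
      Der ℓ (tmEq Γ x x' (tm 0 nat)) → Der ℓ (tmEq Γ (suc x) (suc x') (tm 0 nat))
  | ind {n : ℕ} {Γ : Ctx n} {B B' bz bz' bs bs' x x' : Expr n} :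
      Der ℓ (tmEq Γ B B' (Fam 0 nat)) → Der ℓ (tmEq Γ bz bz' (tm 0 (fam 0 nat B zero))) →
      Der ℓ (tmEq Γ bs bs' (Step B)) → Der ℓ (tmEq Γ x x' (tm 0 nat)) →
      Der ℓ (tmEq Γ (ind B bz bs x) (ind B' bz' bs' x') (tm 0 (fam 0 nat B x)))
  | ind_zero {n : ℕ} {Γ : Ctx n} {B bz bs : Expr n} :
      Der ℓ (tmEq Γ B B (Fam 0 nat)) → Der ℓ (tmEq Γ bz bz (tm 0 (fam 0 nat B zero))) →
      Der ℓ (tmEq Γ bs bs (Step B)) →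
      Der ℓ (tmEq Γ (ind B bz bs zero) bz (tm 0 (fam 0 nat B zero)))
  | ind_suc {n : ℕ} {Γ : Ctx n} {B bz bs x : Expr n} :
      Der ℓ (tmEq Γ B B (Fam 0 nat)) → Der ℓ (tmEq Γ bz bz (tm 0 (fam 0 nat B zero))) →
      Der ℓ (tmEq Γ bs bs (Step B)) → Der ℓ (tmEq Γ x x (tm 0 nat)) →
      Der ℓ (tmEq Γ (ind B bz bs (suc x)) (step B bs x (ind B bz bs x))
        (tm 0 (fam 0 nat B (suc x))))
  -- universes
  | univ {n : ℕ} {Γ : Ctx n} {α : ℕ} :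
      ((α + 1 : ℕ) : ℕ∞) < ℓ → Der ℓ (ctx Γ) → Der ℓ (tmEq Γ (univ α) (univ α) (tp (α + 1)))
  | tm_univ {n : ℕ} {Γ : Ctx n} {α : ℕ} :
      ((α + 1 : ℕ) : ℕ∞) < ℓ → Der ℓ (ctx Γ) → Der ℓ (tyEq Γ (tm (α + 1) (univ α)) (tp α))

/-! ### Substitution lemmas on raw expressions -/

theorem upSub_var {m n : ℕ} (ρ : Fin m → Fin n) :
    upSub (fun i => .var (ρ i)) = fun i => .var (upRen ρ i) := by
  funext i; refine Fin.cases rfl (fun j => rfl) i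

theorem upSub_id {n : ℕ} : upSub (Expr.var : Fin n → Expr n) = Expr.var := by
  funext i; refine Fin.cases rfl (fun j => rfl) i

theorem Expr.rename_eq_subst {m : ℕ} (t : Expr m) :
    ∀ {n : ℕ} (ρ : Fin m → Fin n), t.rename ρ = t.subst (fun i => .var (ρ i)) := by
  induction t <;> intro n ρ <;> simp [Expr.rename, Expr.subst, upSub_var, *]

theorem Expr.subst_id {n : ℕ} (t : Expr n) : t.subst Expr.var = t := by
  induction t <;> simp [Expr.subst, upSub_id, *]

theorem upSub_comp_upRen {k m n : ℕ} (ρ : Fin k → Fin m) (σ : Fin m → Expr n) :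
    (fun i => upSub σ (upRen ρ i)) = upSub (fun i => σ (ρ i)) := by
  funext i; refine Fin.cases rfl (fun j => rfl) i

theorem Expr.subst_rename {k : ℕ} (t : Expr k) :
    ∀ {m n : ℕ} (ρ : Fin k → Fin m) (σ : Fin m → Expr n),
      (t.rename ρ).subst σ = t.subst (fun i => σ (ρ i)) := by
  induction t <;> intro m n ρ σ <;> simp [Expr.rename, Expr.subst, upSub_comp_upRen, *]

theorem upRen_comp {k m n : ℕ} (ρ : Fin k → Fin m) (θ : Fin m → Fin n) :
    (fun i => upRen θ (upRen ρ i)) = upRen (fun i => θ (ρ i)) := by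
  funext i; refine Fin.cases rfl (fun j => rfl) i

theorem Expr.rename_rename {k : ℕ} (t : Expr k) :
    ∀ {m n : ℕ} (ρ : Fin k → Fin m) (θ : Fin m → Fin n),
      (t.rename ρ).rename θ = t.rename (fun i => θ (ρ i)) := by
  induction t <;> intro m n ρ θ <;> simp [Expr.rename, upRen_comp, *]

theorem rename_upSub {k m n : ℕ} (σ : Fin k → Expr m) (ρ : Fin m → Fin n) :
    (fun i => (upSub σ i).rename (upRen ρ)) = upSub (fun i => (σ i).rename ρ) := by
  funext i
  refine Fin.cases rfl (fun j => ?_) i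
  simp only [upSub, Fin.cases_succ, Expr.wk, Expr.rename_rename]
  rfl

theorem Expr.rename_subst {k : ℕ} (t : Expr k) :
    ∀ {m n : ℕ} (σ : Fin k → Expr m) (ρ : Fin m → Fin n),
      (t.subst σ).rename ρ = t.subst (fun i => (σ i).rename ρ) := by
  induction t <;> intro m n σ ρ <;> simp [Expr.rename, Expr.subst, rename_upSub, *]

theorem subst_upSub {k m n : ℕ} (σ : Fin k → Expr m) (τ : Fin m → Expr n) :
    (fun i => (upSub σ i).subst (upSub τ)) = upSub (fun i => (σ i).subst τ) := by
  funext i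
  refine Fin.cases rfl (fun j => ?_) i
  simp only [upSub, Fin.cases_succ, Expr.wk, Expr.subst_rename, Expr.rename_subst]

theorem Expr.subst_subst {k : ℕ} (t : Expr k) :
    ∀ {m n : ℕ} (σ : Fin k → Expr m) (τ : Fin m → Expr n),
      (t.subst σ).subst τ = t.subst (fun i => (σ i).subst τ) := by
  induction t <;> intro m n σ τ <;> simp [Expr.subst, subst_upSub, *]

theorem Expr.wk_subst_closed (C : Expr 0) {n : ℕ} (σ : Fin 1 → Expr (n + 1)) :
    C.wk.subst σ = (C.rename Fin.elim0 : Expr (n + 1)) := by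
  rw [Expr.subst_rename, Expr.rename_eq_subst]
  congr 1
  funext i
  exact i.elim0

theorem Expr.wk_closed (C : Expr 0) : (C.rename Fin.elim0 : Expr 1) = C.wk := by
  unfold Expr.wk
  congr 1
  funext i
  exact i.elim0

/-! ### The category of judgements -/

/-- The objects of the category `T_pr` of judgements: the closed well-formed judgements. -/
structure Tpr (ℓ : ℕ∞) where
  /-- The underlying closed expression. -/
  expr : Expr 0
  /-- It is a well-formed judgement. -/
  wf : Der ℓ (tyEq .nil expr expr)

namespace Tpr

variable {ℓ : ℕ∞}

/-- The context with one variable. -/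
def ctx (X : Tpr ℓ) : Ctx 1 := Ctx.nil.snoc X.expr

theorem der_ctx (X : Tpr ℓ) : Der ℓ (Assertion.ctx X.ctx) :=
  Der.ctx_snoc Der.ctx_nil X.wf

/-- Terms of the judgement `Y` in one variable of the judgement `X`. -/
def RawHom (X Y : Tpr ℓ) : Type :=
  {t : Expr 1 // Der ℓ (tmEq X.ctx t t Y.expr.wk)}

/-- Judgemental equality of terms. -/
instance homSetoid (X Y : Tpr ℓ) : Setoid (RawHom X Y) where
  r t u := Der ℓ (tmEq X.ctx t.1 u.1 Y.expr.wk)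
  iseqv := ⟨fun t => t.2, fun h => Der.tm_symm h, fun h h' => Der.tm_trans h h'⟩

theorem der_comp {X Y Z : Tpr ℓ} {t t' u u' : Expr 1}
    (ht : Der ℓ (tmEq X.ctx t t' Y.expr.wk)) (hu : Der ℓ (tmEq Y.ctx u u' Z.expr.wk)) :
    Der ℓ (tmEq X.ctx (u.subst fun _ => t) (u'.subst fun _ => t') Z.expr.wk) := by
  have h := Der.tm_subst (σ := fun _ => t) (τ := fun _ => t') X.der_ctx (fun i => by
    have hi : Y.ctx.get i = Y.expr.wk := by
      obtain rfl : i = 0 := Subsingleton.elim _ _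
      rfl
    rw [hi, Expr.wk_subst_closed, Expr.wk_closed]
    exact ht) hu
  rwa [Expr.wk_subst_closed, Expr.wk_closed] at h

/-- The category of judgements: a morphism from `X` to `Y` is a term `x : X ⊢ t : Y` up to
judgemental equality, and composition is substitution. -/
instance : CategoryTheory.Category (Tpr ℓ) where
  Hom X Y := Quotient (homSetoid X Y)
  id X := Quotient.mk _ ⟨.var 0, Der.var 0 X.der_ctx⟩
  comp {X Y Z} f g :=
    Quotient.map₂ (fun (t : RawHom X Y) (u : RawHom Y Z) =>
      (⟨u.1.subst fun _ => t.1, der_comp t.2 u.2⟩ : RawHom X Z))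
      (fun _ _ ht _ _ hu => der_comp ht hu) f g
  id_comp {X Y} f := by
    refine Quotient.inductionOn f (fun t => ?_)
    refine congrArg (Quotient.mk _) (Subtype.ext ?_)
    have h : (fun _ => .var 0 : Fin 1 → Expr 1) = Expr.var := by
      funext i
      rw [Subsingleton.elim i 0]
    change t.1.subst (fun _ => .var 0) = t.1
    rw [h, Expr.subst_id]
  comp_id {X Y} f := by
    refine Quotient.inductionOn f (fun t => ?_)
    rfl
  assoc {W X Y Z} f g h := by
    refine Quotient.inductionOn₃ f g h (fun t u v => ?_)
    refine congrArg (Quotient.mk _) (Subtype.ext ?_)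
    change v.1.subst (fun _ => u.1.subst fun _ => t.1) =
      (v.1.subst fun _ => u.1).subst fun _ => t.1
    rw [Expr.subst_subst]

/-- The unit judgement `1`. -/
def one (ℓ : ℕ∞) : Tpr ℓ := ⟨.lfUnit, Der.lfUnit Der.ctx_nil⟩

/-- The judgement `tm₀(N)` of terms of the type of natural numbers. -/
def tmN (hℓ : 2 ≤ ℓ) : Tpr ℓ :=
  ⟨.tm 0 .nat, Der.tm (Der.nat (lt_of_lt_of_le (by norm_num) hℓ) Der.ctx_nil)⟩

/-- The global element `z : 1 ⟶ tm₀(N)`. -/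
def z (hℓ : 2 ≤ ℓ) : one ℓ ⟶ tmN hℓ :=
  Quotient.mk _ ⟨.zero, Der.zero (lt_of_lt_of_le (by norm_num) hℓ) (one ℓ).der_ctx⟩

/-- The successor `s : tm₀(N) ⟶ tm₀(N)`. -/
def s (hℓ : 2 ≤ ℓ) : tmN hℓ ⟶ tmN hℓ :=
  Quotient.mk _ ⟨.suc (.var 0), Der.suc (Der.var 0 (tmN hℓ).der_ctx)⟩

open CategoryTheory in
/-- The numeral `sⁿ(z)`. -/
def numeral (hℓ : 2 ≤ ℓ) : ℕ → (one ℓ ⟶ tmN hℓ)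
  | 0 => z hℓ
  | n + 1 => numeral hℓ n ≫ s hℓ

end Tpr

end PRTT

/-! The argument is Tait's computability method, carried out with partial equivalence relations on
closed expressions. Closed expressions are evaluated to weak head canonical forms by a
deterministic, untyped evaluation `Ev` that ignores annotations and lifts. Each closed judgement is
interpreted by a relation that is symmetric and transitive, contains only derivable equalities, and
is closed under expansion along evaluation (`Good`). Two terms of the natural numbers type are
related by `NatR` when they evaluate, layer by layer, to the same numeral and every layer is also a
derivable equality. Two functions are related when they are derivably equal and send related
arguments to related results, and so on. The fundamental theorem `Der.valid` says that derivable
equalities hold in these relations under all pairs of related closing substitutions. For a closed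
term of the natural numbers type it yields an instance of `NatR`, from which the numeral and the
derivation are read off.

Derivability is stored in the relations rather than recovered from evaluation. Hence no
normalization of open terms is needed, and equality reflection is harmless: a related pair of proofs
of `lfEq A a b` carries the fact that `a` and `b` are related.

Because terms of a universe are types, the relation of a type cannot be defined by recursion on the
expression. Instead `IsTy` is an inductively defined graph between types and relations, parametrised
by the interpretation of the universes; at level `α` it uses only universes below `α`
(`IsTy.congr_univ`), so the interpretation `Univ` exists by well-founded recursion on the level. By
`IsTy.det` the graph is functional, and the relation depends on the value of the type alone.

Two types are equal in the model when they are derivably equal and have the same relation; their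
canonical forms are not compared. This is what handles lifts. A lift does not change the value, so
it does not change the relation, which gives injectivity of lifts (`JTm.lift_inj`). For the rules
commuting lifts with Σ, Π and identity types, the two sides have different canonical forms; their
relations agree because the introduction forms at the two levels are judgementally equal
(`JTm.univ_lift_sigma`, `JTm.univ_lift_pi`, `JTm.univ_lift_eq`). -/

namespace PRTT

open _root_.PRTT.Expr _root_.PRTT.Assertion

/-! ### Substitutions -/

/-- Extension of a substitution by one more expression. -/
def cons {m n : ℕ} (a : Expr n) (σ : Fin m → Expr n) : Fin (m + 1) → Expr n :=
  Fin.cases a σ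

@[simp] theorem cons_zero {m n : ℕ} (a : Expr n) (σ : Fin m → Expr n) : cons a σ 0 = a := rfl

theorem Expr.inst_eq {n : ℕ} (B : Expr (n + 1)) (a : Expr n) :
    B.inst a = B.subst (cons a var) := rfl

@[simp] theorem Expr.wk_subst_cons {m n : ℕ} (A : Expr m) (a : Expr n) (σ : Fin m → Expr n) :
    A.wk.subst (cons a σ) = A.subst σ := by
  rw [Expr.subst_rename]; rfl

@[simp] theorem Expr.wk_subst_upSub {m n : ℕ} (A : Expr m) (σ : Fin m → Expr n) :
    A.wk.subst (upSub σ) = (A.subst σ).wk := by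
  rw [Expr.subst_rename]
  exact (Expr.rename_subst A σ Fin.succ).symm

theorem upSub_subst_cons {k m n : ℕ} (σ : Fin k → Expr m) (a : Expr n) (τ : Fin m → Expr n) :
    (fun i => (upSub σ i).subst (cons a τ)) = cons a (fun i => (σ i).subst τ) := by
  funext i
  refine Fin.cases rfl (fun j => ?_) i
  exact Expr.wk_subst_cons (σ j) a τ

theorem subst_var_comp {m n : ℕ} (σ : Fin m → Expr n) :
    (fun i => (σ i).subst var) = σ := by
  funext i; exact Expr.subst_id _

@[simp] theorem Expr.subst_upSub_inst {m n : ℕ} (B : Expr (m + 1)) (σ : Fin m → Expr n)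
    (a : Expr n) : (B.subst (upSub σ)).inst a = B.subst (cons a σ) := by
  rw [Expr.inst_eq, Expr.subst_subst, upSub_subst_cons, subst_var_comp]

theorem cons_subst {k m n : ℕ} (a : Expr m) (σ : Fin k → Expr m) (τ : Fin m → Expr n) :
    (fun i => (cons a σ i).subst τ) = cons (a.subst τ) (fun i => (σ i).subst τ) := by
  funext i
  refine Fin.cases rfl (fun j => rfl) i

theorem Expr.inst_subst {m n : ℕ} (B : Expr (m + 1)) (a : Expr m) (σ : Fin m → Expr n) :
    (B.inst a).subst σ = B.subst (cons (a.subst σ) σ) := by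
  rw [Expr.inst_eq, Expr.subst_subst, cons_subst]; rfl

theorem Expr.wk_eq_subst {n : ℕ} (A : Expr n) : A.wk = A.subst (fun i => var i.succ) :=
  Expr.rename_eq_subst A _

/-! ### Evaluation of closed expressions -/

/-- The canonical forms. -/
inductive IsVal : Expr 0 → Prop
  | lfLam {A : Expr 0} {B t : Expr 1} : IsVal (lfLam A B t)
  | lfPair {A : Expr 0} {B : Expr 1} {a b : Expr 0} : IsVal (lfPair A B a b)
  | sigma {α : ℕ} {A B : Expr 0} : IsVal (sigma α A B)
  | pair {α : ℕ} {A B x : Expr 0} : IsVal (pair α A B x)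
  | eq {α : ℕ} {A a b : Expr 0} : IsVal (eq α A a b)
  | refl {α : ℕ} {A a : Expr 0} : IsVal (refl α A a)
  | pi {α : ℕ} {A B : Expr 0} : IsVal (pi α A B)
  | abs {α : ℕ} {A B f : Expr 0} : IsVal (abs α A B f)
  | empty : IsVal empty
  | unit : IsVal unit
  | star : IsVal star
  | nat : IsVal nat
  | zero : IsVal zero
  | suc {x : Expr 0} : IsVal (suc x)
  | univ {α : ℕ} : IsVal (univ α)

/-- Big-step evaluation of closed expressions to canonical forms.  Annotations and lifts are
ignored. -/
inductive Ev : Expr 0 → Expr 0 → Prop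
  | val {v : Expr 0} : IsVal v → Ev v v
  | lfApp {A A' : Expr 0} {B B' t : Expr 1} {f a v : Expr 0} :
      Ev f (lfLam A' B' t) → Ev (t.inst a) v → Ev (lfApp A B f a) v
  | lfFst {A A' : Expr 0} {B B' : Expr 1} {p a b v : Expr 0} :
      Ev p (lfPair A' B' a b) → Ev a v → Ev (lfFst A B p) v
  | lfSnd {A A' : Expr 0} {B B' : Expr 1} {p a b v : Expr 0} :
      Ev p (lfPair A' B' a b) → Ev b v → Ev (lfSnd A B p) v
  | lift {α β : ℕ} {A v : Expr 0} : Ev A v → Ev (lift α β A) v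
  | unpair {α α' : ℕ} {A B A' B' y x v : Expr 0} :
      Ev y (pair α' A' B' x) → Ev x v → Ev (unpair α A B y) v
  | unabs {α α' : ℕ} {A B A' B' g f v : Expr 0} :
      Ev g (abs α' A' B' f) → Ev f v → Ev (unabs α A B g) v
  | eqind {α α' : ℕ} {A a P b p s A' a' v : Expr 0} :
      Ev p (refl α' A' a') → Ev s v → Ev (eqind α A a P b p s) v
  | unitind {B b x v : Expr 0} : Ev x star → Ev b v → Ev (unitind B b x) v
  | ind_zero {B bz bs x v : Expr 0} : Ev x zero → Ev bz v → Ev (ind B bz bs x) v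
  | ind_suc {B bz bs x y v : Expr 0} :
      Ev x (suc y) → Ev (step B bs y (ind B bz bs y)) v → Ev (ind B bz bs x) v

/-- Evaluation is syntax-directed. Only `ind` has two rules, and the value of its last argument
decides between them. -/
theorem Ev.det {t v w : Expr 0} (h : Ev t v) (h' : Ev t w) : v = w := by
  induction h generalizing w with
  | val hv => cases hv <;> (cases h'; rfl)
  | lfApp _ _ ih₁ ih₂ =>
    cases h' with
    | val hv => cases hv
    | lfApp k₁ k₂ => cases ih₁ k₁; exact ih₂ k₂
  | lfFst _ _ ih₁ ih₂ =>
    cases h' with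
    | val hv => cases hv
    | lfFst k₁ k₂ => cases ih₁ k₁; exact ih₂ k₂
  | lfSnd _ _ ih₁ ih₂ =>
    cases h' with
    | val hv => cases hv
    | lfSnd k₁ k₂ => cases ih₁ k₁; exact ih₂ k₂
  | lift _ ih =>
    cases h' with
    | val hv => cases hv
    | lift k => exact ih k
  | unpair _ _ ih₁ ih₂ =>
    cases h' with
    | val hv => cases hv
    | unpair k₁ k₂ => cases ih₁ k₁; exact ih₂ k₂
  | unabs _ _ ih₁ ih₂ =>
    cases h' with
    | val hv => cases hv
    | unabs k₁ k₂ => cases ih₁ k₁; exact ih₂ k₂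
  | eqind _ _ ih₁ ih₂ =>
    cases h' with
    | val hv => cases hv
    | eqind k₁ k₂ => cases ih₁ k₁; exact ih₂ k₂
  | unitind _ _ ih₁ ih₂ =>
    cases h' with
    | val hv => cases hv
    | unitind k₁ k₂ => exact ih₂ k₂
  | ind_zero _ _ ih₁ ih₂ =>
    cases h' with
    | val hv => cases hv
    | ind_zero k₁ k₂ => exact ih₂ k₂
    | ind_suc k₁ k₂ => cases ih₁ k₁
  | ind_suc _ _ ih₁ ih₂ =>
    cases h' with
    | val hv => cases hv
    | ind_zero k₁ k₂ => cases ih₁ k₁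
    | ind_suc k₁ k₂ => cases ih₁ k₁; exact ih₂ k₂

theorem Ev.isVal {t v : Expr 0} (h : Ev t v) : IsVal v := by
  induction h <;> assumption

/-- `u` evaluates to every value of `t`. -/
def Exp (t u : Expr 0) : Prop := ∀ v, Ev t v → Ev u v

theorem Exp.rfl {t : Expr 0} : Exp t t := fun _ h => h

theorem Exp.trans {t u v : Expr 0} (h : Exp t u) (h' : Exp u v) : Exp t v :=
  fun _ k => h' _ (h _ k)

/-- The annotations on the two sides are unrelated, since evaluation discards them. This is how the
congruence rules, which change annotations, come to hold in the model. -/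
theorem Exp.lfApp {A A' f f' a : Expr 0} {B B' : Expr 1} (h : Exp f f') :
    Exp (lfApp A B f a) (lfApp A' B' f' a) := by
  intro v k
  cases k with
  | val hv => cases hv
  | lfApp k₁ k₂ => exact .lfApp (h _ k₁) k₂

theorem Exp.lfFst {A A' p p' : Expr 0} {B B' : Expr 1} (h : Exp p p') :
    Exp (lfFst A B p) (lfFst A' B' p') := by
  intro v k
  cases k with
  | val hv => cases hv
  | lfFst k₁ k₂ => exact .lfFst (h _ k₁) k₂

theorem Exp.lfSnd {A A' p p' : Expr 0} {B B' : Expr 1} (h : Exp p p') :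
    Exp (lfSnd A B p) (lfSnd A' B' p') := by
  intro v k
  cases k with
  | val hv => cases hv
  | lfSnd k₁ k₂ => exact .lfSnd (h _ k₁) k₂

theorem Exp.unpair {α α' : ℕ} {A A' B B' y y' : Expr 0} (h : Exp y y') :
    Exp (unpair α A B y) (unpair α' A' B' y') := by
  intro v k
  cases k with
  | val hv => cases hv
  | unpair k₁ k₂ => exact .unpair (h _ k₁) k₂

theorem Exp.unabs {α α' : ℕ} {A A' B B' y y' : Expr 0} (h : Exp y y') :
    Exp (unabs α A B y) (unabs α' A' B' y') := by
  intro v k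
  cases k with
  | val hv => cases hv
  | unabs k₁ k₂ => exact .unabs (h _ k₁) k₂

theorem Exp.lift {α β : ℕ} {A : Expr 0} : Exp A (lift α β A) := fun _ h => .lift h

theorem Exp.of_lift {α β : ℕ} {A : Expr 0} : Exp (Expr.lift α β A) A := by
  intro v k
  cases k with
  | val hv => cases hv
  | lift k => exact k

theorem Exp.beta {A A' a : Expr 0} {B B' t : Expr 1} :
    Exp (t.inst a) (Expr.lfApp A B (lfLam A' B' t) a) := fun _ h => .lfApp (.val .lfLam) h

theorem Exp.of_beta {A A' a : Expr 0} {B B' t : Expr 1} :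
    Exp (Expr.lfApp A B (lfLam A' B' t) a) (t.inst a) := by
  intro v k
  cases k with
  | val hv => cases hv
  | lfApp k₁ k₂ => cases k₁; exact k₂

theorem Exp.fst_pair {A A' a b : Expr 0} {B B' : Expr 1} :
    Exp a (Expr.lfFst A B (lfPair A' B' a b)) := fun _ h => .lfFst (.val .lfPair) h

theorem Exp.snd_pair {A A' a b : Expr 0} {B B' : Expr 1} :
    Exp b (Expr.lfSnd A B (lfPair A' B' a b)) := fun _ h => .lfSnd (.val .lfPair) h

theorem Exp.unpair_pair {α α' : ℕ} {A A' B B' x : Expr 0} :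
    Exp x (Expr.unpair α A B (pair α' A' B' x)) := fun _ h => .unpair (.val .pair) h

theorem Exp.unabs_abs {α α' : ℕ} {A A' B B' x : Expr 0} :
    Exp x (Expr.unabs α A B (abs α' A' B' x)) := fun _ h => .unabs (.val .abs) h

/-! ### Derivations in the empty context -/

/-- Judgemental equality of closed expressions. -/
abbrev D (ℓ : ℕ∞) (t u A : Expr 0) : Prop := Der ℓ (tmEq .nil t u A)

/-- Equality of closed judgements. -/
abbrev DTy (ℓ : ℕ∞) (A B : Expr 0) : Prop := Der ℓ (tyEq .nil A B)

section
variable {ℓ : ℕ∞} {n : ℕ} {Γ : Ctx n}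

theorem Der.tm_left {t u A : Expr n} (h : Der ℓ (tmEq Γ t u A)) : Der ℓ (tmEq Γ t t A) :=
  h.tm_trans h.tm_symm

theorem Der.tm_right {t u A : Expr n} (h : Der ℓ (tmEq Γ t u A)) : Der ℓ (tmEq Γ u u A) :=
  h.tm_symm.tm_trans h

theorem Der.ty_left {A B : Expr n} (h : Der ℓ (tyEq Γ A B)) : Der ℓ (tyEq Γ A A) :=
  h.ty_trans h.ty_symm

theorem Der.ty_right {A B : Expr n} (h : Der ℓ (tyEq Γ A B)) : Der ℓ (tyEq Γ B B) :=
  h.ty_symm.ty_trans h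

theorem Der.wk_subst {C : Expr n} (hc : Der ℓ (Assertion.ctx (Γ.snoc C))) (i : Fin n) :
    Der ℓ (tmEq (Γ.snoc C) (.var i.succ) (.var i.succ)
      ((Γ.get i).subst fun i => .var i.succ)) := by
  rw [← Expr.wk_eq_subst]
  exact Der.var (Γ := Γ.snoc C) i.succ hc

theorem Der.tm_wk {t u A C : Expr n} (hc : Der ℓ (Assertion.ctx (Γ.snoc C)))
    (h : Der ℓ (tmEq Γ t u A)) : Der ℓ (tmEq (Γ.snoc C) t.wk u.wk A.wk) := by
  simp only [Expr.wk_eq_subst]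
  exact Der.tm_subst hc (Der.wk_subst hc) h

theorem Der.ty_wk {A B C : Expr n} (hc : Der ℓ (Assertion.ctx (Γ.snoc C)))
    (h : Der ℓ (tyEq Γ A B)) : Der ℓ (tyEq (Γ.snoc C) A.wk B.wk) := by
  simp only [Expr.wk_eq_subst]
  exact Der.ty_subst hc (Der.wk_subst hc) h

theorem Der.cons_inst {A a a' : Expr 0} (h : D ℓ a a' A) (i : Fin 1) :
    D ℓ (cons a Expr.var i) (cons a' Expr.var i) (((Ctx.nil.snoc A).get i).subst (cons a Expr.var)) := by
  obtain rfl : i = 0 := Subsingleton.elim _ _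
  change D ℓ a a' (A.wk.subst (cons a Expr.var))
  rwa [Expr.wk_subst_cons, Expr.subst_id]

theorem Der.ty_inst {A a a' : Expr 0} {B B' : Expr 1} (hB : Der ℓ (tyEq (Ctx.nil.snoc A) B B'))
    (h : D ℓ a a' A) : DTy ℓ (B.inst a) (B'.inst a') :=
  Der.ty_subst Der.ctx_nil (Der.cons_inst h) hB

theorem Der.tm_inst {A a a' : Expr 0} {t t' B : Expr 1}
    (ht : Der ℓ (tmEq (Ctx.nil.snoc A) t t' B)) (h : D ℓ a a' A) :
    D ℓ (t.inst a) (t'.inst a') (B.inst a) :=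
  Der.tm_subst Der.ctx_nil (Der.cons_inst h) ht

theorem Der.fam_congr {α : ℕ} {A A' B B' x x' : Expr n} (hα : (α : ℕ∞) < ℓ)
    (hc : Der ℓ (Assertion.ctx Γ))
    (hA : Der ℓ (tmEq Γ A A' (.tp α))) (hB : Der ℓ (tmEq Γ B B' (Fam α A)))
    (hx : Der ℓ (tmEq Γ x x' (.tm α A))) :
    Der ℓ (tmEq Γ (fam α A B x) (fam α A' B' x') (.tp α)) :=
  Der.lfApp (Der.tm hA) (Der.tp hα (Der.ctx_snoc hc (Der.tm hA).ty_left)) hB hx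

theorem Der.tm_fam {α : ℕ} {A A' B B' : Expr n} (hα : (α : ℕ∞) < ℓ)
    (hc : Der ℓ (Assertion.ctx Γ))
    (hA : Der ℓ (tmEq Γ A A' (.tp α))) (hB : Der ℓ (tmEq Γ B B' (Fam α A))) :
    Der ℓ (tyEq (Γ.snoc (.tm α A)) (.tm α (fam α A.wk B.wk v0)) (.tm α (fam α A'.wk B'.wk v0))) := by
  have hc' := Der.ctx_snoc hc (Der.tm hA).ty_left
  exact Der.tm (Der.fam_congr hα hc' (Der.tm_wk hc' hA) (Der.tm_wk hc' hB) (Der.var 0 hc'))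

end

/-! ### Relations on closed expressions -/

/-- Relations on closed expressions. -/
abbrev Rel : Type := Expr 0 → Expr 0 → Prop

/-- The properties of the relation that interprets the closed judgement `X`. -/
structure Good (ℓ : ℕ∞) (X : Expr 0) (R : Rel) : Prop where
  symm {t u : Expr 0} : R t u → R u t
  trans {t u v : Expr 0} : R t u → R u v → R t v
  der {t u : Expr 0} : R t u → D ℓ t u X
  -- Only values of `u` have to be values of `u'`. The derivation is demanded separately because
  -- evaluation is untyped and carries no information about judgemental equality.
  exp {t u u' : Expr 0} : R t u → Exp u u' → D ℓ t u' X → R t u'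

section
variable {ℓ : ℕ∞} {X Y : Expr 0} {R : Rel}

theorem Good.left (g : Good ℓ X R) {t u : Expr 0} (h : R t u) : R t t := g.trans h (g.symm h)

theorem Good.exp₂ (g : Good ℓ X R) {t t' u u' : Expr 0} (h : R t u) (ht : Exp t t')
    (hu : Exp u u') (hd : D ℓ t t' X) (hd' : D ℓ t' u' X) : R t' u' :=
  g.exp (g.symm (g.exp (g.symm h) ht ((g.der h).tm_symm.tm_trans hd))) hu hd'

theorem Good.conv (g : Good ℓ X R) (h : DTy ℓ X Y) : Good ℓ Y R where
  symm := g.symm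
  trans := g.trans
  der k := (g.der k).tm_conv h
  exp k₁ k₂ k₃ := g.exp k₁ k₂ (k₃.tm_conv h.ty_symm)

/-- The relation of a dependent product of the framework. -/
def PiRel (ℓ : ℕ∞) (A : Expr 0) (B : Expr 1) (RA : Rel) (RB : Expr 0 → Rel) : Rel := fun f f' =>
  D ℓ f f' (lfPi A B) ∧ ∀ a a', RA a a' → RB a (lfApp A B f a) (lfApp A B f' a')

/-- The relation of a dependent sum of the framework. -/
def SigRel (ℓ : ℕ∞) (A : Expr 0) (B : Expr 1) (RA : Rel) (RB : Expr 0 → Rel) : Rel := fun p p' =>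
  D ℓ p p' (lfSig A B) ∧ RA (lfFst A B p) (lfFst A B p') ∧
    RB (lfFst A B p) (lfSnd A B p) (lfSnd A B p')

/-- The relation of an extensional equality of the framework. -/
def LfEqRel (ℓ : ℕ∞) (A : Expr 0) (RA : Rel) (a b : Expr 0) : Rel := fun p p' =>
  D ℓ p p' (lfEq A a b) ∧ RA a b

theorem good_D (X : Expr 0) : Good ℓ X (fun t u => D ℓ t u X) :=
  ⟨Der.tm_symm, Der.tm_trans, id, fun _ _ h => h⟩

theorem Good.lfEq {A a b : Expr 0} (RA : Rel) : Good ℓ (lfEq A a b) (LfEqRel ℓ A RA a b) :=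
  ⟨fun h => ⟨h.1.tm_symm, h.2⟩, fun h h' => ⟨h.1.tm_trans h'.1, h.2⟩, fun h => h.1,
    fun h _ hd => ⟨hd, h.2⟩⟩

/-- The hypothesis `eB` is indispensable for symmetry: swapping the arguments moves the base point
of the family of relations from `a` to `a'`. -/
theorem Good.lfPi {A : Expr 0} {B : Expr 1} {RA : Rel} {RB : Expr 0 → Rel}
    (hA : DTy ℓ A A) (hB : Der ℓ (tyEq (Ctx.nil.snoc A) B B)) (gA : Good ℓ A RA)
    (gB : ∀ a a', RA a a' → Good ℓ (B.inst a) (RB a))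
    (eB : ∀ a a', RA a a' → RB a = RB a') :
    Good ℓ (lfPi A B) (PiRel ℓ A B RA RB) where
  symm h := ⟨h.1.tm_symm, fun a a' k => by
    rw [eB a a' k]
    exact (gB _ _ (gA.symm k)).symm (h.2 _ _ (gA.symm k))⟩
  -- The first function pair is used at the diagonal argument `(a, a)`, so that both links lie over
  -- the same base point `a`.
  trans h h' := ⟨h.1.tm_trans h'.1, fun a a' k =>
    (gB _ _ k).trans (h.2 _ _ (gA.left k)) (h'.2 _ _ k)⟩
  der h := h.1
  exp h he hd := ⟨hd, fun a a' k =>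
    (gB _ _ k).exp (h.2 _ _ k) (Exp.lfApp he) (Der.lfApp hA hB hd (gA.der k))⟩

theorem Good.lfSig {A : Expr 0} {B : Expr 1} {RA : Rel} {RB : Expr 0 → Rel}
    (hA : DTy ℓ A A) (hB : Der ℓ (tyEq (Ctx.nil.snoc A) B B)) (gA : Good ℓ A RA)
    (gB : ∀ a a', RA a a' → Good ℓ (B.inst a) (RB a))
    (eB : ∀ a a', RA a a' → RB a = RB a') :
    Good ℓ (lfSig A B) (SigRel ℓ A B RA RB) where
  symm h := ⟨h.1.tm_symm, gA.symm h.2.1, by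
    rw [← eB _ _ h.2.1]
    exact (gB _ _ h.2.1).symm h.2.2⟩
  trans h h' := ⟨h.1.tm_trans h'.1, gA.trans h.2.1 h'.2.1, by
    refine (gB _ _ h.2.1).trans h.2.2 ?_
    rw [eB _ _ h.2.1]
    exact h'.2.2⟩
  der h := h.1
  exp h he hd := ⟨hd, gA.exp h.2.1 (Exp.lfFst he) (Der.lfFst hA hB hd),
    (gB _ _ h.2.1).exp h.2.2 (Exp.lfSnd he) (Der.lfSnd hA hB hd)⟩

/-- The two relations differ by the annotations on the applications. These are invisible to
evaluation and the annotated applications are derivably equal, so closure under expansion carries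
one to the other. -/
theorem PiRel.congr {A A' : Expr 0} {B B' : Expr 1} {RA : Rel} {RB RB' : Expr 0 → Rel}
    (hA : DTy ℓ A A') (hB : Der ℓ (tyEq (Ctx.nil.snoc A) B B')) (gA : Good ℓ A RA)
    (gB : ∀ a a', RA a a' → Good ℓ (B.inst a) (RB a))
    (eB : ∀ a a', RA a a' → RB a = RB' a') {f f' : Expr 0} (h : PiRel ℓ A B RA RB f f') :
    PiRel ℓ A' B' RA RB' f f' := by
  refine ⟨h.1.tm_conv (Der.lfPi hA hB), fun a a' k => ?_⟩
  rw [← eB a a (gA.left k)]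
  have ha := gA.der k
  exact (gB _ _ k).exp₂ (h.2 _ _ k) (Exp.lfApp Exp.rfl) (Exp.lfApp Exp.rfl)
    (Der.lfApp hA hB h.1.tm_left ha.tm_left)
    ((Der.lfApp hA hB h.1.tm_left ha.tm_left).tm_symm.tm_trans (Der.lfApp hA hB h.1 ha))

theorem SigRel.congr {A A' : Expr 0} {B B' : Expr 1} {RA : Rel} {RB RB' : Expr 0 → Rel}
    (hA : DTy ℓ A A') (hB : Der ℓ (tyEq (Ctx.nil.snoc A) B B')) (gA : Good ℓ A RA)
    (gB : ∀ a a', RA a a' → Good ℓ (B.inst a) (RB a))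
    (eB : ∀ a a', RA a a' → RB a = RB' a') {p p' : Expr 0} (h : SigRel ℓ A B RA RB p p') :
    SigRel ℓ A' B' RA RB' p p' := by
  have d₁ := Der.lfFst hA hB h.1.tm_left
  have d₂ := Der.lfSnd hA hB h.1.tm_left
  have r₁ : RA (lfFst A B p) (lfFst A' B' p) := gA.exp (gA.left h.2.1) (Exp.lfFst Exp.rfl) d₁
  refine ⟨h.1.tm_conv (Der.lfSig hA hB), ?_, ?_⟩
  · exact gA.exp₂ h.2.1 (Exp.lfFst Exp.rfl) (Exp.lfFst Exp.rfl) d₁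
      (d₁.tm_symm.tm_trans (Der.lfFst hA hB h.1))
  · rw [← eB _ _ r₁]
    exact (gB _ _ r₁).exp₂ h.2.2 (Exp.lfSnd Exp.rfl) (Exp.lfSnd Exp.rfl) d₂
      (d₂.tm_symm.tm_trans (Der.lfSnd hA hB h.1))

/-- The inverse image of a relation along an operation on closed terms of `Y`. -/
def PreRel (ℓ : ℕ∞) (Y : Expr 0) (f : Expr 0 → Expr 0) (R : Rel) : Rel := fun t u =>
  D ℓ t u Y ∧ R (f t) (f u)

/-- Applied with `unpair` and `unabs`: terms of Σ and Π types are compared through their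
destructors, so that η holds and the framework's relations on sums and products can be reused. -/
theorem Good.preimage {f : Expr 0 → Expr 0} (g : Good ℓ X R)
    (hD : ∀ t u, D ℓ t u Y → D ℓ (f t) (f u) X) (hE : ∀ t u, Exp t u → Exp (f t) (f u)) :
    Good ℓ Y (PreRel ℓ Y f R) where
  symm h := ⟨h.1.tm_symm, g.symm h.2⟩
  trans h h' := ⟨h.1.tm_trans h'.1, g.trans h.2 h'.2⟩
  der h := h.1
  exp h he hd := ⟨hd, g.exp h.2 (hE _ _ he) (hD _ _ hd)⟩

theorem PreRel.congr {Y' : Expr 0} {f f' : Expr 0 → Expr 0} (g : Good ℓ X R) (hY : DTy ℓ Y Y')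
    (hD : ∀ t u, D ℓ t u Y → D ℓ (f t) (f' u) X) (hE : ∀ t, Exp (f t) (f' t)) {t u : Expr 0}
    (h : PreRel ℓ Y f R t u) : PreRel ℓ Y' f' R t u := by
  refine ⟨h.1.tm_conv hY, g.exp₂ h.2 (hE t) (hE u) (hD _ _ h.1.tm_left) ?_⟩
  exact (hD _ _ h.1.tm_left).tm_symm.tm_trans (hD _ _ h.1)

end

/-! ### Relations of the types of the theory -/

/-- The relation of the type of natural numbers. -/
inductive NatR (ℓ : ℕ∞) : Rel
  | zero {t t' : Expr 0} : Ev t zero → Ev t' zero → D ℓ t zero (tm 0 nat) →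
      D ℓ t' zero (tm 0 nat) → NatR ℓ t t'
  | suc {t t' x x' : Expr 0} : Ev t (suc x) → Ev t' (suc x') → D ℓ t (suc x) (tm 0 nat) →
      D ℓ t' (suc x') (tm 0 nat) → NatR ℓ x x' → NatR ℓ t t'

/-- The relation of the unit type. -/
def UnitR (ℓ : ℕ∞) : Rel := fun t t' =>
  (Ev t star ∧ D ℓ t star (tm 0 unit)) ∧ (Ev t' star ∧ D ℓ t' star (tm 0 unit))

/-- The relation of the empty type. -/
def EmptyR : Rel := fun _ _ => False

/-- `p` evaluates to, and is judgementally equal to, reflexivity of `a`. -/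
def IsRefl (ℓ : ℕ∞) (γ : ℕ) (A a b p : Expr 0) : Prop :=
  (∃ (δ : ℕ) (C c : Expr 0), Ev p (refl δ C c)) ∧ D ℓ p (refl γ A a) (tm γ (eq γ A a b))

/-- The relation of an identity type. -/
def EqR (ℓ : ℕ∞) (γ : ℕ) (A a b : Expr 0) (RA : Rel) : Rel := fun p p' =>
  RA a b ∧ IsRefl ℓ γ A a b p ∧ IsRefl ℓ γ A a b p'

/-- The relation of a dependent pair type. -/
def SigmaR (ℓ : ℕ∞) (γ : ℕ) (A B : Expr 0) (RA : Rel) (RB : Expr 0 → Rel) : Rel :=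
  PreRel ℓ (tm γ (sigma γ A B)) (unpair γ A B)
    (SigRel ℓ (tm γ A) (tm γ (fam γ A.wk B.wk v0)) RA RB)

/-- The relation of a dependent function type. -/
def PiR (ℓ : ℕ∞) (γ : ℕ) (A B : Expr 0) (RA : Rel) (RB : Expr 0 → Rel) : Rel :=
  PreRel ℓ (tm (max 1 γ) (pi γ A B)) (unabs γ A B)
    (PiRel ℓ (tm γ A) (tm γ (fam γ A.wk B.wk v0)) RA RB)

/-- `IsTy ℓ U α X R`: the closed expression `X` is a type of level `α`, interpreted by `R`, if the
universes are interpreted by `U`. -/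
inductive IsTy (ℓ : ℕ∞) (U : ℕ → Rel) : ℕ → Expr 0 → Rel → Prop
  -- Lifts leave no trace in the value, so the canonical form `v` may live at a lower level `γ`. The
  -- derivation restores the missing lift.
  | red {α γ : ℕ} {X v : Expr 0} {R : Rel} : γ ≤ α → (α : ℕ∞) < ℓ → Ev X v →
      D ℓ X (lift γ α v) (tp α) → IsTy ℓ U γ v R → IsTy ℓ U α X R
  | empty : 0 < ℓ → IsTy ℓ U 0 empty EmptyR
  | unit : 0 < ℓ → IsTy ℓ U 0 unit (UnitR ℓ)
  | nat : 0 < ℓ → IsTy ℓ U 0 nat (NatR ℓ)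
  | sigma {γ : ℕ} {A B : Expr 0} {RA : Rel} {RB : Expr 0 → Rel} :
      D ℓ A A (tp γ) → D ℓ B B (Fam γ A) → IsTy ℓ U γ A RA →
      (∀ a a', RA a a' → IsTy ℓ U γ (fam γ A B a) (RB a)) →
      (∀ a a', RA a a' → RB a = RB a') →
      IsTy ℓ U γ (sigma γ A B) (SigmaR ℓ γ A B RA RB)
  | pi {γ : ℕ} {A B : Expr 0} {RA : Rel} {RB : Expr 0 → Rel} :
      ((max 1 γ : ℕ) : ℕ∞) < ℓ →
      D ℓ A A (tp γ) → D ℓ B B (Fam γ A) → IsTy ℓ U γ A RA →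
      (∀ a a', RA a a' → IsTy ℓ U γ (fam γ A B a) (RB a)) →
      (∀ a a', RA a a' → RB a = RB a') →
      IsTy ℓ U (max 1 γ) (pi γ A B) (PiR ℓ γ A B RA RB)
  | eq {γ : ℕ} {A a b : Expr 0} {RA : Rel} : D ℓ A A (tp γ) → D ℓ a a (tm γ A) →
      D ℓ b b (tm γ A) → IsTy ℓ U γ A RA → IsTy ℓ U γ (eq γ A a b) (EqR ℓ γ A a b RA)
  | univ {γ : ℕ} : ((γ + 1 : ℕ) : ℕ∞) < ℓ → IsTy ℓ U (γ + 1) (univ γ) (U γ)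

/-! ### Values of types, uniqueness of their relations, dependence on the universes -/

section
variable {ℓ : ℕ∞} {U : ℕ → Rel} {α β γ : ℕ} {X Y v : Expr 0} {R R' : Rel}

theorem IsTy.level_lt (h : IsTy ℓ U α X R) : (α : ℕ∞) < ℓ := by
  induction h <;> assumption

theorem IsTy.der (h : IsTy ℓ U α X R) : D ℓ X X (tp α) := by
  induction h with
  | red _ _ _ h => exact h.tm_left
  | empty h => exact Der.empty h Der.ctx_nil
  | unit h => exact Der.unit h Der.ctx_nil
  | nat h => exact Der.nat h Der.ctx_nil
  | sigma hA hB => exact Der.sigma hA hB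
  | pi h hA hB => exact Der.pi h hA hB
  | eq hA ha hb => exact Der.eq hA ha hb
  | univ h => exact Der.univ h Der.ctx_nil

/-- A type given by a constructor other than `red` is its own value, along the identity lift; this
makes all cases look like `red`. -/
theorem IsTy.exists_val (h : IsTy ℓ U α X R) :
    ∃ γ v, γ ≤ α ∧ Ev X v ∧ D ℓ X (lift γ α v) (tp α) ∧ IsTy ℓ U γ v R := by
  have hv : IsVal X → ∃ γ v, γ ≤ α ∧ Ev X v ∧ D ℓ X (lift γ α v) (tp α) ∧ IsTy ℓ U γ v R :=
    fun hv => ⟨α, X, le_rfl, .val hv, (Der.lift_self h.der).tm_symm, h⟩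
  cases h with
  | @red _ γ _ v _ h₁ _ h₂ h₃ h₄ => exact ⟨γ, v, h₁, h₂, h₃, h₄⟩
  | empty => exact hv .empty
  | unit => exact hv .unit
  | nat => exact hv .nat
  | sigma => exact hv .sigma
  | pi => exact hv .pi
  | eq => exact hv .eq
  | univ => exact hv .univ

theorem IsTy.exp (h : IsTy ℓ U α X R) (he : Exp X Y) (hd : D ℓ X Y (tp α)) :
    IsTy ℓ U α Y R := by
  obtain ⟨γ, v, h₁, h₂, h₃, h₄⟩ := h.exists_val
  exact .red h₁ h.level_lt (he _ h₂) (hd.tm_symm.tm_trans h₃) h₄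

/-- The same relation serves at both levels: the value is unchanged, and the lift recorded for `X`
composes with the new one. -/
theorem IsTy.lift (h : IsTy ℓ U α X R) (hβ : α ≤ β) (hℓ : (β : ℕ∞) < ℓ) :
    IsTy ℓ U β (lift α β X) R := by
  obtain ⟨γ, v, h₁, h₂, h₃, h₄⟩ := h.exists_val
  exact .red (h₁.trans hβ) hℓ (.lift h₂)
    ((Der.lift hβ hℓ h₃).tm_trans (Der.lift_lift h₁ hβ hℓ h₄.der)) h₄

/-- The shape of the relation of a type whose value is `v`. -/
def TyView (ℓ : ℕ∞) (U : ℕ → Rel) (v : Expr 0) (R : Rel) : Prop :=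
  match v with
  | .empty => R = EmptyR
  | .unit => R = UnitR ℓ
  | .nat => R = NatR ℓ
  | .sigma γ A B => ∃ RA RB, IsTy ℓ U γ A RA ∧
      (∀ a a', RA a a' → IsTy ℓ U γ (fam γ A B a) (RB a)) ∧
      (∀ a a', RA a a' → RB a = RB a') ∧ R = SigmaR ℓ γ A B RA RB
  | .pi γ A B => ∃ RA RB, IsTy ℓ U γ A RA ∧
      (∀ a a', RA a a' → IsTy ℓ U γ (fam γ A B a) (RB a)) ∧
      (∀ a a', RA a a' → RB a = RB a') ∧ R = PiR ℓ γ A B RA RB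
  | .eq γ A a b => ∃ RA, IsTy ℓ U γ A RA ∧ R = EqR ℓ γ A a b RA
  | .univ γ => R = U γ
  | _ => False

/-- Inversion according to the value of the type instead of the last rule used. Applications of
`red` are absorbed, since a canonical form evaluates to itself. -/
theorem IsTy.view (h : IsTy ℓ U α X R) (hv : Ev X v) : TyView ℓ U v R := by
  induction h with
  | red _ _ he _ _ ih => cases he.det hv; exact ih (.val he.isVal)
  | empty => cases hv; exact rfl
  | unit => cases hv; exact rfl
  | nat => cases hv; exact rfl
  | sigma _ _ h₁ h₂ h₃ => cases hv; exact ⟨_, _, h₁, h₂, h₃, rfl⟩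
  | pi _ _ _ h₁ h₂ h₃ => cases hv; exact ⟨_, _, h₁, h₂, h₃, rfl⟩
  | eq _ _ _ h => cases hv; exact ⟨_, h, rfl⟩
  | univ => cases hv; exact rfl

/-- A Σ type determines the family of relations only over arguments related by `RA`. Since the
relation consults the family only there, this is enough for uniqueness. -/
theorem SigmaR.congr_right {A B : Expr 0} {RA : Rel} {RB RB' : Expr 0 → Rel}
    (h : ∀ a a', RA a a' → RB a = RB' a) :
    SigmaR ℓ γ A B RA RB = SigmaR ℓ γ A B RA RB' := by
  funext t u
  simp only [SigmaR, PreRel, SigRel]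
  refine propext (and_congr_right fun _ => and_congr_right fun _ => and_congr_right fun k => ?_)
  rw [h _ _ k]

theorem PiR.congr_right {A B : Expr 0} {RA : Rel} {RB RB' : Expr 0 → Rel}
    (h : ∀ a a', RA a a' → RB a = RB' a) :
    PiR ℓ γ A B RA RB = PiR ℓ γ A B RA RB' := by
  funext t u
  simp only [PiR, PreRel, PiRel]
  refine propext (and_congr_right fun _ => and_congr_right fun _ => forall_congr' fun a =>
    forall_congr' fun a' => forall_congr' fun k => ?_)
  rw [h _ _ k]

/-- The levels `α` and `β` and the expressions `X` and `Y` may differ: only the common value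
matters. For a compound value the induction hypothesis identifies first the relation of the domain
and then, over it, those of the fibres. -/
theorem IsTy.det (h : IsTy ℓ U α X R) (h' : IsTy ℓ U β Y R') (hX : Ev X v) (hY : Ev Y v) :
    R = R' := by
  have key : ∀ {α X R}, IsTy ℓ U α X R →
      ∀ {β Y R' v}, IsTy ℓ U β Y R' → Ev X v → Ev Y v → R = R' := by
    clear h h' hX hY
    intro α X R h
    induction h with
    | red _ _ he _ _ ih =>
      intro β Y R' v h' hX hY
      cases he.det hX
      exact ih h' (.val he.isVal) hY
    | empty => intro β Y R' v h' hX hY; cases hX; exact (h'.view hY).symm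
    | unit => intro β Y R' v h' hX hY; cases hX; exact (h'.view hY).symm
    | nat => intro β Y R' v h' hX hY; cases hX; exact (h'.view hY).symm
    | univ => intro β Y R' v h' hX hY; cases hX; exact (h'.view hY).symm
    | sigma _ _ h₁ h₂ h₃ ih₁ ih₂ =>
      intro β Y R' v h' hX hY
      cases hX
      obtain ⟨RA, RB, k₁, k₂, k₃, rfl⟩ := h'.view hY
      obtain ⟨_, w, _, hw, _, _⟩ := h₁.exists_val
      obtain rfl := ih₁ k₁ hw hw
      refine SigmaR.congr_right fun a a' ha => ?_
      obtain ⟨_, w, _, hw, _, _⟩ := (h₂ a a' ha).exists_val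
      exact ih₂ a a' ha (k₂ a a' ha) hw hw
    | pi _ _ _ h₁ h₂ h₃ ih₁ ih₂ =>
      intro β Y R' v h' hX hY
      cases hX
      obtain ⟨RA, RB, k₁, k₂, k₃, rfl⟩ := h'.view hY
      obtain ⟨_, w, _, hw, _, _⟩ := h₁.exists_val
      obtain rfl := ih₁ k₁ hw hw
      refine PiR.congr_right fun a a' ha => ?_
      obtain ⟨_, w, _, hw, _, _⟩ := (h₂ a a' ha).exists_val
      exact ih₂ a a' ha (k₂ a a' ha) hw hw
    | eq _ _ _ h₁ ih₁ =>
      intro β Y R' v h' hX hY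
      cases hX
      obtain ⟨RA, k₁, rfl⟩ := h'.view hY
      obtain ⟨_, w, _, hw, _, _⟩ := h₁.exists_val
      rw [ih₁ k₁ hw hw]
  exact key h h' hX hY

theorem IsTy.unique (h : IsTy ℓ U α X R) (h' : IsTy ℓ U β X R') : R = R' := by
  obtain ⟨_, w, _, hw, _, _⟩ := h.exists_val
  exact h.det h' hw hw

/-- The universe with index `γ` first occurs at level `γ + 1`, and every premise of a rule has at
most the level of its conclusion. This justifies the recursion on levels that defines `Univ`. -/
theorem IsTy.congr_univ {U' : ℕ → Rel} (h : IsTy ℓ U α X R) (hU : ∀ γ < α, U γ = U' γ) :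
    IsTy ℓ U' α X R := by
  induction h with
  | red h₁ h₂ h₃ h₄ _ ih => exact .red h₁ h₂ h₃ h₄ (ih fun γ hγ => hU γ (hγ.trans_le h₁))
  | empty h => exact .empty h
  | unit h => exact .unit h
  | nat h => exact .nat h
  | sigma h₁ h₂ _ _ h₃ ih₁ ih₂ =>
    exact .sigma h₁ h₂ (ih₁ hU) (fun a a' ha => ih₂ a a' ha hU) h₃
  | pi h₀ h₁ h₂ _ _ h₃ ih₁ ih₂ =>
    have hU' := fun γ' hγ => hU γ' (lt_of_lt_of_le hγ (le_max_right _ _))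
    exact .pi h₀ h₁ h₂ (ih₁ hU') (fun a a' ha => ih₂ a a' ha hU') h₃
  | eq h₁ h₂ h₃ _ ih => exact .eq h₁ h₂ h₃ (ih hU)
  | univ h => rw [hU _ (Nat.lt_succ_self _)]; exact .univ h

/-! ### Properties of the relations -/

theorem NatR.der {t u : Expr 0} (h : NatR ℓ t u) : D ℓ t u (tm 0 nat) := by
  induction h with
  | zero _ _ h₁ h₂ => exact h₁.tm_trans h₂.tm_symm
  | suc _ _ h₁ h₂ _ ih => exact (h₁.tm_trans (Der.suc ih)).tm_trans h₂.tm_symm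

theorem NatR.symm {t u : Expr 0} (h : NatR ℓ t u) : NatR ℓ u t := by
  induction h with
  | zero h₁ h₂ h₃ h₄ => exact .zero h₂ h₁ h₄ h₃
  | suc h₁ h₂ h₃ h₄ _ ih => exact .suc h₂ h₁ h₄ h₃ ih

theorem NatR.trans {t u v : Expr 0} (h : NatR ℓ t u) (h' : NatR ℓ u v) : NatR ℓ t v := by
  induction h generalizing v with
  | zero h₁ h₂ h₃ h₄ =>
    cases h' with
    | zero k₁ k₂ k₃ k₄ => exact .zero h₁ k₂ h₃ k₄
    | suc k₁ => cases h₂.det k₁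
  | suc h₁ h₂ h₃ h₄ _ ih =>
    cases h' with
    | zero k₁ k₂ k₃ k₄ => cases h₂.det k₁
    | suc k₁ k₂ k₃ k₄ k => cases h₂.det k₁; exact .suc h₁ k₂ h₃ k₄ (ih k)

theorem good_NatR : Good ℓ (tm 0 nat) (NatR ℓ) where
  symm := NatR.symm
  trans := NatR.trans
  der := NatR.der
  exp h he hd := by
    have hd' := hd.tm_symm.tm_trans h.der
    cases h with
    | zero h₁ h₂ h₃ h₄ => exact .zero h₁ (he _ h₂) h₃ (hd'.tm_trans h₄)
    | suc h₁ h₂ h₃ h₄ h => exact .suc h₁ (he _ h₂) h₃ (hd'.tm_trans h₄) h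

theorem good_UnitR : Good ℓ (tm 0 unit) (UnitR ℓ) where
  symm h := ⟨h.2, h.1⟩
  trans h h' := ⟨h.1, h'.2⟩
  der h := h.1.2.tm_trans h.2.2.tm_symm
  exp h he hd := ⟨h.1, he _ h.2.1, hd.tm_symm.tm_trans h.1.2⟩

theorem good_EmptyR : Good ℓ X EmptyR :=
  ⟨False.elim, fun h => h.elim, False.elim, fun h => h.elim⟩

theorem IsRefl.exp {A a b p q : Expr 0} (h : IsRefl ℓ γ A a b p) (he : Exp p q)
    (hd : D ℓ p q (tm γ (.eq γ A a b))) : IsRefl ℓ γ A a b q := by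
  obtain ⟨⟨δ, C, c, h₁⟩, h₂⟩ := h
  exact ⟨⟨δ, C, c, he _ h₁⟩, hd.tm_symm.tm_trans h₂⟩

theorem good_EqR {A a b : Expr 0} {RA : Rel} :
    Good ℓ (tm γ (.eq γ A a b)) (EqR ℓ γ A a b RA) where
  symm h := ⟨h.1, h.2.2, h.2.1⟩
  trans h h' := ⟨h.1, h.2.1, h'.2.2⟩
  der h := h.2.1.2.tm_trans h.2.2.2.tm_symm
  exp h he hd := ⟨h.1, h.2.1, h.2.2.exp he
    ((h.2.2.2.tm_trans h.2.1.2.tm_symm).tm_trans hd)⟩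

section
variable {A B : Expr 0} {RA : Rel} {RB : Expr 0 → Rel}

@[simp] theorem Expr.fam_inst (a : Expr 0) : (fam γ A.wk B.wk v0).inst a = fam γ A B a := by
  simp only [fam, Expr.inst_eq, Expr.subst, Expr.wk_subst_cons, Expr.subst_id, cons_zero]

theorem Expr.tm_fam_inst (a : Expr 0) :
    (tm γ (fam γ A.wk B.wk v0)).inst a = tm γ (fam γ A B a) :=
  congrArg (tm γ) (Expr.fam_inst a)

theorem good_pairs (hγ : (γ : ℕ∞) < ℓ) (hA : D ℓ A A (tp γ)) (hB : D ℓ B B (Fam γ A))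
    (gA : Good ℓ (tm γ A) RA) (gB : ∀ a a', RA a a' → Good ℓ (tm γ (fam γ A B a)) (RB a))
    (eB : ∀ a a', RA a a' → RB a = RB a') :
    Good ℓ (Pairs γ A B) (SigRel ℓ (tm γ A) (tm γ (fam γ A.wk B.wk v0)) RA RB) :=
  Good.lfSig (Der.tm hA) (Der.tm_fam hγ Der.ctx_nil hA hB) gA
    (fun a a' ha => by rw [Expr.tm_fam_inst]; exact gB a a' ha) eB

theorem good_sections (hγ : (γ : ℕ∞) < ℓ) (hA : D ℓ A A (tp γ)) (hB : D ℓ B B (Fam γ A))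
    (gA : Good ℓ (tm γ A) RA) (gB : ∀ a a', RA a a' → Good ℓ (tm γ (fam γ A B a)) (RB a))
    (eB : ∀ a a', RA a a' → RB a = RB a') :
    Good ℓ (Sections γ A B) (PiRel ℓ (tm γ A) (tm γ (fam γ A.wk B.wk v0)) RA RB) :=
  Good.lfPi (Der.tm hA) (Der.tm_fam hγ Der.ctx_nil hA hB) gA
    (fun a a' ha => by rw [Expr.tm_fam_inst]; exact gB a a' ha) eB

end

theorem IsTy.good (hU : ∀ γ : ℕ, ((γ + 1 : ℕ) : ℕ∞) < ℓ → Good ℓ (tp γ) (U γ))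
    (h : IsTy ℓ U α X R) : Good ℓ (tm α X) R := by
  induction h with
  | red h₁ h₂ _ h₃ h₄ ih =>
    -- The terms of `v` at level `γ` are those of its lift to `α`, and the lift is equal to the
    -- given type.
    exact ih.conv ((Der.tm_lift h₁ h₂ h₄.der).ty_trans (Der.tm h₃).ty_symm)
  | empty => exact good_EmptyR
  | unit => exact good_UnitR
  | nat => exact good_NatR
  | sigma hA hB h₁ h₂ h₃ ih₁ ih₂ =>
    exact (good_pairs h₁.level_lt hA hB ih₁ ih₂ h₃).preimage
      (fun _ _ h => Der.unpair hA hB h) (fun _ _ h => Exp.unpair h)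
  | pi hγ hA hB h₁ h₂ h₃ ih₁ ih₂ =>
    exact (good_sections h₁.level_lt hA hB ih₁ ih₂ h₃).preimage
      (fun _ _ h => Der.unabs hγ hA hB h) (fun _ _ h => Exp.unabs h)
  | eq => exact good_EqR
  | univ h => exact (hU _ h).conv (Der.tm_univ h Der.ctx_nil).ty_symm

end

/-! ### The universes -/

/-- Equality of types of level `α`, if the universes are interpreted by `U`. -/
def TyRel (ℓ : ℕ∞) (U : ℕ → Rel) (α : ℕ) : Rel := fun X Y =>
  D ℓ X Y (tp α) ∧ ∃ R, IsTy ℓ U α X R ∧ IsTy ℓ U α Y R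

/-- The interpretation of the universes. -/
def Univ (ℓ : ℕ∞) (α : ℕ) : Rel :=
  TyRel ℓ (fun γ => if _h : γ < α then Univ ℓ γ else EmptyR) α
termination_by α

/-- Closed types of level `α` with their relations. -/
abbrev Ty (ℓ : ℕ∞) : ℕ → Expr 0 → Rel → Prop := IsTy ℓ (Univ ℓ)

section
variable {ℓ : ℕ∞} {α β γ : ℕ} {X Y v : Expr 0} {R R' : Rel}

/-- The recursive definition replaces the universes from `α` upwards by the empty relation. Types of
level `α` do not see this, so the truncation can be removed. -/
theorem Univ_iff : Univ ℓ α X Y ↔ D ℓ X Y (tp α) ∧ ∃ R, Ty ℓ α X R ∧ Ty ℓ α Y R := by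
  have h₁ : ∀ γ < α, (fun γ => if _h : γ < α then Univ ℓ γ else EmptyR) γ = Univ ℓ γ := by
    intro γ hγ; simp only [hγ, dite_true]
  have h₂ : ∀ γ < α, Univ ℓ γ = (fun γ => if _h : γ < α then Univ ℓ γ else EmptyR) γ :=
    fun γ hγ => (h₁ γ hγ).symm
  rw [Univ]
  refine and_congr_right fun _ => exists_congr fun R => and_congr ?_ ?_
  · exact ⟨fun h => h.congr_univ h₁, fun h => h.congr_univ h₂⟩
  · exact ⟨fun h => h.congr_univ h₁, fun h => h.congr_univ h₂⟩

theorem good_Univ : Good ℓ (tp α) (Univ ℓ α) where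
  symm h := by
    obtain ⟨d, R, h₁, h₂⟩ := Univ_iff.1 h
    exact Univ_iff.2 ⟨d.tm_symm, R, h₂, h₁⟩
  trans h h' := by
    obtain ⟨d, R, h₁, h₂⟩ := Univ_iff.1 h
    obtain ⟨d', R', h₁', h₂'⟩ := Univ_iff.1 h'
    -- Transitivity rests on uniqueness: the middle type has only one relation.
    obtain rfl := h₂.unique h₁'
    exact Univ_iff.2 ⟨d.tm_trans d', R, h₁, h₂'⟩
  der h := (Univ_iff.1 h).1
  exp h he hd := by
    obtain ⟨d, R, h₁, h₂⟩ := Univ_iff.1 h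
    exact Univ_iff.2 ⟨hd, R, h₁, h₂.exp he (d.tm_symm.tm_trans hd)⟩

theorem IsTy.good_Ty (h : Ty ℓ α X R) : Good ℓ (tm α X) R := h.good fun _ _ => good_Univ

/-- The relation of the closed type `X` of level `α`. -/
def El (ℓ : ℕ∞) (α : ℕ) (X : Expr 0) : Rel := fun t u => ∃ R, Ty ℓ α X R ∧ R t u

theorem IsTy.El_eq (h : Ty ℓ α X R) : El ℓ α X = R := by
  funext t u
  refine propext ⟨?_, fun k => ⟨R, h, k⟩⟩
  rintro ⟨R', h', k⟩
  rwa [h.unique h']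

theorem Univ.El_eq (h : Univ ℓ α X Y) : El ℓ α X = El ℓ α Y := by
  obtain ⟨_, R, h₁, h₂⟩ := Univ_iff.1 h
  rw [h₁.El_eq, h₂.El_eq]

theorem Univ.ty (h : Univ ℓ α X Y) : Ty ℓ α X (El ℓ α X) := by
  obtain ⟨_, R, h₁, h₂⟩ := Univ_iff.1 h
  rwa [h₁.El_eq]

theorem Univ.der (h : Univ ℓ α X Y) : D ℓ X Y (tp α) := (Univ_iff.1 h).1

theorem Univ.good (h : Univ ℓ α X Y) : Good ℓ (tm α X) (El ℓ α X) := h.ty.good_Ty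

theorem Univ.intro (hd : D ℓ X Y (tp α)) (h : Ty ℓ α X R) (h' : Ty ℓ α Y R) : Univ ℓ α X Y :=
  Univ_iff.2 ⟨hd, R, h, h'⟩

theorem Univ.lift (h : Univ ℓ α X Y) (hβ : α ≤ β) (hℓ : (β : ℕ∞) < ℓ) :
    Univ ℓ β (lift α β X) (lift α β Y) := by
  obtain ⟨d, R, h₁, h₂⟩ := Univ_iff.1 h
  exact .intro (Der.lift hβ hℓ d) (h₁.lift hβ hℓ) (h₂.lift hβ hℓ)

/-- Lifting a type leaves its relation untouched; the soundness of all rules about lifts comes down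
to this. -/
theorem Univ.El_lift (h : Univ ℓ α X Y) (hβ : α ≤ β) (hℓ : (β : ℕ∞) < ℓ) :
    El ℓ β (Expr.lift α β X) = El ℓ α X :=
  (h.ty.lift hβ hℓ).El_eq

theorem El_nat (hℓ : 0 < ℓ) : El ℓ 0 nat = NatR ℓ := (IsTy.nat hℓ : Ty ℓ 0 nat _).El_eq

theorem El_unit (hℓ : 0 < ℓ) : El ℓ 0 unit = UnitR ℓ := (IsTy.unit hℓ : Ty ℓ 0 unit _).El_eq

theorem El_empty (hℓ : 0 < ℓ) : El ℓ 0 empty = EmptyR := (IsTy.empty hℓ : Ty ℓ 0 empty _).El_eq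

theorem El_univ (hℓ : ((α + 1 : ℕ) : ℕ∞) < ℓ) : El ℓ (α + 1) (univ α) = Univ ℓ α :=
  (IsTy.univ hℓ : Ty ℓ (α + 1) (univ α) _).El_eq

end

/-! ### Independence of the relations from the presentation of a judgement -/

section
variable {ℓ : ℕ∞}

theorem Der.snoc_conv {A A' : Expr 0} (hA : DTy ℓ A A') (i : Fin 1) :
    Der ℓ (tmEq (Ctx.nil.snoc A') (Expr.var i) (Expr.var i)
      (((Ctx.nil.snoc A).get i).subst Expr.var)) := by
  have hc := Der.ctx_snoc Der.ctx_nil hA.ty_right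
  rw [Expr.subst_id]
  obtain rfl : i = 0 := Subsingleton.elim _ _
  exact (Der.var 0 hc).tm_conv (Der.ty_wk hc hA.ty_symm)

/-- Context conversion is not a primitive rule; it is substitution of the variable for itself,
retyped along the equality of judgements. -/
theorem Der.ty_snoc_conv {A A' : Expr 0} {B B' : Expr 1} (hA : DTy ℓ A A')
    (hB : Der ℓ (tyEq (Ctx.nil.snoc A) B B')) : Der ℓ (tyEq (Ctx.nil.snoc A') B B') := by
  have := Der.ty_subst (Der.ctx_snoc Der.ctx_nil hA.ty_right) (Der.snoc_conv hA) hB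
  rwa [Expr.subst_id, Expr.subst_id] at this

/-- The reverse inclusion is `PiRel.congr` with the roles exchanged. The goodness of the second
family, which this requires, is transported along `eB` from the first. -/
theorem PiRel.eq {A A' : Expr 0} {B B' : Expr 1} {RA : Rel} {RB RB' : Expr 0 → Rel}
    (hA : DTy ℓ A A') (hB : Der ℓ (tyEq (Ctx.nil.snoc A) B B')) (gA : Good ℓ A RA)
    (gB : ∀ a a', RA a a' → Good ℓ (B.inst a) (RB a))
    (eB : ∀ a a', RA a a' → RB a = RB' a') : PiRel ℓ A B RA RB = PiRel ℓ A' B' RA RB' := by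
  funext f f'
  refine propext ⟨PiRel.congr hA hB gA gB eB, ?_⟩
  refine PiRel.congr hA.ty_symm (Der.ty_snoc_conv hA hB.ty_symm) (gA.conv hA)
    (fun a a' k => ?_) (fun a a' k => (eB _ _ (gA.symm k)).symm)
  rw [← eB _ _ (gA.left k)]
  exact (gB _ _ k).conv (Der.ty_inst hB (gA.der (gA.left k)))

theorem SigRel.eq {A A' : Expr 0} {B B' : Expr 1} {RA : Rel} {RB RB' : Expr 0 → Rel}
    (hA : DTy ℓ A A') (hB : Der ℓ (tyEq (Ctx.nil.snoc A) B B')) (gA : Good ℓ A RA)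
    (gB : ∀ a a', RA a a' → Good ℓ (B.inst a) (RB a))
    (eB : ∀ a a', RA a a' → RB a = RB' a') : SigRel ℓ A B RA RB = SigRel ℓ A' B' RA RB' := by
  funext f f'
  refine propext ⟨SigRel.congr hA hB gA gB eB, ?_⟩
  refine SigRel.congr hA.ty_symm (Der.ty_snoc_conv hA hB.ty_symm) (gA.conv hA)
    (fun a a' k => ?_) (fun a a' k => (eB _ _ (gA.symm k)).symm)
  rw [← eB _ _ (gA.left k)]
  exact (gB _ _ k).conv (Der.ty_inst hB (gA.der (gA.left k)))

theorem PreRel.eq {X Y Y' : Expr 0} {R : Rel} {f f' : Expr 0 → Expr 0} (g : Good ℓ X R)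
    (hY : DTy ℓ Y Y') (hD : ∀ t u, D ℓ t u Y → D ℓ (f t) (f' u) X)
    (hE : ∀ t, Exp (f t) (f' t)) (hE' : ∀ t, Exp (f' t) (f t)) :
    PreRel ℓ Y f R = PreRel ℓ Y' f' R := by
  funext t u
  exact propext ⟨PreRel.congr g hY hD hE, PreRel.congr g hY.ty_symm
    (fun t u h => (hD u t (h.tm_conv hY.ty_symm).tm_symm).tm_symm) hE'⟩

end

/-! ### Interpretation of judgements -/

/-- The expressions that have the form of a judgement, with levels below `ℓ`. -/
def IsJudg (ℓ : ℕ∞) : {n : ℕ} → Expr n → Prop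
  | _, .lfUnit => True
  | _, .lfPi A B => IsJudg ℓ A ∧ IsJudg ℓ B
  | _, .lfSig A B => IsJudg ℓ A ∧ IsJudg ℓ B
  | _, .lfEq A _ _ => IsJudg ℓ A
  | _, .tp α => (α : ℕ∞) < ℓ
  | _, .tm _ _ => True
  | _, _ => False

/-- The relation that interprets a judgement under a closing substitution. -/
def den (ℓ : ℕ∞) : {n : ℕ} → Expr n → (Fin n → Expr 0) → Rel
  | _, .lfUnit, _ => fun t u => D ℓ t u lfUnit
  | _, .lfPi A B, σ => PiRel ℓ (A.subst σ) (B.subst (upSub σ)) (den ℓ A σ)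
      (fun a => den ℓ B (cons a σ))
  | _, .lfSig A B, σ => SigRel ℓ (A.subst σ) (B.subst (upSub σ)) (den ℓ A σ)
      (fun a => den ℓ B (cons a σ))
  | _, .lfEq A a b, σ => LfEqRel ℓ (A.subst σ) (den ℓ A σ) (a.subst σ) (b.subst σ)
  | _, .tp α, _ => Univ ℓ α
  | _, .tm α A, σ => El ℓ α (A.subst σ)
  | _, _, _ => EmptyR

theorem IsJudg.subst {ℓ : ℕ∞} {m : ℕ} {A : Expr m} (h : IsJudg ℓ A) :
    ∀ {n : ℕ} (σ : Fin m → Expr n), IsJudg ℓ (A.subst σ) := by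
  induction A with
  | lfUnit | tp | tm => intro n σ; exact h
  | lfPi A B ihA ihB | lfSig A B ihA ihB => intro n σ; exact ⟨ihA h.1 _, ihB h.2 _⟩
  | lfEq A a b ihA => intro n σ; exact ihA h _
  | _ => exact h.elim

theorem cons_comp_upRen {m n : ℕ} (a : Expr 0) (σ : Fin n → Expr 0) (ρ : Fin m → Fin n) :
    (fun i => cons a σ (upRen ρ i)) = cons a (fun i => σ (ρ i)) := by
  funext i; refine Fin.cases rfl (fun j => rfl) i

/-- The restriction to expressions of judgement form is necessary: a variable is interpreted by the
empty relation, but a substitution may replace it by a judgement with another interpretation. -/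
theorem IsJudg.den_subst {ℓ : ℕ∞} {m : ℕ} {A : Expr m} (h : IsJudg ℓ A) :
    ∀ {n : ℕ} (τ : Fin m → Expr n) (σ : Fin n → Expr 0),
      den ℓ (A.subst τ) σ = den ℓ A (fun i => (τ i).subst σ) := by
  induction A with
  | lfUnit | tp => intro n τ σ; rfl
  | tm α A => intro n τ σ; simp only [Expr.subst, den, Expr.subst_subst]
  | lfPi A B ihA ihB | lfSig A B ihA ihB =>
    intro n τ σ
    simp only [Expr.subst, den, Expr.subst_subst, subst_upSub, ihA h.1, ihB h.2, upSub_subst_cons]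
  | lfEq A a b ihA =>
    intro n τ σ
    have := ihA h τ σ
    simp only [Expr.subst, den, Expr.subst_subst, this]
  | _ => exact h.elim

/-- Unlike substitution, renaming preserves the head of every expression, so no condition on the
form of `A` is needed. -/
theorem den_rename {ℓ : ℕ∞} {m : ℕ} (A : Expr m) :
    ∀ {n : ℕ} (ρ : Fin m → Fin n) (σ : Fin n → Expr 0),
      den ℓ (A.rename ρ) σ = den ℓ A (fun i => σ (ρ i)) := by
  induction A with
  | tm α A => intro n ρ σ; simp only [Expr.rename, den, Expr.subst_rename]
  | lfPi A B ihA ihB | lfSig A B ihA ihB =>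
    intro n ρ σ
    simp only [Expr.rename, den, Expr.subst_rename, upSub_comp_upRen, ihA, ihB, cons_comp_upRen]
  | lfEq A a b ihA =>
    intro n ρ σ
    simp only [Expr.rename, den, Expr.subst_rename, ihA]
  | _ => intro n ρ σ; rfl

theorem IsJudg.den_inst {ℓ : ℕ∞} {m : ℕ} {B : Expr (m + 1)} (h : IsJudg ℓ B) (a : Expr m)
    (σ : Fin m → Expr 0) : den ℓ (B.inst a) σ = den ℓ B (cons (a.subst σ) σ) := by
  rw [Expr.inst_eq, h.den_subst, cons_subst]; rfl

section
variable {ℓ : ℕ∞} {n : ℕ} {Γ : Ctx n} {σ τ : Fin n → Expr 0}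

/-- Related closing substitutions. -/
def SubRel (ℓ : ℕ∞) (Γ : Ctx n) (σ τ : Fin n → Expr 0) : Prop :=
  ∀ i, den ℓ (Γ.get i) σ (σ i) (τ i)

/-- Derivable and valid contexts. -/
structure JCtx (ℓ : ℕ∞) (Γ : Ctx n) : Prop where
  der : Der ℓ (Assertion.ctx Γ)
  judg (i : Fin n) : IsJudg ℓ (Γ.get i)
  eq {σ τ : Fin n → Expr 0} : SubRel ℓ Γ σ τ → ∀ i, den ℓ (Γ.get i) σ = den ℓ (Γ.get i) τ
  good {σ τ : Fin n → Expr 0} : SubRel ℓ Γ σ τ → ∀ i,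
    Good ℓ ((Γ.get i).subst σ) (den ℓ (Γ.get i) σ)

/-- Derivable and valid equalities of judgements. -/
structure JTy (ℓ : ℕ∞) (Γ : Ctx n) (A B : Expr n) : Prop where
  ctx : JCtx ℓ Γ
  der : Der ℓ (tyEq Γ A B)
  judg_left : IsJudg ℓ A
  judg_right : IsJudg ℓ B
  eq {σ τ : Fin n → Expr 0} : SubRel ℓ Γ σ τ → den ℓ A σ = den ℓ B τ
  good {σ τ : Fin n → Expr 0} : SubRel ℓ Γ σ τ → Good ℓ (A.subst σ) (den ℓ A σ)

/-- Derivable and valid equalities of terms. -/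
structure JTm (ℓ : ℕ∞) (Γ : Ctx n) (t u A : Expr n) : Prop where
  ty : JTy ℓ Γ A A
  der : Der ℓ (tmEq Γ t u A)
  rel {σ τ : Fin n → Expr 0} : SubRel ℓ Γ σ τ → den ℓ A σ (t.subst σ) (u.subst τ)

/-- Derivable and valid assertions. -/
def J (ℓ : ℕ∞) : Assertion → Prop
  | .ctx Γ => JCtx ℓ Γ
  | .tyEq Γ A B => JTy ℓ Γ A B
  | .tmEq Γ t u A => JTm ℓ Γ t u A

/-- The relation at each variable is taken over the first substitution. Validity of the context
allows the base to be moved to the second one. -/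
theorem SubRel.symm (hc : JCtx ℓ Γ) (h : SubRel ℓ Γ σ τ) : SubRel ℓ Γ τ σ := fun i => by
  rw [← hc.eq h i]
  exact (hc.good h i).symm (h i)

theorem SubRel.left (hc : JCtx ℓ Γ) (h : SubRel ℓ Γ σ τ) : SubRel ℓ Γ σ σ := fun i =>
  (hc.good h i).left (h i)

theorem SubRel.right (hc : JCtx ℓ Γ) (h : SubRel ℓ Γ σ τ) : SubRel ℓ Γ τ τ :=
  SubRel.left hc (h.symm hc)

theorem SubRel.der (hc : JCtx ℓ Γ) (h : SubRel ℓ Γ σ τ) (i : Fin n) :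
    D ℓ (σ i) (τ i) ((Γ.get i).subst σ) := (hc.good h i).der (h i)

theorem den_wk (A : Expr n) (a : Expr 0) : den ℓ A.wk (cons a σ) = den ℓ A σ :=
  den_rename A _ _

theorem SubRel.cons {A a a' : _} (h : SubRel ℓ Γ σ τ) (ha : den ℓ A σ a a') :
    SubRel ℓ (Γ.snoc A) (cons a σ) (cons a' τ) := by
  intro i
  refine Fin.cases ?_ (fun j => ?_) i
  · change den ℓ A.wk _ a a'
    rwa [den_wk]
  · change den ℓ (Γ.get j).wk _ (σ j) (τ j)
    rw [den_wk]
    exact h j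

theorem SubRel.tail {A : Expr n} {σ τ : Fin (n + 1) → Expr 0} (h : SubRel ℓ (Γ.snoc A) σ τ) :
    SubRel ℓ Γ (fun i => σ i.succ) (fun i => τ i.succ) := by
  intro i
  have : den ℓ (Γ.get i).wk σ (σ i.succ) (τ i.succ) := h i.succ
  rwa [den_rename] at this

theorem JTy.close {A B : Expr n} (h : JTy ℓ Γ A B) (hs : SubRel ℓ Γ σ τ) :
    DTy ℓ (A.subst σ) (B.subst τ) :=
  Der.ty_subst Der.ctx_nil (hs.der h.ctx) h.der

theorem JTm.close {t u A : Expr n} (h : JTm ℓ Γ t u A) (hs : SubRel ℓ Γ σ τ) :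
    D ℓ (t.subst σ) (u.subst τ) (A.subst σ) :=
  Der.tm_subst Der.ctx_nil (hs.der h.ty.ctx) h.der

theorem SubRel.der_up {A A' : Expr n} (hA : JTy ℓ Γ A A') (hs : SubRel ℓ Γ σ τ)
    (i : Fin (n + 1)) :
    Der ℓ (tmEq (Ctx.nil.snoc (A.subst σ)) (upSub σ i) (upSub τ i)
      (((Γ.snoc A).get i).subst (upSub σ))) := by
  have hc := Der.ctx_snoc Der.ctx_nil (hA.close hs).ty_left
  refine Fin.cases ?_ (fun j => ?_) i
  · change Der ℓ (tmEq _ (Expr.var 0) (Expr.var 0) (A.wk.subst (upSub σ)))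
    rw [Expr.wk_subst_upSub]
    exact Der.var 0 hc
  · change Der ℓ (tmEq _ (σ j).wk (τ j).wk ((Γ.get j).wk.subst (upSub σ)))
    rw [Expr.wk_subst_upSub]
    exact Der.tm_wk hc (hs.der hA.ctx j)

theorem JTy.close_up {A A' : Expr n} {B B' : Expr (n + 1)} (hA : JTy ℓ Γ A A')
    (hB : JTy ℓ (Γ.snoc A) B B') (hs : SubRel ℓ Γ σ τ) :
    Der ℓ (tyEq (Ctx.nil.snoc (A.subst σ)) (B.subst (upSub σ)) (B'.subst (upSub τ))) :=
  Der.ty_subst (Der.ctx_snoc Der.ctx_nil (hA.close hs).ty_left) (hs.der_up hA) hB.der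

theorem JTm.close_up {A A' : Expr n} {t u B : Expr (n + 1)} (hA : JTy ℓ Γ A A')
    (ht : JTm ℓ (Γ.snoc A) t u B) (hs : SubRel ℓ Γ σ τ) :
    Der ℓ (tmEq (Ctx.nil.snoc (A.subst σ)) (t.subst (upSub σ)) (u.subst (upSub τ))
      (B.subst (upSub σ))) :=
  Der.tm_subst (Der.ctx_snoc Der.ctx_nil (hA.close hs).ty_left) (hs.der_up hA) ht.der

/-! ### Structural rules -/

theorem JCtx.nil : JCtx ℓ .nil := ⟨Der.ctx_nil, fun i => i.elim0, fun _ i => i.elim0,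
  fun _ i => i.elim0⟩

theorem JCtx.snoc {A : Expr n} (hA : JTy ℓ Γ A A) : JCtx ℓ (Γ.snoc A) where
  der := Der.ctx_snoc hA.ctx.der hA.der
  judg i := by
    have hr : ∀ {B : Expr n}, IsJudg ℓ B → IsJudg ℓ B.wk := fun h => by
      rw [Expr.wk_eq_subst]; exact h.subst _
    refine Fin.cases (hr hA.judg_left) (fun j => hr (hA.ctx.judg j)) i
  eq h i := by
    refine Fin.cases ?_ (fun j => ?_) i
    · change den ℓ A.wk _ = den ℓ A.wk _
      rw [den_rename, den_rename]
      exact hA.eq h.tail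
    · change den ℓ (Γ.get j).wk _ = den ℓ (Γ.get j).wk _
      rw [den_rename, den_rename]
      exact hA.ctx.eq h.tail j
  good h i := by
    refine Fin.cases ?_ (fun j => ?_) i
    · change Good ℓ (A.wk.subst _) (den ℓ A.wk _)
      rw [den_rename, Expr.subst_rename]
      exact hA.good h.tail
    · change Good ℓ ((Γ.get j).wk.subst _) (den ℓ (Γ.get j).wk _)
      rw [den_rename, Expr.subst_rename]
      exact hA.ctx.good h.tail j

theorem JTy.symm {A B : Expr n} (h : JTy ℓ Γ A B) : JTy ℓ Γ B A where
  ctx := h.ctx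
  der := h.der.ty_symm
  judg_left := h.judg_right
  judg_right := h.judg_left
  eq hs := (h.eq (hs.symm h.ctx)).symm
  good hs := by
    have hs' := hs.left h.ctx
    rw [← h.eq hs']
    exact (h.good hs').conv (h.close hs')

theorem JTy.trans {A B C : Expr n} (h : JTy ℓ Γ A B) (h' : JTy ℓ Γ B C) : JTy ℓ Γ A C where
  ctx := h.ctx
  der := h.der.ty_trans h'.der
  judg_left := h.judg_left
  judg_right := h'.judg_right
  eq hs := (h.eq hs).trans (h'.eq (hs.right h.ctx))
  good := h.good

theorem JTy.left {A B : Expr n} (h : JTy ℓ Γ A B) : JTy ℓ Γ A A := h.trans h.symm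

theorem JTy.right {A B : Expr n} (h : JTy ℓ Γ A B) : JTy ℓ Γ B B := h.symm.trans h

theorem JTm.symm {t u A : Expr n} (h : JTm ℓ Γ t u A) : JTm ℓ Γ u t A where
  ty := h.ty
  der := h.der.tm_symm
  rel hs := by
    rw [h.ty.eq hs]
    exact (h.ty.good (hs.symm h.ty.ctx)).symm (h.rel (hs.symm h.ty.ctx))

theorem JTm.trans {t u v A : Expr n} (h : JTm ℓ Γ t u A) (h' : JTm ℓ Γ u v A) :
    JTm ℓ Γ t v A where
  ty := h.ty
  der := h.der.tm_trans h'.der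
  rel hs := (h.ty.good hs).trans (h.rel (hs.left h.ty.ctx)) (h'.rel hs)

theorem JTm.left {t u A : Expr n} (h : JTm ℓ Γ t u A) : JTm ℓ Γ t t A := h.trans h.symm

theorem JTm.conv {t u A B : Expr n} (h : JTm ℓ Γ t u A) (h' : JTy ℓ Γ A B) : JTm ℓ Γ t u B where
  ty := h'.right
  der := h.der.tm_conv h'.der
  rel hs := by
    rw [← h'.eq (hs.left h'.ctx)]
    exact h.rel hs

theorem JTm.var (hc : JCtx ℓ Γ) (i : Fin n) : JTm ℓ Γ (.var i) (.var i) (Γ.get i) where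
  ty := {
    ctx := hc
    der := by
      -- Only `ctx_snoc` derives a nonempty context, so inverting the derivation yields the
      -- well-formedness of each entry, which is then weakened.
      have : ∀ {m : ℕ} {Δ : Ctx m}, Der ℓ (Assertion.ctx Δ) → ∀ i, Der ℓ (tyEq Δ (Δ.get i) (Δ.get i)) := by
        intro m Δ
        induction Δ with
        | nil => exact fun _ i => i.elim0
        | snoc Δ A ih =>
          intro h i
          cases h with
          | ctx_snoc h hA =>
            refine Fin.cases ?_ (fun j => ?_) i
            · exact Der.ty_wk (Der.ctx_snoc h hA) hA
            · exact Der.ty_wk (Der.ctx_snoc h hA) (ih h j)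
      exact this hc.der i
    judg_left := hc.judg i
    judg_right := hc.judg i
    eq := fun hs => hc.eq hs i
    good := fun hs => hc.good hs i }
  der := Der.var i hc.der
  rel hs := hs i

theorem SubRel.comp {m : ℕ} {Δ : Ctx m} {ρ θ : Fin m → Expr n} (hΔ : ∀ i, IsJudg ℓ (Δ.get i))
    (h : ∀ i, JTm ℓ Γ (ρ i) (θ i) ((Δ.get i).subst ρ)) (hs : SubRel ℓ Γ σ τ) :
    SubRel ℓ Δ (fun i => (ρ i).subst σ) (fun i => (θ i).subst τ) := by
  intro i
  have := (h i).rel hs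
  rwa [(hΔ i).den_subst] at this

theorem JTy.subst {m : ℕ} {Δ : Ctx m} {ρ θ : Fin m → Expr n} {A B : Expr m} (hc : JCtx ℓ Γ)
    (h : ∀ i, JTm ℓ Γ (ρ i) (θ i) ((Δ.get i).subst ρ)) (hA : JTy ℓ Δ A B) :
    JTy ℓ Γ (A.subst ρ) (B.subst θ) where
  ctx := hc
  der := Der.ty_subst hc.der (fun i => (h i).der) hA.der
  judg_left := hA.judg_left.subst _
  judg_right := hA.judg_right.subst _
  eq hs := by
    rw [hA.judg_left.den_subst, hA.judg_right.den_subst]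
    exact hA.eq (hs.comp hA.ctx.judg h)
  good hs := by
    rw [hA.judg_left.den_subst, Expr.subst_subst]
    exact hA.good (hs.comp hA.ctx.judg h)

theorem JTm.subst {m : ℕ} {Δ : Ctx m} {ρ θ : Fin m → Expr n} {t u A : Expr m} (hc : JCtx ℓ Γ)
    (h : ∀ i, JTm ℓ Γ (ρ i) (θ i) ((Δ.get i).subst ρ)) (ht : JTm ℓ Δ t u A) :
    JTm ℓ Γ (t.subst ρ) (u.subst θ) (A.subst ρ) where
  ty := by
    have hA := ht.ty
    exact {
      ctx := hc
      der := (Der.ty_subst hc.der (fun i => (h i).der) hA.der).ty_left.ty_trans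
        (Der.ty_subst hc.der (fun i => (h i).der) hA.der).ty_left.ty_symm
      judg_left := hA.judg_left.subst _
      judg_right := hA.judg_left.subst _
      eq := fun hs => by
        rw [hA.judg_left.den_subst, hA.judg_left.den_subst]
        -- The hypothesis relates `ρ` to `θ`, not `ρ` to itself. Both `ρ` followed by `σ` and `ρ`
        -- followed by `τ` are therefore compared with `θ` followed by `τ`.
        have h₁ := hs.comp hA.ctx.judg h
        have h₂ := (hs.right hc).comp hA.ctx.judg h
        exact (hA.eq h₁).trans (hA.eq h₂).symm
      good := fun hs => by
        rw [hA.judg_left.den_subst, Expr.subst_subst]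
        exact hA.good (hs.comp hA.ctx.judg h) }
  der := Der.tm_subst hc.der (fun i => (h i).der) ht.der
  rel hs := by
    rw [ht.ty.judg_left.den_subst, Expr.subst_subst, Expr.subst_subst]
    exact ht.rel (hs.comp ht.ty.ctx.judg h)

/-- A valid term is equal to another one if it evaluates to the same values. -/
theorem JTm.of_exp {t u A : Expr n} (h : JTm ℓ Γ t t A) (hd : Der ℓ (tmEq Γ t u A))
    (he : ∀ σ : Fin n → Expr 0, Exp (t.subst σ) (u.subst σ)) : JTm ℓ Γ t u A where
  ty := h.ty
  der := hd
  rel hs := (h.ty.good hs).exp (h.rel hs) (he _)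
    (Der.tm_subst Der.ctx_nil (hs.der h.ty.ctx) hd)

/-- One substitution at a time suffices: `t` is compared with `u` under `σ`, and the validity of `u`
then carries it from `σ` to `τ`. -/
theorem JTm.of_diag {t u A : Expr n} (h : JTm ℓ Γ u u A) (hd : Der ℓ (tmEq Γ t u A))
    (hr : ∀ σ, SubRel ℓ Γ σ σ → den ℓ A σ (t.subst σ) (u.subst σ)) : JTm ℓ Γ t u A where
  ty := h.ty
  der := hd
  rel hs := (h.ty.good hs).trans (hr _ (hs.left h.ty.ctx)) (h.rel hs)

end

section
variable {ℓ : ℕ∞} {n : ℕ} {Γ : Ctx n} {σ τ : Fin n → Expr 0}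

protected theorem JTm.univ {α : ℕ} {A A' : Expr n} (h : JTm ℓ Γ A A' (.tp α)) (hs : SubRel ℓ Γ σ τ) :
    Univ ℓ α (A.subst σ) (A'.subst τ) := h.rel hs

protected theorem JTm.subst_cons {A a a' : Expr n} (ha : JTm ℓ Γ a a' A) (i : Fin (n + 1)) :
    JTm ℓ Γ (cons a Expr.var i) (cons a' Expr.var i)
      (((Γ.snoc A).get i).subst (cons a Expr.var)) := by
  refine Fin.cases ?_ (fun j => ?_) i
  · change JTm ℓ Γ a a' (A.wk.subst _)
    rwa [Expr.wk_subst_cons, Expr.subst_id]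
  · change JTm ℓ Γ (.var j) (.var j) ((Γ.get j).wk.subst _)
    rw [Expr.wk_subst_cons, Expr.subst_id]
    exact JTm.var ha.ty.ctx j

protected theorem JTy.inst {A a a' : Expr n} {B B' : Expr (n + 1)} (hB : JTy ℓ (Γ.snoc A) B B')
    (ha : JTm ℓ Γ a a' A) : JTy ℓ Γ (B.inst a) (B'.inst a') :=
  JTy.subst ha.ty.ctx ha.subst_cons hB

/-! ### The rules of the framework -/

protected theorem JTy.lfUnit (hc : JCtx ℓ Γ) : JTy ℓ Γ lfUnit lfUnit where
  ctx := hc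
  der := Der.lfUnit hc.der
  judg_left := trivial
  judg_right := trivial
  eq _ := rfl
  good _ := good_D _

protected theorem JTm.lfStar (hc : JCtx ℓ Γ) : JTm ℓ Γ lfStar lfStar lfUnit where
  ty := JTy.lfUnit hc
  der := Der.lfStar hc.der
  rel _ := Der.lfStar Der.ctx_nil

protected theorem JTm.lfUnit_eta {t : Expr n} (h : JTm ℓ Γ t t lfUnit) : JTm ℓ Γ t lfStar lfUnit :=
  JTm.of_diag (JTm.lfStar h.ty.ctx) (Der.lfUnit_eta h.der)
    fun _ hs => Der.lfUnit_eta (h.close hs)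

section
variable {A A' : Expr n} {B B' : Expr (n + 1)}

protected theorem JTy.good_cons (hB : JTy ℓ (Γ.snoc A) B B') (hs : SubRel ℓ Γ σ τ) {a a' : Expr 0}
    (ha : den ℓ A σ a a') : Good ℓ ((B.subst (upSub σ)).inst a) (den ℓ B (cons a σ)) := by
  rw [Expr.subst_upSub_inst]
  exact hB.good (hs.cons ha)

protected theorem JTy.lfPi (hA : JTy ℓ Γ A A') (hB : JTy ℓ (Γ.snoc A) B B') :
    JTy ℓ Γ (lfPi A B) (lfPi A' B') where
  ctx := hA.ctx
  der := Der.lfPi hA.der hB.der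
  judg_left := ⟨hA.judg_left, hB.judg_left⟩
  judg_right := ⟨hA.judg_right, hB.judg_right⟩
  eq hs := by
    simp only [den]
    rw [← hA.eq hs]
    exact PiRel.eq (hA.close hs) (hA.close_up hB hs) (hA.good hs)
      (fun a a' ha => hB.good_cons hs ha) (fun a a' ha => hB.eq (hs.cons ha))
  good hs := Good.lfPi (hA.close hs).ty_left (hA.close_up hB hs).ty_left (hA.good hs)
    (fun a a' ha => hB.good_cons hs ha)
    (fun a a' ha => hB.left.eq ((hs.left hA.ctx).cons ha))

protected theorem JTy.lfSig (hA : JTy ℓ Γ A A') (hB : JTy ℓ (Γ.snoc A) B B') :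
    JTy ℓ Γ (lfSig A B) (lfSig A' B') where
  ctx := hA.ctx
  der := Der.lfSig hA.der hB.der
  judg_left := ⟨hA.judg_left, hB.judg_left⟩
  judg_right := ⟨hA.judg_right, hB.judg_right⟩
  eq hs := by
    simp only [den]
    rw [← hA.eq hs]
    exact SigRel.eq (hA.close hs) (hA.close_up hB hs) (hA.good hs)
      (fun a a' ha => hB.good_cons hs ha) (fun a a' ha => hB.eq (hs.cons ha))
  good hs := Good.lfSig (hA.close hs).ty_left (hA.close_up hB hs).ty_left (hA.good hs)
    (fun a a' ha => hB.good_cons hs ha)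
    (fun a a' ha => hB.left.eq ((hs.left hA.ctx).cons ha))

protected theorem JTm.lfLam {t t' : Expr (n + 1)} (hA : JTy ℓ Γ A A') (hB : JTy ℓ (Γ.snoc A) B B')
    (ht : JTm ℓ (Γ.snoc A) t t' B) : JTm ℓ Γ (lfLam A B t) (lfLam A' B' t') (lfPi A B) where
  ty := JTy.lfPi hA.left hB.left
  der := Der.lfLam hA.der hB.der ht.der
  rel {σ τ} hs := by
    have dA := hA.close hs
    have dB := hA.close_up hB hs
    have dt := ht.close_up hA hs
    have dl := Der.lfLam dA dB dt
    refine ⟨dl, fun a a' k => ?_⟩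
    have da := (hA.good hs).der k
    have r := ht.rel (hs.cons k)
    have d₁ := Der.lfPi_beta dA.ty_left dB.ty_left dt.tm_left da.tm_left
    -- Both applications are β-expansions of the bodies instantiated at `a` and `a'`, which are
    -- related by the validity of `t` and `t'`.
    refine (hB.good_cons hs k).exp₂ r ?_ ?_ ?_ (Der.lfApp dA.ty_left dB.ty_left dl da)
    · rw [← Expr.subst_upSub_inst]; exact Exp.beta
    · rw [← Expr.subst_upSub_inst]; exact Exp.beta
    · rw [← Expr.subst_upSub_inst t]; exact d₁.tm_symm

protected theorem JTm.lfApp {f f' a a' : Expr n} (hA : JTy ℓ Γ A A') (hB : JTy ℓ (Γ.snoc A) B B')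
    (hf : JTm ℓ Γ f f' (lfPi A B)) (ha : JTm ℓ Γ a a' A) :
    JTm ℓ Γ (lfApp A B f a) (lfApp A' B' f' a') (B.inst a) where
  ty := JTy.inst hB.left ha.left
  der := Der.lfApp hA.der hB.der hf.der ha.der
  rel {σ τ} hs := by
    have k := ha.rel hs
    have r := (hf.rel hs).2 _ _ k
    rw [hB.judg_left.den_inst]
    exact (hB.good_cons hs k).exp r (Exp.lfApp Exp.rfl)
      (Der.lfApp (hA.close hs) (hA.close_up hB hs) (hf.close hs) (ha.close hs))

protected theorem JTm.lfPi_beta {t : Expr (n + 1)} {a : Expr n} (hA : JTy ℓ Γ A A)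
    (hB : JTy ℓ (Γ.snoc A) B B) (ht : JTm ℓ (Γ.snoc A) t t B) (ha : JTm ℓ Γ a a A) :
    JTm ℓ Γ (lfApp A B (lfLam A B t) a) (t.inst a) (B.inst a) :=
  JTm.of_exp (JTm.lfApp hA hB (JTm.lfLam hA hB ht) ha)
    (Der.lfPi_beta hA.der hB.der ht.der ha.der) fun σ => by
      rw [Expr.inst_subst, ← Expr.subst_upSub_inst]
      exact Exp.of_beta

protected theorem JTm.lfPi_eta {f : Expr n} (hA : JTy ℓ Γ A A) (hB : JTy ℓ (Γ.snoc A) B B)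
    (hf : JTm ℓ Γ f f (lfPi A B)) :
    JTm ℓ Γ (lfLam A B (lfApp A.wk (B.rename (upRen Fin.succ)) f.wk v0)) f (lfPi A B) := by
  have hd := Der.lfPi_eta hA.der hB.der hf.der
  refine JTm.of_diag hf hd fun σ hs => ?_
  have hd' := Der.tm_subst Der.ctx_nil (hs.der hA.ctx) hd
  refine ⟨hd', fun a a' k => ?_⟩
  have r := (hf.rel hs).2 _ _ k
  have da := (hA.good hs).der k
  have g := hB.good_cons hs k
  refine g.exp₂ r ?_ Exp.rfl ?_ (Der.lfApp (hA.close hs) (hA.close_up hB hs) hd' da)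
  -- Applied to `a`, the η-expansion β-reduces to an application of `f` to `a`.
  · refine Exp.trans ?_ Exp.beta
    rw [Expr.subst_upSub_inst]
    simp only [Expr.subst, Expr.wk_subst_cons, cons_zero]
    exact Exp.lfApp Exp.rfl
  · exact Der.lfApp (hA.close hs) (hA.close_up hB hs) hd'.tm_symm da.tm_left

protected theorem JTm.lfPair {a a' b b' : Expr n} (hA : JTy ℓ Γ A A') (hB : JTy ℓ (Γ.snoc A) B B')
    (ha : JTm ℓ Γ a a' A) (hb : JTm ℓ Γ b b' (B.inst a)) :
    JTm ℓ Γ (lfPair A B a b) (lfPair A' B' a' b') (lfSig A B) where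
  ty := JTy.lfSig hA.left hB.left
  der := Der.lfPair hA.der hB.der ha.der hb.der
  rel {σ τ} hs := by
    have dA := hA.close hs
    have dB := hA.close_up hB hs
    have da := ha.close hs
    have db := hb.close hs
    rw [Expr.inst_subst, ← Expr.subst_upSub_inst] at db
    have dp := Der.lfPair dA dB da db
    have d₁ := Der.lfSig_fst dA.ty_left dB.ty_left da.tm_left db.tm_left
    have d₂ := Der.lfSig_snd dA.ty_left dB.ty_left da.tm_left db.tm_left
    have k := ha.rel hs
    have r := hb.rel hs
    rw [hB.judg_left.den_inst] at r
    have gA := hA.good hs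
    have k' := gA.exp (gA.left k) (Exp.fst_pair) d₁.tm_symm
    refine ⟨dp, gA.exp₂ k Exp.fst_pair Exp.fst_pair d₁.tm_symm
      (Der.lfFst dA.ty_left dB.ty_left dp), ?_⟩
    -- The second components have to be related over the first projection of the pair rather than
    -- over its first entry; `e` identifies the two relations.
    have e := hB.left.eq ((hs.left hA.ctx).cons k')
    refine (congrFun (congrFun e _) _).mp ?_
    refine (hB.good_cons hs k).exp₂ r Exp.snd_pair Exp.snd_pair d₂.tm_symm ?_
    exact (Der.lfSnd dA.ty_left dB.ty_left dp).tm_conv (Der.ty_inst dB.ty_left d₁)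

protected theorem JTm.lfFst {p p' : Expr n} (hA : JTy ℓ Γ A A') (hB : JTy ℓ (Γ.snoc A) B B')
    (hp : JTm ℓ Γ p p' (lfSig A B)) : JTm ℓ Γ (lfFst A B p) (lfFst A' B' p') A where
  ty := hA.left
  der := Der.lfFst hA.der hB.der hp.der
  rel hs := (hA.good hs).exp (hp.rel hs).2.1 (Exp.lfFst Exp.rfl)
    (Der.lfFst (hA.close hs) (hA.close_up hB hs) (hp.close hs))

protected theorem JTm.lfSnd {p p' : Expr n} (hA : JTy ℓ Γ A A') (hB : JTy ℓ (Γ.snoc A) B B')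
    (hp : JTm ℓ Γ p p' (lfSig A B)) :
    JTm ℓ Γ (lfSnd A B p) (lfSnd A' B' p') (B.inst (.lfFst A B p)) where
  ty := JTy.inst hB.left (JTm.lfFst hA.left hB.left hp.left)
  der := Der.lfSnd hA.der hB.der hp.der
  rel {σ τ} hs := by
    rw [hB.judg_left.den_inst]
    have r := (hp.rel hs).2
    exact (hB.good_cons hs r.1).exp r.2 (Exp.lfSnd Exp.rfl)
      (Der.lfSnd (hA.close hs) (hA.close_up hB hs) (hp.close hs))

protected theorem JTm.lfSig_fst {a b : Expr n} (hA : JTy ℓ Γ A A) (hB : JTy ℓ (Γ.snoc A) B B)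
    (ha : JTm ℓ Γ a a A) (hb : JTm ℓ Γ b b (B.inst a)) :
    JTm ℓ Γ (lfFst A B (lfPair A B a b)) a A :=
  (JTm.of_exp ha (Der.lfSig_fst hA.der hB.der ha.der hb.der).tm_symm fun _ => Exp.fst_pair).symm

protected theorem JTm.lfSig_snd {a b : Expr n} (hA : JTy ℓ Γ A A) (hB : JTy ℓ (Γ.snoc A) B B)
    (ha : JTm ℓ Γ a a A) (hb : JTm ℓ Γ b b (B.inst a)) :
    JTm ℓ Γ (lfSnd A B (lfPair A B a b)) b (B.inst a) :=
  (JTm.of_exp hb (Der.lfSig_snd hA.der hB.der ha.der hb.der).tm_symm fun _ => Exp.snd_pair).symm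

protected theorem JTm.lfSig_eta {p : Expr n} (hA : JTy ℓ Γ A A) (hB : JTy ℓ (Γ.snoc A) B B)
    (hp : JTm ℓ Γ p p (lfSig A B)) :
    JTm ℓ Γ (lfPair A B (lfFst A B p) (lfSnd A B p)) p (lfSig A B) := by
  have hd := Der.lfSig_eta hA.der hB.der hp.der
  refine JTm.of_diag hp hd fun σ hs => ?_
  have hd' := Der.tm_subst Der.ctx_nil (hs.der hA.ctx) hd
  have dA := hA.close hs
  have dB := hA.close_up hB hs
  have r := (hp.rel hs).2
  have d₁ := Der.lfFst dA dB hd'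
  have gA := hA.good hs
  have k := gA.exp r.1 Exp.fst_pair d₁.tm_symm
  refine ⟨hd', gA.symm k, ?_⟩
  have e := hB.eq (hs.cons k)
  refine (congrFun (congrFun e _) _).mp ?_
  have g := hB.good_cons hs k
  exact g.symm (g.exp r.2 Exp.snd_pair
    ((Der.lfSnd dA dB hd').tm_symm.tm_conv (Der.ty_inst dB d₁)))

protected theorem JTy.lfEq {a a' b b' : Expr n} (hA : JTy ℓ Γ A A') (ha : JTm ℓ Γ a a' A)
    (hb : JTm ℓ Γ b b' A) : JTy ℓ Γ (lfEq A a b) (lfEq A' a' b') where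
  ctx := hA.ctx
  der := Der.lfEq hA.der ha.der hb.der
  judg_left := hA.judg_left
  judg_right := hA.judg_right
  eq {σ τ} hs := by
    have d := Der.lfEq (hA.close hs) (ha.close hs) (hb.close hs)
    have gA := hA.good hs
    have ra := ha.rel hs
    have rb := hb.rel hs
    simp only [den]
    rw [← hA.eq hs]
    funext p p'
    refine propext ⟨fun h => ⟨h.1.tm_conv d, ?_⟩, fun h => ⟨h.1.tm_conv d.ty_symm, ?_⟩⟩
    · exact gA.trans (gA.symm ra) (gA.trans h.2 rb)
    · exact gA.trans ra (gA.trans h.2 (gA.symm rb))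
  good _ := Good.lfEq _

protected theorem JTm.lfRefl {a a' : Expr n} (hA : JTy ℓ Γ A A') (ha : JTm ℓ Γ a a' A) :
    JTm ℓ Γ (lfRefl A a) (lfRefl A' a') (lfEq A a a) where
  ty := JTy.lfEq hA.left ha.left ha.left
  der := Der.lfRefl hA.der ha.der
  rel hs := ⟨Der.lfRefl (hA.close hs) (ha.close hs), (hA.good hs).left (ha.rel hs)⟩

/-- Sound by design: `LfEqRel` contains the statement that the two sides are related, and a valid
proof supplies it at every closing substitution. -/
protected theorem JTm.lfEq_reflection {a b p : Expr n} (hA : JTy ℓ Γ A A) (ha : JTm ℓ Γ a a A)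
    (hb : JTm ℓ Γ b b A) (hp : JTm ℓ Γ p p (lfEq A a b)) : JTm ℓ Γ a b A :=
  JTm.of_diag hb (Der.lfEq_reflection hA.der ha.der hb.der hp.der) fun _ hs => (hp.rel hs).2

protected theorem JTm.lfEq_eta {a b p : Expr n} (hA : JTy ℓ Γ A A) (ha : JTm ℓ Γ a a A)
    (hb : JTm ℓ Γ b b A) (hp : JTm ℓ Γ p p (lfEq A a b)) :
    JTm ℓ Γ p (lfRefl A a) (lfEq A a b) := by
  have hd := Der.lfEq_eta hA.der ha.der hb.der hp.der
  exact {
    ty := hp.ty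
    der := hd
    rel := fun hs => ⟨Der.tm_subst Der.ctx_nil (hs.der hA.ctx) hd, (hp.rel hs).2⟩ }

end

/-! ### Types, terms and lifts -/

protected theorem JTy.tp {α : ℕ} (hα : (α : ℕ∞) < ℓ) (hc : JCtx ℓ Γ) : JTy ℓ Γ (tp α) (tp α) where
  ctx := hc
  der := Der.tp hα hc.der
  judg_left := hα
  judg_right := hα
  eq _ := rfl
  good _ := good_Univ

protected theorem JTy.tm {α : ℕ} {A A' : Expr n} (h : JTm ℓ Γ A A' (tp α)) :
    JTy ℓ Γ (tm α A) (tm α A') where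
  ctx := h.ty.ctx
  der := Der.tm h.der
  judg_left := trivial
  judg_right := trivial
  eq hs := (h.univ hs).El_eq
  good hs := (h.univ hs).good

protected theorem JTm.lift {α β : ℕ} {A A' : Expr n} (hαβ : α ≤ β) (hβ : (β : ℕ∞) < ℓ)
    (h : JTm ℓ Γ A A' (tp α)) : JTm ℓ Γ (lift α β A) (lift α β A') (tp β) where
  ty := JTy.tp hβ h.ty.ctx
  der := Der.lift hαβ hβ h.der
  rel hs := (h.univ hs).lift hαβ hβ

protected theorem JTm.lift_self {α : ℕ} {A : Expr n} (h : JTm ℓ Γ A A (tp α)) :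
    JTm ℓ Γ (Expr.lift α α A) A (tp α) :=
  (JTm.of_exp h (Der.lift_self h.der).tm_symm fun _ => Exp.lift).symm

protected theorem JTm.lift_lift {α β γ : ℕ} {A : Expr n} (hαβ : α ≤ β) (hβγ : β ≤ γ)
    (hγ : (γ : ℕ∞) < ℓ) (h : JTm ℓ Γ A A (tp α)) :
    JTm ℓ Γ (Expr.lift β γ (Expr.lift α β A)) (Expr.lift α γ A) (tp γ) :=
  (JTm.of_exp (JTm.lift (hαβ.trans hβγ) hγ h) (Der.lift_lift hαβ hβγ hγ h.der).tm_symm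
    fun _ => Exp.of_lift.trans (Exp.lift.trans Exp.lift)).symm

protected theorem JTy.tm_lift {α β : ℕ} {A : Expr n} (hαβ : α ≤ β) (hβ : (β : ℕ∞) < ℓ)
    (h : JTm ℓ Γ A A (tp α)) : JTy ℓ Γ (Expr.tm α A) (Expr.tm β (lift α β A)) where
  ctx := h.ty.ctx
  der := Der.tm_lift hαβ hβ h.der
  judg_left := trivial
  judg_right := trivial
  eq hs := (h.univ hs).El_eq.trans ((h.univ (hs.right h.ty.ctx)).El_lift hαβ hβ).symm
  good hs := (h.univ hs).good

/-- Equality of types in the model is a derivable equality together with equality of relations. The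
rule itself provides the former. For the latter, the lifted types have the same relation, and
lifting changes neither. -/
protected theorem JTm.lift_inj {α β : ℕ} {A B : Expr n} (hαβ : α ≤ β) (hβ : (β : ℕ∞) < ℓ)
    (hA : JTm ℓ Γ A A (tp α)) (hB : JTm ℓ Γ B B (tp α))
    (h : JTm ℓ Γ (Expr.lift α β A) (Expr.lift α β B) (tp β)) : JTm ℓ Γ A B (tp α) := by
  have hd := Der.lift_inj hαβ hβ hA.der hB.der h.der
  refine JTm.of_diag hB hd fun σ hs => ?_
  have uA := hA.univ hs
  have uB := hB.univ hs
  have e := (h.univ hs).El_eq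
  refine Univ.intro (Der.tm_subst Der.ctx_nil (hs.der hA.ty.ctx) hd) uA.ty ?_
  have e' : El ℓ α (A.subst σ) = El ℓ α (B.subst σ) := by
    rw [← uA.El_lift hαβ hβ, ← uB.El_lift hαβ hβ]; exact e
  rw [e']
  exact uB.ty

end

/-! ### Closed judgements -/

section
variable {ℓ : ℕ∞} {n : ℕ} {Γ : Ctx n} {σ τ : Fin n → Expr 0}

theorem Expr.subst_closed (t : Expr 0) (σ : Fin 0 → Expr 0) : t.subst σ = t := by
  rw [show σ = Expr.var from funext fun i => i.elim0, Expr.subst_id]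

theorem SubRel.nil {σ τ : Fin 0 → Expr 0} : SubRel ℓ .nil σ τ := fun i => i.elim0

protected theorem JTm.rel_closed {t u A : Expr 0} (h : JTm ℓ .nil t u A) : den ℓ A Expr.var t u := by
  have := h.rel (SubRel.nil (σ := Expr.var) (τ := Expr.var))
  rwa [Expr.subst_closed, Expr.subst_closed] at this

/-- Related closing substitutions consist of valid closed equalities. Substituting them reduces the
rules for type formers and eliminators from arbitrary contexts to the empty one. -/
theorem SubRel.jtm (hc : JCtx ℓ Γ) (hs : SubRel ℓ Γ σ τ) (i : Fin n) :
    JTm ℓ .nil (σ i) (τ i) ((Γ.get i).subst σ) where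
  ty := {
    ctx := JCtx.nil
    der := ((JTm.var hc i).ty.close hs).ty_left
    judg_left := (hc.judg i).subst _
    judg_right := (hc.judg i).subst _
    eq := fun _ => by simp only [(hc.judg i).den_subst, Expr.subst_closed]
    good := fun _ => by
      simp only [(hc.judg i).den_subst, Expr.subst_closed]
      exact hc.good hs i }
  der := hs.der hc i
  rel _ := by
    simp only [(hc.judg i).den_subst, Expr.subst_closed]
    exact hs i

protected theorem JTm.closed {t u A : Expr n} (h : JTm ℓ Γ t u A) (hs : SubRel ℓ Γ σ τ) :
    JTm ℓ .nil (t.subst σ) (u.subst τ) (A.subst σ) :=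
  JTm.subst JCtx.nil (hs.jtm h.ty.ctx) h

protected theorem JTm.univ_closed {α : ℕ} {A A' : Expr 0} (h : JTm ℓ .nil A A' (tp α)) : Univ ℓ α A A' :=
  h.rel_closed

protected theorem JTm.el_closed {α : ℕ} {A a a' : Expr 0} (h : JTm ℓ .nil a a' (tm α A)) :
    El ℓ α A a a' := by
  have : El ℓ α (A.subst Expr.var) a a' := h.rel_closed
  rwa [Expr.subst_id] at this

/-- Elements of the relation of a type become valid closed equalities, to which the rules already
verified can be applied, for instance to instantiate a family at arbitrary related arguments. -/
protected theorem JTm.of_el {α : ℕ} {A A' a a' : Expr 0} (hA : JTm ℓ .nil A A' (tp α))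
    (h : El ℓ α A a a') : JTm ℓ .nil a a' (tm α A) where
  ty := (JTy.tm hA).left
  der := hA.univ_closed.good.der h
  rel _ := by simp only [den]; rwa [Expr.subst_closed, Expr.subst_closed, Expr.subst_closed]

protected theorem JTm.wk {t u A C : Expr n} (hC : JTy ℓ Γ C C) (h : JTm ℓ Γ t u A) :
    JTm ℓ (Γ.snoc C) t.wk u.wk A.wk := by
  have hc := JCtx.snoc hC
  simp only [Expr.wk_eq_subst]
  refine JTm.subst hc (fun i => ?_) h
  rw [← Expr.wk_eq_subst]
  exact JTm.var hc i.succ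

protected theorem JTm.level {α : ℕ} {A A' : Expr n} (h : JTm ℓ Γ A A' (tp α)) : (α : ℕ∞) < ℓ :=
  h.ty.judg_left

/-! ### Families -/

protected theorem JTy.fam {α : ℕ} {A A' : Expr n} (hA : JTm ℓ Γ A A' (tp α)) :
    JTy ℓ Γ (Fam α A) (Fam α A') :=
  JTy.lfPi (JTy.tm hA) (JTy.tp hA.level (JCtx.snoc (JTy.tm hA).left))

protected theorem JTm.fam {α : ℕ} {A A' B B' x x' : Expr n} (hA : JTm ℓ Γ A A' (tp α))
    (hB : JTm ℓ Γ B B' (Fam α A)) (hx : JTm ℓ Γ x x' (tm α A)) :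
    JTm ℓ Γ (fam α A B x) (fam α A' B' x') (tp α) :=
  JTm.lfApp (JTy.tm hA) (JTy.tp hA.level (JCtx.snoc (JTy.tm hA).left)) hB hx

protected theorem JTy.tm_fam {α : ℕ} {A A' B B' : Expr n} (hA : JTm ℓ Γ A A' (tp α))
    (hB : JTm ℓ Γ B B' (Fam α A)) :
    JTy ℓ (Γ.snoc (.tm α A)) (.tm α (Expr.fam α A.wk B.wk v0))
      (.tm α (Expr.fam α A'.wk B'.wk v0)) := by
  have hT := (JTy.tm hA).left
  exact JTy.tm (JTm.fam (hA.wk hT) (hB.wk hT) (JTm.var (JCtx.snoc hT) 0))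

protected theorem JTy.pairs {α : ℕ} {A A' B B' : Expr n} (hA : JTm ℓ Γ A A' (tp α))
    (hB : JTm ℓ Γ B B' (Fam α A)) : JTy ℓ Γ (Pairs α A B) (Pairs α A' B') :=
  JTy.lfSig (JTy.tm hA) (JTy.tm_fam hA hB)

protected theorem JTy.sections {α : ℕ} {A A' B B' : Expr n} (hA : JTm ℓ Γ A A' (tp α))
    (hB : JTm ℓ Γ B B' (Fam α A)) : JTy ℓ Γ (Sections α A B) (Sections α A' B') :=
  JTy.lfPi (JTy.tm hA) (JTy.tm_fam hA hB)

theorem Expr.liftFam_subst {m : ℕ} {α β : ℕ} {A B : Expr n} (ρ : Fin n → Expr m) :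
    (liftFam α β A B).subst ρ = liftFam α β (A.subst ρ) (B.subst ρ) := by
  simp only [liftFam, Expr.fam, Expr.subst, Expr.wk_subst_upSub]
  rfl

theorem Expr.wk_liftFam {α β : ℕ} {A B : Expr n} :
    (liftFam α β A B).wk = liftFam α β A.wk B.wk := by
  simp only [Expr.wk_eq_subst (liftFam α β A B), Expr.liftFam_subst, ← Expr.wk_eq_subst]

protected theorem JTm.lift_fam {α β : ℕ} {A A' B B' : Expr n} (hαβ : α ≤ β) (hβ : (β : ℕ∞) < ℓ)
    (hA : JTm ℓ Γ A A' (tp α)) (hB : JTm ℓ Γ B B' (Fam α A)) :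
    JTm ℓ (Γ.snoc (.tm α A)) (Expr.lift α β (Expr.fam α A.wk B.wk v0))
      (Expr.lift α β (Expr.fam α A'.wk B'.wk v0)) (tp β) := by
  have hT := (JTy.tm hA).left
  exact JTm.lift hαβ hβ (JTm.fam (hA.wk hT) (hB.wk hT) (JTm.var (JCtx.snoc hT) 0))

protected theorem JTm.liftFam {α β : ℕ} {A A' B B' : Expr n} (hαβ : α ≤ β) (hβ : (β : ℕ∞) < ℓ)
    (hA : JTm ℓ Γ A A' (tp α)) (hB : JTm ℓ Γ B B' (Fam α A)) :
    JTm ℓ Γ (Expr.liftFam α β A B) (Expr.liftFam α β A' B') (Fam β (Expr.lift α β A)) := by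
  have hT := (JTy.tm hA).left
  have hβT := JTy.tp hβ (JCtx.snoc hT)
  exact (JTm.lfLam (JTy.tm hA) hβT (JTm.lift_fam hαβ hβ hA hB)).conv
    (JTy.lfPi (JTy.tm_lift hαβ hβ hA.left) hβT)

protected theorem JTm.fam_liftFam {α β : ℕ} {A B x : Expr n} (hαβ : α ≤ β) (hβ : (β : ℕ∞) < ℓ)
    (hA : JTm ℓ Γ A A (tp α)) (hB : JTm ℓ Γ B B (Fam α A)) (hx : JTm ℓ Γ x x (.tm α A)) :
    JTm ℓ Γ (Expr.fam β (Expr.lift α β A) (Expr.liftFam α β A B) x)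
      (Expr.lift α β (Expr.fam α A B x)) (tp β) := by
  have hT := JTy.tm hA
  have hβT := JTy.tp hβ (JCtx.snoc hT)
  have h₁ : JTm ℓ Γ (Expr.lfApp (.tm α A) (tp β) (Expr.liftFam α β A B) x)
      ((Expr.lift α β (Expr.fam α A.wk B.wk v0)).inst x) (tp β) :=
    JTm.lfPi_beta hT hβT (JTm.lift_fam hαβ hβ hA hB) hx
  have e : (Expr.lift α β (Expr.fam α A.wk B.wk v0)).inst x = Expr.lift α β (Expr.fam α A B x) := by
    simp only [Expr.fam, Expr.inst_eq, Expr.subst, Expr.wk_subst_cons, Expr.subst_id, cons_zero]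
  rw [e] at h₁
  refine JTm.trans ?_ h₁
  -- The application annotated by the lifted type is traded for the one annotated by the type
  -- itself, where β applies.
  exact (JTm.lfApp (JTy.tm_lift hαβ hβ hA) hβT (JTm.lfLam hT hβT (JTm.lift_fam hαβ hβ hA hB))
    hx).symm

protected theorem JTy.tm_fam_liftFam {α β : ℕ} {A B : Expr n} (hαβ : α ≤ β) (hβ : (β : ℕ∞) < ℓ)
    (hA : JTm ℓ Γ A A (tp α)) (hB : JTm ℓ Γ B B (Fam α A)) :
    JTy ℓ (Γ.snoc (.tm α A)) (.tm α (Expr.fam α A.wk B.wk v0))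
      (.tm β (Expr.fam β (Expr.lift α β A).wk (Expr.liftFam α β A B).wk v0)) := by
  have hT := JTy.tm hA
  have hx := JTm.var (JCtx.snoc hT) 0
  have hF := JTm.fam (hA.wk hT) (hB.wk hT) hx
  rw [Expr.wk_liftFam]
  exact (JTy.tm_lift hαβ hβ hF).trans
    (JTy.tm (JTm.fam_liftFam hαβ hβ (hA.wk hT) (hB.wk hT) hx)).symm

protected theorem JTy.pairs_lift {α β : ℕ} {A B : Expr n} (hαβ : α ≤ β) (hβ : (β : ℕ∞) < ℓ)
    (hA : JTm ℓ Γ A A (tp α)) (hB : JTm ℓ Γ B B (Fam α A)) :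
    JTy ℓ Γ (Pairs α A B) (Pairs β (Expr.lift α β A) (Expr.liftFam α β A B)) :=
  JTy.lfSig (JTy.tm_lift hαβ hβ hA) (JTy.tm_fam_liftFam hαβ hβ hA hB)

protected theorem JTy.sections_lift {α β : ℕ} {A B : Expr n} (hαβ : α ≤ β) (hβ : (β : ℕ∞) < ℓ)
    (hA : JTm ℓ Γ A A (tp α)) (hB : JTm ℓ Γ B B (Fam α A)) :
    JTy ℓ Γ (Sections α A B) (Sections β (Expr.lift α β A) (Expr.liftFam α β A B)) :=
  JTy.lfPi (JTy.tm_lift hαβ hβ hA) (JTy.tm_fam_liftFam hαβ hβ hA hB)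

end

/-! ### Dependent pair types and dependent function types -/

section
variable {ℓ : ℕ∞} {α β : ℕ} {A A' B B' : Expr 0}

/-- The relation of the judgement `Pairs α A B`. -/
def PairsRel (ℓ : ℕ∞) (α : ℕ) (A B : Expr 0) : Rel := den ℓ (Pairs α A B) Expr.var

/-- The relation of the judgement `Sections α A B`. -/
def SectionsRel (ℓ : ℕ∞) (α : ℕ) (A B : Expr 0) : Rel := den ℓ (Sections α A B) Expr.var

theorem PairsRel_eq : PairsRel ℓ α A B = SigRel ℓ (tm α A) (tm α (fam α A.wk B.wk v0)) (El ℓ α A)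
    (fun a => El ℓ α (fam α A B a)) := by
  simp only [PairsRel, Pairs, den, upSub_id, Expr.subst_id]
  simp only [fam, Expr.subst, Expr.wk_subst_cons, Expr.subst_id, cons_zero]

theorem SectionsRel_eq : SectionsRel ℓ α A B =
    PiRel ℓ (tm α A) (tm α (fam α A.wk B.wk v0)) (El ℓ α A)
      (fun a => El ℓ α (fam α A B a)) := by
  simp only [SectionsRel, Sections, den, upSub_id, Expr.subst_id]
  simp only [fam, Expr.subst, Expr.wk_subst_cons, Expr.subst_id, cons_zero]

protected theorem JTy.eq_closed {X Y : Expr 0} (h : JTy ℓ .nil X Y) :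
    den ℓ X Expr.var = den ℓ Y Expr.var := h.eq SubRel.nil

protected theorem JTy.good_closed {X Y : Expr 0} (h : JTy ℓ .nil X Y) : Good ℓ X (den ℓ X Expr.var) := by
  have := h.good (SubRel.nil (σ := Expr.var) (τ := Expr.var))
  rwa [Expr.subst_id] at this

protected theorem JTm.univ_fam (hA : JTm ℓ .nil A A' (tp α)) (hB : JTm ℓ .nil B B' (Fam α A))
    {a a' : Expr 0} (ha : El ℓ α A a a') : Univ ℓ α (Expr.fam α A B a) (Expr.fam α A' B' a') :=
  (JTm.fam hA hB (JTm.of_el hA ha)).univ_closed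

protected theorem JTm.ty_sigma (hA : JTm ℓ .nil A A (tp α)) (hB : JTm ℓ .nil B B (Fam α A)) :
    Ty ℓ α (sigma α A B)
      (PreRel ℓ (tm α (sigma α A B)) (unpair α A B) (PairsRel ℓ α A B)) := by
  rw [PairsRel_eq]
  exact .sigma hA.der hB.der hA.univ_closed.ty (fun a a' k => (JTm.univ_fam hA hB k).ty)
    (fun a a' k => (JTm.univ_fam hA hB k).El_eq)

protected theorem JTm.ty_pi (hα : ((max 1 α : ℕ) : ℕ∞) < ℓ) (hA : JTm ℓ .nil A A (tp α))
    (hB : JTm ℓ .nil B B (Fam α A)) :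
    Ty ℓ (max 1 α) (pi α A B)
      (PreRel ℓ (tm (max 1 α) (pi α A B)) (unabs α A B) (SectionsRel ℓ α A B)) := by
  rw [SectionsRel_eq]
  exact .pi hα hA.der hB.der hA.univ_closed.ty (fun a a' k => (JTm.univ_fam hA hB k).ty)
    (fun a a' k => (JTm.univ_fam hA hB k).El_eq)

/-- Both relations are pulled back along `unpair`, whose annotations do not affect evaluation, from
relations of equal judgements of pairs. -/
protected theorem JTm.univ_sigma (hA : JTm ℓ .nil A A' (tp α)) (hB : JTm ℓ .nil B B' (Fam α A)) :
    Univ ℓ α (sigma α A B) (sigma α A' B') := by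
  have hB' := hB.symm.left.conv (JTy.fam hA)
  have hd := Der.sigma hA.der hB.der
  refine Univ.intro hd (JTm.ty_sigma hA.left hB.left) ?_
  have hP := JTy.pairs hA hB
  have e : _ = PreRel ℓ (tm α (sigma α A' B')) (unpair α A' B') (PairsRel ℓ α A B) :=
    PreRel.eq hP.good_closed (Der.tm hd) (fun t u h => Der.unpair hA.der hB.der h)
      (fun _ => Exp.unpair Exp.rfl) (fun _ => Exp.unpair Exp.rfl)
  rw [e, show PairsRel ℓ α A B = PairsRel ℓ α A' B' from hP.eq_closed]
  exact JTm.ty_sigma hA.symm.left hB'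

protected theorem JTm.univ_pi (hα : ((max 1 α : ℕ) : ℕ∞) < ℓ) (hA : JTm ℓ .nil A A' (tp α))
    (hB : JTm ℓ .nil B B' (Fam α A)) :
    Univ ℓ (max 1 α) (pi α A B) (pi α A' B') := by
  have hB' := hB.symm.left.conv (JTy.fam hA)
  have hd := Der.pi hα hA.der hB.der
  refine Univ.intro hd (JTm.ty_pi hα hA.left hB.left) ?_
  have hP := JTy.sections hA hB
  have e : _ = PreRel ℓ (tm (max 1 α) (pi α A' B')) (unabs α A' B') (SectionsRel ℓ α A B) :=
    PreRel.eq hP.good_closed (Der.tm hd) (fun t u h => Der.unabs hα hA.der hB.der h)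
      (fun _ => Exp.unabs Exp.rfl) (fun _ => Exp.unabs Exp.rfl)
  rw [e, show SectionsRel ℓ α A B = SectionsRel ℓ α A' B' from hP.eq_closed]
  exact JTm.ty_pi hα hA.symm.left hB'

/-- The two sides have different values, `sigma` at level `α` and at level `β`, so the relations
must be compared. This needs the two versions of `unpair` to be judgementally equal. -/
protected theorem JTm.univ_lift_sigma (hαβ : α ≤ β) (hβ : (β : ℕ∞) < ℓ) (hA : JTm ℓ .nil A A (tp α))
    (hB : JTm ℓ .nil B B (Fam α A)) :
    Univ ℓ β (Expr.lift α β (sigma α A B))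
      (sigma β (Expr.lift α β A) (Expr.liftFam α β A B)) := by
  have hd := Der.lift_sigma hαβ hβ hA.der hB.der
  have hA' := JTm.lift hαβ hβ hA
  have hB' := JTm.liftFam hαβ hβ hA hB
  refine Univ.intro hd ((JTm.ty_sigma hA hB).lift hαβ hβ) ?_
  have hP := JTy.pairs_lift hαβ hβ hA hB
  have hY := (Der.tm_lift hαβ hβ (Der.sigma hA.der hB.der)).ty_trans (Der.tm hd)
  have hD : ∀ t u, D ℓ t u (tm α (sigma α A B)) → D ℓ (unpair α A B t)
      (unpair β (Expr.lift α β A) (Expr.liftFam α β A B) u) (Pairs α A B) := by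
    intro t u h
    have h₁ := Der.unpair hA.der hB.der h
    -- Since pairing is the same at both levels, pairing `unpair α A B u` at level `β` gives back
    -- `u`. Applying `unpair` at level `β` then shows that the two unpairings of `u` agree.
    have h₂ := (Der.pair_lift hαβ hβ hA.der hB.der h₁.tm_right).tm_symm.tm_trans
      (Der.pair_unpair hA.der hB.der h.tm_right)
    have h₃ := (Der.unpair_pair hA'.der hB'.der (h₁.tm_right.tm_conv hP.der)).tm_symm.tm_trans
      (Der.unpair hA'.der hB'.der (h₂.tm_conv hY))
    exact h₁.tm_trans (h₃.tm_conv hP.der.ty_symm)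
  have e : PreRel ℓ (tm α (sigma α A B)) (unpair α A B) (PairsRel ℓ α A B) = _ :=
    PreRel.eq hP.good_closed hY hD (fun _ => Exp.unpair Exp.rfl) (fun _ => Exp.unpair Exp.rfl)
  rw [e, show PairsRel ℓ α A B =
    PairsRel ℓ β (Expr.lift α β A) (Expr.liftFam α β A B) from hP.eq_closed]
  exact JTm.ty_sigma hA' hB'

protected theorem JTm.univ_lift_pi (hα : 0 < α) (hαβ : α ≤ β) (hβ : (β : ℕ∞) < ℓ)
    (hA : JTm ℓ .nil A A (tp α)) (hB : JTm ℓ .nil B B (Fam α A)) :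
    Univ ℓ β (Expr.lift α β (pi α A B))
      (pi β (Expr.lift α β A) (Expr.liftFam α β A B)) := by
  have hd := Der.lift_pi hα hαβ hβ hA.der hB.der
  have hA' := JTm.lift hαβ hβ hA
  have hB' := JTm.liftFam hαβ hβ hA hB
  -- Positivity of `α` keeps the function type at level `α`. At level `0` it would jump to level
  -- `1`, and the left-hand side could not be formed.
  have eα : max 1 α = α := max_eq_right hα
  have eβ : max 1 β = β := max_eq_right (hα.trans_le hαβ)
  have lα : ((max 1 α : ℕ) : ℕ∞) < ℓ := by rw [eα]; exact hA.level
  have lβ : ((max 1 β : ℕ) : ℕ∞) < ℓ := by rw [eβ]; exact hβ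
  have h₀ := JTm.ty_pi lα hA hB
  have h₁ := JTm.ty_pi lβ hA' hB'
  rw [eα] at h₀
  rw [eβ] at h₁
  refine Univ.intro hd (h₀.lift hαβ hβ) ?_
  have hP := JTy.sections_lift hαβ hβ hA hB
  have hY := (Der.tm_lift hαβ hβ h₀.der).ty_trans (Der.tm hd)
  have hD : ∀ t u, D ℓ t u (tm α (pi α A B)) → D ℓ (unabs α A B t)
      (unabs β (Expr.lift α β A) (Expr.liftFam α β A B) u) (Sections α A B) := by
    intro t u h
    have h' : D ℓ t u (tm (max 1 α) (pi α A B)) := by rwa [eα]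
    have k₁ := Der.unabs lα hA.der hB.der h'
    have k₂ := (Der.abs_lift hα hαβ hβ hA.der hB.der k₁.tm_right).tm_symm.tm_trans
      (Der.abs_unabs lα hA.der hB.der h'.tm_right)
    rw [eα] at k₂
    have k₂' : D ℓ (abs β (Expr.lift α β A) (Expr.liftFam α β A B) (unabs α A B u)) u
        (tm (max 1 β) (pi β (Expr.lift α β A) (Expr.liftFam α β A B))) := by
      rw [eβ]; exact k₂.tm_conv hY
    have k₃ := (Der.unabs_abs lβ hA'.der hB'.der
      (k₁.tm_right.tm_conv hP.der)).tm_symm.tm_trans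
      (Der.unabs lβ hA'.der hB'.der k₂')
    exact k₁.tm_trans (k₃.tm_conv hP.der.ty_symm)
  have e : PreRel ℓ (tm α (pi α A B)) (unabs α A B) (SectionsRel ℓ α A B) = _ :=
    PreRel.eq hP.good_closed hY hD (fun _ => Exp.unabs Exp.rfl) (fun _ => Exp.unabs Exp.rfl)
  rw [e, show SectionsRel ℓ α A B =
    SectionsRel ℓ β (Expr.lift α β A) (Expr.liftFam α β A B) from hP.eq_closed]
  exact h₁

end

/-! ### Pair types, function types and universes in an arbitrary context -/

section
variable {ℓ : ℕ∞} {n : ℕ} {Γ : Ctx n} {α β : ℕ}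

theorem IsJudg.den_closed {X : Expr n} (h : IsJudg ℓ X) (σ : Fin n → Expr 0) :
    den ℓ X σ = den ℓ (X.subst σ) Expr.var := by
  rw [h.den_subst, subst_var_comp]

theorem JTm.exp₂ {t t' u u' A : Expr n} (h : JTm ℓ Γ t u A) (ht : Der ℓ (tmEq Γ t t' A))
    (hu : Der ℓ (tmEq Γ u u' A)) (et : ∀ σ : Fin n → Expr 0, Exp (t.subst σ) (t'.subst σ))
    (eu : ∀ σ : Fin n → Expr 0, Exp (u.subst σ) (u'.subst σ)) : JTm ℓ Γ t' u' A :=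
  ((JTm.of_exp h.left ht et).symm.trans h).trans (JTm.of_exp h.symm.left hu eu)

section
variable {A A' B B' : Expr n}

theorem Expr.pairs_subst {m : ℕ} (ρ : Fin n → Expr m) (A B : Expr n) :
    (Pairs α A B).subst ρ = Pairs α (A.subst ρ) (B.subst ρ) := by
  simp only [Pairs, Expr.fam, Expr.subst, Expr.wk_subst_upSub]; rfl

theorem Expr.sections_subst {m : ℕ} (ρ : Fin n → Expr m) (A B : Expr n) :
    (Sections α A B).subst ρ = Sections α (A.subst ρ) (B.subst ρ) := by
  simp only [Sections, Expr.fam, Expr.subst, Expr.wk_subst_upSub]; rfl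

theorem JTy.den_pairs {X : Expr n} (h : JTy ℓ Γ (Pairs α A B) X) (σ : Fin n → Expr 0) :
    den ℓ (Pairs α A B) σ = PairsRel ℓ α (A.subst σ) (B.subst σ) := by
  rw [h.judg_left.den_closed, Expr.pairs_subst]; rfl

theorem JTy.den_sections {X : Expr n} (h : JTy ℓ Γ (Sections α A B) X) (σ : Fin n → Expr 0) :
    den ℓ (Sections α A B) σ = SectionsRel ℓ α (A.subst σ) (B.subst σ) := by
  rw [h.judg_left.den_closed, Expr.sections_subst]; rfl

/-! #### Pairs -/

protected theorem JTm.sigma (hA : JTm ℓ Γ A A' (tp α)) (hB : JTm ℓ Γ B B' (Fam α A)) :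
    JTm ℓ Γ (sigma α A B) (sigma α A' B') (tp α) where
  ty := hA.ty
  der := Der.sigma hA.der hB.der
  rel hs := JTm.univ_sigma (hA.closed hs) (hB.closed hs)

theorem JTm.den_sigma (hA : JTm ℓ Γ A A (tp α)) (hB : JTm ℓ Γ B B (Fam α A))
    {σ τ : Fin n → Expr 0} (hs : SubRel ℓ Γ σ τ) :
    den ℓ (tm α (sigma α A B)) σ = PreRel ℓ (tm α (sigma α (A.subst σ) (B.subst σ)))
      (unpair α (A.subst σ) (B.subst σ)) (den ℓ (Pairs α A B) σ) := by
  rw [(JTy.pairs hA hB).den_pairs]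
  exact (JTm.ty_sigma (hA.closed (hs.left hA.ty.ctx)) (hB.closed (hs.left hA.ty.ctx))).El_eq

/-- Two terms of a dependent pair type are equal if their images under `unpair` are. -/
theorem JTm.sigma_ext {y y' : Expr n} (hA : JTm ℓ Γ A A (tp α)) (hB : JTm ℓ Γ B B (Fam α A))
    (hd : Der ℓ (tmEq Γ y y' (tm α (sigma α A B))))
    (h : JTm ℓ Γ (unpair α A B y) (unpair α A B y') (Pairs α A B)) :
    JTm ℓ Γ y y' (tm α (sigma α A B)) where
  ty := JTy.tm (JTm.sigma hA hB)
  der := hd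
  rel hs := by
    have hd' := Der.tm_subst Der.ctx_nil (hs.der hA.ty.ctx) hd
    rw [JTm.den_sigma hA hB hs]
    refine ⟨hd', (h.ty.good hs).exp (h.rel hs) (Exp.unpair Exp.rfl) ?_⟩
    have hs' := hs.left hA.ty.ctx
    rw [Expr.pairs_subst]
    exact (Der.unpair (hA.close hs') (hB.close hs')
      (hd'.tm_left.tm_trans hd'))

protected theorem JTm.unpair {y y' : Expr n} (hA : JTm ℓ Γ A A' (tp α))
    (hB : JTm ℓ Γ B B' (Fam α A)) (hy : JTm ℓ Γ y y' (tm α (sigma α A B))) :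
    JTm ℓ Γ (unpair α A B y) (unpair α A' B' y') (Pairs α A B) where
  ty := JTy.pairs hA.left hB.left
  der := Der.unpair hA.der hB.der hy.der
  rel hs := by
    have r := hy.rel hs
    rw [JTm.den_sigma hA.left hB.left hs] at r
    refine ((JTy.pairs hA.left hB.left).good hs).exp r.2 (Exp.unpair Exp.rfl) ?_
    exact Der.tm_subst Der.ctx_nil (hs.der hA.ty.ctx) (Der.unpair hA.der hB.der hy.der)


theorem JTm.right {t u T : Expr n} (h : JTm ℓ Γ t u T) : JTm ℓ Γ u u T := h.symm.left

protected theorem JTm.pair {x x' : Expr n} (hA : JTm ℓ Γ A A' (tp α))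
    (hB : JTm ℓ Γ B B' (Fam α A)) (hx : JTm ℓ Γ x x' (Pairs α A B)) :
    JTm ℓ Γ (pair α A B x) (pair α A' B' x') (tm α (sigma α A B)) := by
  have hd := Der.pair hA.der hB.der hx.der
  have h₁ := (Der.unpair_pair hA.left.der hB.left.der hx.left.der).tm_symm
  exact JTm.sigma_ext hA.left hB.left hd (hx.exp₂ h₁
    ((hx.der.tm_symm.tm_trans h₁).tm_trans (Der.unpair hA.left.der hB.left.der hd))
    (fun _ => Exp.unpair_pair) (fun _ => Exp.unpair_pair))

protected theorem JTm.unpair_pair {x : Expr n} (hA : JTm ℓ Γ A A (tp α))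
    (hB : JTm ℓ Γ B B (Fam α A)) (hx : JTm ℓ Γ x x (Pairs α A B)) :
    JTm ℓ Γ (Expr.unpair α A B (Expr.pair α A B x)) x (Pairs α A B) :=
  (hx.of_exp (Der.unpair_pair hA.der hB.der hx.der).tm_symm fun _ => Exp.unpair_pair).symm

protected theorem JTm.pair_unpair {y : Expr n} (hA : JTm ℓ Γ A A (tp α))
    (hB : JTm ℓ Γ B B (Fam α A)) (hy : JTm ℓ Γ y y (tm α (Expr.sigma α A B))) :
    JTm ℓ Γ (Expr.pair α A B (Expr.unpair α A B y)) y (tm α (Expr.sigma α A B)) :=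
  JTm.sigma_ext hA hB (Der.pair_unpair hA.der hB.der hy.der)
    (JTm.unpair_pair hA hB (JTm.unpair hA hB hy))

protected theorem JTm.lift_sigma (hαβ : α ≤ β) (hβ : (β : ℕ∞) < ℓ)
    (hA : JTm ℓ Γ A A (tp α)) (hB : JTm ℓ Γ B B (Fam α A)) :
    JTm ℓ Γ (Expr.lift α β (Expr.sigma α A B))
      (Expr.sigma β (Expr.lift α β A) (Expr.liftFam α β A B)) (tp β) := by
  refine JTm.of_diag (JTm.sigma (JTm.lift hαβ hβ hA) (JTm.liftFam hαβ hβ hA hB))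
    (Der.lift_sigma hαβ hβ hA.der hB.der) fun σ hs => ?_
  have := JTm.univ_lift_sigma hαβ hβ (hA.closed hs) (hB.closed hs)
  rw [← Expr.liftFam_subst] at this
  exact this

protected theorem JTm.pair_lift {x : Expr n} (hαβ : α ≤ β) (hβ : (β : ℕ∞) < ℓ)
    (hA : JTm ℓ Γ A A (tp α)) (hB : JTm ℓ Γ B B (Fam α A)) (hx : JTm ℓ Γ x x (Pairs α A B)) :
    JTm ℓ Γ (Expr.pair α A B x) (Expr.pair β (Expr.lift α β A) (Expr.liftFam α β A B) x)
      (tm α (Expr.sigma α A B)) := by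
  have hd := Der.pair_lift hαβ hβ hA.der hB.der hx.der
  have h₁ := (Der.unpair_pair hA.der hB.der hx.der).tm_symm
  exact JTm.sigma_ext hA hB hd (hx.exp₂ h₁ (h₁.tm_trans (Der.unpair hA.der hB.der hd))
    (fun _ => Exp.unpair_pair) (fun _ => Exp.unpair_pair))

/-! #### Functions -/

protected theorem JTm.pi (hα : ((max 1 α : ℕ) : ℕ∞) < ℓ) (hA : JTm ℓ Γ A A' (tp α))
    (hB : JTm ℓ Γ B B' (Fam α A)) : JTm ℓ Γ (pi α A B) (pi α A' B') (tp (max 1 α)) where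
  ty := JTy.tp hα hA.ty.ctx
  der := Der.pi hα hA.der hB.der
  rel hs := JTm.univ_pi hα (hA.closed hs) (hB.closed hs)

theorem JTm.den_pi (hα : ((max 1 α : ℕ) : ℕ∞) < ℓ) (hA : JTm ℓ Γ A A (tp α))
    (hB : JTm ℓ Γ B B (Fam α A)) {σ τ : Fin n → Expr 0} (hs : SubRel ℓ Γ σ τ) :
    den ℓ (tm (max 1 α) (Expr.pi α A B)) σ =
      PreRel ℓ (tm (max 1 α) (Expr.pi α (A.subst σ) (B.subst σ)))
      (unabs α (A.subst σ) (B.subst σ)) (den ℓ (Sections α A B) σ) := by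
  rw [(JTy.sections hA hB).den_sections]
  exact (JTm.ty_pi hα (hA.closed (hs.left hA.ty.ctx)) (hB.closed (hs.left hA.ty.ctx))).El_eq

/-- Two terms of a dependent function type are equal if their images under `unabs` are. -/
theorem JTm.pi_ext {g g' : Expr n} (hα : ((max 1 α : ℕ) : ℕ∞) < ℓ) (hA : JTm ℓ Γ A A (tp α))
    (hB : JTm ℓ Γ B B (Fam α A)) (hd : Der ℓ (tmEq Γ g g' (tm (max 1 α) (Expr.pi α A B))))
    (h : JTm ℓ Γ (unabs α A B g) (unabs α A B g') (Sections α A B)) :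
    JTm ℓ Γ g g' (tm (max 1 α) (Expr.pi α A B)) where
  ty := JTy.tm (JTm.pi hα hA hB)
  der := hd
  rel hs := by
    have hd' := Der.tm_subst Der.ctx_nil (hs.der hA.ty.ctx) hd
    rw [JTm.den_pi hα hA hB hs]
    refine ⟨hd', (h.ty.good hs).exp (h.rel hs) (Exp.unabs Exp.rfl) ?_⟩
    have hs' := hs.left hA.ty.ctx
    rw [Expr.sections_subst]
    exact Der.unabs hα (hA.close hs') (hB.close hs') hd'

protected theorem JTm.unabs {g g' : Expr n} (hα : ((max 1 α : ℕ) : ℕ∞) < ℓ)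
    (hA : JTm ℓ Γ A A' (tp α)) (hB : JTm ℓ Γ B B' (Fam α A))
    (hg : JTm ℓ Γ g g' (tm (max 1 α) (Expr.pi α A B))) :
    JTm ℓ Γ (unabs α A B g) (unabs α A' B' g') (Sections α A B) where
  ty := JTy.sections hA.left hB.left
  der := Der.unabs hα hA.der hB.der hg.der
  rel hs := by
    have r := hg.rel hs
    rw [JTm.den_pi hα hA.left hB.left hs] at r
    refine ((JTy.sections hA.left hB.left).good hs).exp r.2 (Exp.unabs Exp.rfl) ?_
    exact Der.tm_subst Der.ctx_nil (hs.der hA.ty.ctx) (Der.unabs hα hA.der hB.der hg.der)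

protected theorem JTm.abs {f f' : Expr n} (hα : ((max 1 α : ℕ) : ℕ∞) < ℓ)
    (hA : JTm ℓ Γ A A' (tp α)) (hB : JTm ℓ Γ B B' (Fam α A))
    (hf : JTm ℓ Γ f f' (Sections α A B)) :
    JTm ℓ Γ (abs α A B f) (abs α A' B' f') (tm (max 1 α) (Expr.pi α A B)) := by
  have hd := Der.abs hα hA.der hB.der hf.der
  have h₁ := (Der.unabs_abs hα hA.left.der hB.left.der hf.left.der).tm_symm
  exact JTm.pi_ext hα hA.left hB.left hd (hf.exp₂ h₁
    ((hf.der.tm_symm.tm_trans h₁).tm_trans (Der.unabs hα hA.left.der hB.left.der hd))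
    (fun _ => Exp.unabs_abs) (fun _ => Exp.unabs_abs))

protected theorem JTm.unabs_abs {f : Expr n} (hα : ((max 1 α : ℕ) : ℕ∞) < ℓ)
    (hA : JTm ℓ Γ A A (tp α)) (hB : JTm ℓ Γ B B (Fam α A))
    (hf : JTm ℓ Γ f f (Sections α A B)) :
    JTm ℓ Γ (Expr.unabs α A B (Expr.abs α A B f)) f (Sections α A B) :=
  (hf.of_exp (Der.unabs_abs hα hA.der hB.der hf.der).tm_symm fun _ => Exp.unabs_abs).symm

protected theorem JTm.abs_unabs {g : Expr n} (hα : ((max 1 α : ℕ) : ℕ∞) < ℓ)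
    (hA : JTm ℓ Γ A A (tp α)) (hB : JTm ℓ Γ B B (Fam α A))
    (hg : JTm ℓ Γ g g (tm (max 1 α) (Expr.pi α A B))) :
    JTm ℓ Γ (Expr.abs α A B (Expr.unabs α A B g)) g (tm (max 1 α) (Expr.pi α A B)) :=
  JTm.pi_ext hα hA hB (Der.abs_unabs hα hA.der hB.der hg.der)
    (JTm.unabs_abs hα hA hB (JTm.unabs hα hA hB hg))

theorem level_max (hα : 0 < α) (hℓ : (α : ℕ∞) < ℓ) : ((max 1 α : ℕ) : ℕ∞) < ℓ := by
  rwa [max_eq_right (show 1 ≤ α from hα)]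

protected theorem JTm.lift_pi (hα : 0 < α) (hαβ : α ≤ β) (hβ : (β : ℕ∞) < ℓ)
    (hA : JTm ℓ Γ A A (tp α)) (hB : JTm ℓ Γ B B (Fam α A)) :
    JTm ℓ Γ (Expr.lift α β (Expr.pi α A B))
      (Expr.pi β (Expr.lift α β A) (Expr.liftFam α β A B)) (tp β) := by
  have h := JTm.pi (level_max (hα.trans_le hαβ) hβ) (JTm.lift hαβ hβ hA)
    (JTm.liftFam hαβ hβ hA hB)
  rw [max_eq_right (show 1 ≤ β from hα.trans_le hαβ)] at h
  refine JTm.of_diag h (Der.lift_pi hα hαβ hβ hA.der hB.der) fun σ hs => ?_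
  have := JTm.univ_lift_pi hα hαβ hβ (hA.closed hs) (hB.closed hs)
  rw [← Expr.liftFam_subst] at this
  exact this

protected theorem JTm.abs_lift {f : Expr n} (hα : 0 < α) (hαβ : α ≤ β) (hβ : (β : ℕ∞) < ℓ)
    (hA : JTm ℓ Γ A A (tp α)) (hB : JTm ℓ Γ B B (Fam α A))
    (hf : JTm ℓ Γ f f (Sections α A B)) :
    JTm ℓ Γ (Expr.abs α A B f) (Expr.abs β (Expr.lift α β A) (Expr.liftFam α β A B) f)
      (tm (max 1 α) (Expr.pi α A B)) := by
  have lα := level_max hα hA.level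
  have hd := Der.abs_lift hα hαβ hβ hA.der hB.der hf.der
  have h₁ := (Der.unabs_abs lα hA.der hB.der hf.der).tm_symm
  exact JTm.pi_ext lα hA hB hd (hf.exp₂ h₁ (h₁.tm_trans (Der.unabs lα hA.der hB.der hd))
    (fun _ => Exp.unabs_abs) (fun _ => Exp.unabs_abs))

end

/-! ### Universes -/

protected theorem JTm.univ_type (hα : ((α + 1 : ℕ) : ℕ∞) < ℓ) (hc : JCtx ℓ Γ) :
    JTm ℓ Γ (univ α) (univ α) (tp (α + 1)) where
  ty := JTy.tp hα hc
  der := Der.univ hα hc.der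
  rel _ := Univ.intro (Der.univ hα Der.ctx_nil) (.univ hα) (.univ hα)

protected theorem JTy.tm_univ (hα : ((α + 1 : ℕ) : ℕ∞) < ℓ) (hc : JCtx ℓ Γ) :
    JTy ℓ Γ (tm (α + 1) (univ α)) (tp α) where
  ctx := hc
  der := Der.tm_univ hα hc.der
  judg_left := trivial
  judg_right := (Nat.cast_lt.2 α.lt_succ_self).trans hα
  eq _ := El_univ hα
  good _ := (JTy.tm (JTm.univ_type hα JCtx.nil)).good_closed

end

/-! ### Identity types -/

section
variable {ℓ : ℕ∞} {α β γ γ' : ℕ}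

theorem IsRefl.congr {A A' a a' b b' p : Expr 0}
    (hT : DTy ℓ (tm γ (.eq γ A a b)) (tm γ' (.eq γ' A' a' b')))
    (hr : D ℓ (refl γ A a) (refl γ' A' a') (tm γ (.eq γ A a b))) (h : IsRefl ℓ γ A a b p) :
    IsRefl ℓ γ' A' a' b' p :=
  ⟨h.1, (h.2.tm_trans hr).tm_conv hT⟩

/-- The two reflexivity terms have to agree only if `a` and `b` are related; otherwise both
relations are empty. The levels may differ, as the rule for lifts requires. -/
theorem EqR.eq {A A' a a' b b' : Expr 0} {RA RA' : Rel} (hR : RA a b ↔ RA' a' b')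
    (hT : DTy ℓ (tm γ (.eq γ A a b)) (tm γ' (.eq γ' A' a' b')))
    (hr : RA a b → D ℓ (refl γ A a) (refl γ' A' a') (tm γ (.eq γ A a b))) :
    EqR ℓ γ A a b RA = EqR ℓ γ' A' a' b' RA' := by
  funext p q
  refine propext ⟨fun h => ?_, fun h => ?_⟩
  · exact ⟨hR.1 h.1, h.2.1.congr hT (hr h.1), h.2.2.congr hT (hr h.1)⟩
  · have hr' := (hr (hR.2 h.1)).tm_symm.tm_conv hT
    exact ⟨hR.2 h.1, h.2.1.congr hT.ty_symm hr', h.2.2.congr hT.ty_symm hr'⟩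

theorem DTy.tm_eq {A a b : Expr 0} (hA : D ℓ A A (tp γ)) (h : D ℓ a b (tm γ A)) :
    DTy ℓ (tm γ (.eq γ A a a)) (tm γ (.eq γ A a b)) :=
  Der.tm (Der.eq hA h.tm_left h)

theorem JTm.ty_eq {A a b : Expr 0} (hA : JTm ℓ .nil A A (tp α)) (ha : JTm ℓ .nil a a (tm α A))
    (hb : JTm ℓ .nil b b (tm α A)) : Ty ℓ α (eq α A a b) (EqR ℓ α A a b (El ℓ α A)) :=
  .eq hA.der ha.der hb.der hA.univ_closed.ty

theorem JTm.univ_eq {A A' a a' b b' : Expr 0} (hA : JTm ℓ .nil A A' (tp α))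
    (ha : JTm ℓ .nil a a' (tm α A)) (hb : JTm ℓ .nil b b' (tm α A)) :
    Univ ℓ α (eq α A a b) (eq α A' a' b') := by
  have hd := Der.eq hA.der ha.der hb.der
  have g := hA.univ_closed.good
  have ra := ha.el_closed
  have rb := hb.el_closed
  refine Univ.intro hd (JTm.ty_eq hA.left ha.left hb.left) ?_
  have e : EqR ℓ α A a b (El ℓ α A) = EqR ℓ α A' a' b' (El ℓ α A') := by
    refine EqR.eq ?_ (Der.tm hd) fun r => ?_
    · rw [← hA.univ_closed.El_eq]
      exact ⟨fun r => g.trans (g.symm ra) (g.trans r rb),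
        fun r => g.trans ra (g.trans r (g.symm rb))⟩
    · exact (Der.refl hA.der ha.der).tm_conv (DTy.tm_eq hA.left.der (g.der r))
  rw [e]
  exact JTm.ty_eq hA.right (ha.right.conv (JTy.tm hA)) (hb.right.conv (JTy.tm hA))

theorem JTm.univ_lift_eq {A a b : Expr 0} (hαβ : α ≤ β) (hβ : (β : ℕ∞) < ℓ)
    (hA : JTm ℓ .nil A A (tp α)) (ha : JTm ℓ .nil a a (tm α A)) (hb : JTm ℓ .nil b b (tm α A)) :
    Univ ℓ β (Expr.lift α β (eq α A a b)) (eq β (Expr.lift α β A) a b) := by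
  have hd := Der.lift_eq hαβ hβ hA.der ha.der hb.der
  have h₀ := JTm.ty_eq hA ha hb
  have g := hA.univ_closed.good
  refine Univ.intro hd (h₀.lift hαβ hβ) ?_
  have hT := (Der.tm_lift hαβ hβ h₀.der).ty_trans (Der.tm hd)
  have e : EqR ℓ α A a b (El ℓ α A) =
      EqR ℓ β (Expr.lift α β A) a b (El ℓ β (Expr.lift α β A)) := by
    refine EqR.eq ?_ hT fun r => ?_
    · rw [hA.univ_closed.El_lift hαβ hβ]
    -- Reflexivity being the same term at both levels is what makes the two notions of canonical
    -- proof coincide.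
    · exact (Der.refl_lift hαβ hβ hA.der ha.der).tm_conv (DTy.tm_eq hA.left.der (g.der r))
  rw [e]
  have hL := JTy.tm_lift hαβ hβ hA
  exact JTm.ty_eq (JTm.lift hαβ hβ hA) (ha.conv hL) (hb.conv hL)

end

/-! ### Identity types in an arbitrary context -/

section
variable {ℓ : ℕ∞} {n : ℕ} {Γ : Ctx n} {α β : ℕ} {A A' a a' b b' : Expr n}

protected theorem JTm.eq (hA : JTm ℓ Γ A A' (tp α)) (ha : JTm ℓ Γ a a' (tm α A))
    (hb : JTm ℓ Γ b b' (tm α A)) : JTm ℓ Γ (eq α A a b) (eq α A' a' b') (tp α) where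
  ty := hA.ty
  der := Der.eq hA.der ha.der hb.der
  rel hs := JTm.univ_eq (hA.closed hs) (ha.closed hs) (hb.closed hs)

theorem JTm.den_eq (hA : JTm ℓ Γ A A (tp α)) (ha : JTm ℓ Γ a a (tm α A))
    (hb : JTm ℓ Γ b b (tm α A)) {σ τ : Fin n → Expr 0} (hs : SubRel ℓ Γ σ τ) :
    den ℓ (tm α (Expr.eq α A a b)) σ =
      EqR ℓ α (A.subst σ) (a.subst σ) (b.subst σ) (El ℓ α (A.subst σ)) := by
  have hs' := hs.left hA.ty.ctx
  exact (JTm.ty_eq (hA.closed hs') (ha.closed hs') (hb.closed hs')).El_eq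

/-- The annotations in the value of a canonical proof are unconstrained, so any derivable equality
between reflexivity terms is valid. Congruence and the comparison of levels are both instances. -/
theorem JTm.of_refl {C c : Expr n} (hA : JTm ℓ Γ A A (tp α)) (ha : JTm ℓ Γ a a (tm α A))
    (hd : Der ℓ (tmEq Γ (refl α A a) (refl β C c) (tm α (Expr.eq α A a a)))) :
    JTm ℓ Γ (refl α A a) (refl β C c) (tm α (Expr.eq α A a a)) where
  ty := JTy.tm (JTm.eq hA ha ha)
  der := hd
  rel hs := by
    rw [JTm.den_eq hA ha ha hs]
    have hs' := hs.left hA.ty.ctx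
    have hd' := Der.tm_subst Der.ctx_nil (hs.der hA.ty.ctx) hd
    exact ⟨ha.rel hs', ⟨⟨_, _, _, .val .refl⟩, hd'.tm_left⟩, ⟨_, _, _, .val .refl⟩, hd'.tm_symm⟩

protected theorem JTm.refl (hA : JTm ℓ Γ A A' (tp α)) (ha : JTm ℓ Γ a a' (tm α A)) :
    JTm ℓ Γ (refl α A a) (refl α A' a') (tm α (Expr.eq α A a a)) :=
  JTm.of_refl hA.left ha.left (Der.refl hA.der ha.der)

protected theorem JTm.refl_lift (hαβ : α ≤ β) (hβ : (β : ℕ∞) < ℓ) (hA : JTm ℓ Γ A A (tp α))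
    (ha : JTm ℓ Γ a a (tm α A)) :
    JTm ℓ Γ (Expr.refl α A a) (Expr.refl β (Expr.lift α β A) a) (tm α (Expr.eq α A a a)) :=
  JTm.of_refl hA ha (Der.refl_lift hαβ hβ hA.der ha.der)

protected theorem JTm.lift_eq (hαβ : α ≤ β) (hβ : (β : ℕ∞) < ℓ) (hA : JTm ℓ Γ A A (tp α))
    (ha : JTm ℓ Γ a a (tm α A)) (hb : JTm ℓ Γ b b (tm α A)) :
    JTm ℓ Γ (Expr.lift α β (Expr.eq α A a b)) (Expr.eq β (Expr.lift α β A) a b) (tp β) := by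
  have hL := JTy.tm_lift hαβ hβ hA
  exact JTm.of_diag (JTm.eq (JTm.lift hαβ hβ hA) (ha.conv hL) (hb.conv hL))
    (Der.lift_eq hαβ hβ hA.der ha.der hb.der) fun σ hs =>
      JTm.univ_lift_eq hαβ hβ (hA.closed hs) (ha.closed hs) (hb.closed hs)

theorem JTy.eqFamAt (hA : JTm ℓ Γ A A' (tp α)) (ha : JTm ℓ Γ a a' (tm α A)) :
    JTy ℓ (Γ.snoc (tm α A)) (EqFamAt α A a) (EqFamAt α A' a') := by
  have hT := (JTy.tm hA).left
  exact JTy.fam (JTm.eq (hA.wk hT) (ha.wk hT) (JTm.var (JCtx.snoc hT) 0))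

theorem Expr.eqFamAt_inst : (EqFamAt α A a).inst b = Fam α (Expr.eq α A a b) := by
  simp only [EqFamAt, Fam, Expr.inst_eq, Expr.subst, Expr.wk_subst_cons, Expr.subst_id, cons_zero]

theorem Expr.eqFam_subst {m : ℕ} (ρ : Fin n → Expr m) (P p : Expr n) :
    (eqFam α A a P b p).subst ρ =
      eqFam α (A.subst ρ) (a.subst ρ) (P.subst ρ) (b.subst ρ) (p.subst ρ) := by
  simp only [eqFam, EqFamAt, Expr.subst, Expr.wk_subst_upSub]
  rfl

theorem Expr.EqFam_subst {m : ℕ} (ρ : Fin n → Expr m) :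
    (EqFam α A a).subst ρ = EqFam α (A.subst ρ) (a.subst ρ) := by
  simp only [EqFam, EqFamAt, Expr.subst, Expr.wk_subst_upSub]
  rfl

theorem JTm.eqFam {P P' p p' : Expr n} (hA : JTm ℓ Γ A A' (tp α)) (ha : JTm ℓ Γ a a' (tm α A))
    (hP : JTm ℓ Γ P P' (EqFam α A a)) (hb : JTm ℓ Γ b b' (tm α A))
    (hp : JTm ℓ Γ p p' (tm α (Expr.eq α A a b))) :
    JTm ℓ Γ (eqFam α A a P b p) (eqFam α A' a' P' b' p') (tp α) := by
  have h₁ := JTm.lfApp (JTy.tm hA) (JTy.eqFamAt hA ha) hP hb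
  rw [Expr.eqFamAt_inst] at h₁
  have hE := JTy.tm (JTm.eq hA ha hb)
  exact JTm.lfApp hE (JTy.tp hA.level (JCtx.snoc hE.left)) h₁ hp

end

/-- A computable proof `p` shows that its endpoints are related and that it is equal to reflexivity.
Hence the motive has the same relation at `(a, refl)` and at `(b, p)`, and both eliminators evaluate
like `s` and `s'`. -/
theorem JTm.el_eqind {ℓ : ℕ∞} {α : ℕ} {A A' a a' P P' b b' p p' s s' : Expr 0}
    (hA : JTm ℓ .nil A A' (tp α)) (ha : JTm ℓ .nil a a' (tm α A))
    (hP : JTm ℓ .nil P P' (EqFam α A a)) (hb : JTm ℓ .nil b b' (tm α A))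
    (hp : JTm ℓ .nil p p' (tm α (Expr.eq α A a b)))
    (hs : JTm ℓ .nil s s' (tm α (Expr.eqFam α A a P a (.refl α A a)))) :
    El ℓ α (Expr.eqFam α A a P b p) (eqind α A a P b p s) (eqind α A' a' P' b' p' s') := by
  have rp := hp.el_closed
  rw [(JTm.ty_eq hA.left ha.left hb.left).El_eq] at rp
  obtain ⟨rab, ⟨⟨_, _, _, ep⟩, dp⟩, ⟨_, _, _, ep'⟩, _⟩ := rp
  have hab : JTm ℓ .nil a b (tm α A) := JTm.of_el hA rab
  have dT := DTy.tm_eq hA.left.der hab.der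
  -- Contraction of `p` onto reflexivity; with `hab` it identifies the two instances of the motive.
  have hr : JTm ℓ .nil (Expr.refl α A a) p (tm α (Expr.eq α A a a)) := by
    refine JTm.of_el (JTm.eq hA.left ha.left ha.left) ?_
    rw [(JTm.ty_eq hA.left ha.left ha.left).El_eq]
    exact ⟨ha.left.el_closed, ⟨⟨_, _, _, .val .refl⟩, Der.refl hA.left.der ha.left.der⟩,
      ⟨_, _, _, ep⟩, dp.tm_conv dT.ty_symm⟩
  have u := (JTm.eqFam hA.left ha.left hP.left hab hr).univ_closed
  have g := (JTm.eqFam hA.left ha.left hP.left hb.left hp.left).univ_closed.good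
  have rs := hs.el_closed
  rw [u.El_eq] at rs
  refine g.exp₂ rs (fun _ h => .eqind ep h) (fun _ h => .eqind ep' h) ?_
    (Der.eqind hA.der ha.der hP.der hb.der hp.der hs.der)
  -- The computation rule gives `s` as the eliminator at reflexivity, and congruence along `hab` and
  -- `hr` moves it to `(b, p)`.
  refine Der.tm_conv ?_ (Der.tm u.der)
  exact (Der.eqind_refl hA.left.der ha.left.der hP.left.der hs.left.der).tm_trans
    (Der.eqind hA.left.der ha.left.der hP.left.der hab.der hr.der hs.left.der)

section
variable {ℓ : ℕ∞} {n : ℕ} {Γ : Ctx n}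

protected theorem JTm.eqind {α : ℕ} {A A' a a' P P' b b' p p' s s' : Expr n}
    (hA : JTm ℓ Γ A A' (tp α)) (ha : JTm ℓ Γ a a' (tm α A))
    (hP : JTm ℓ Γ P P' (EqFam α A a)) (hb : JTm ℓ Γ b b' (tm α A))
    (hp : JTm ℓ Γ p p' (tm α (Expr.eq α A a b)))
    (hs : JTm ℓ Γ s s' (tm α (Expr.eqFam α A a P a (Expr.refl α A a)))) :
    JTm ℓ Γ (eqind α A a P b p s) (eqind α A' a' P' b' p' s') (tm α (Expr.eqFam α A a P b p)) where
  ty := JTy.tm (JTm.eqFam hA.left ha.left hP.left hb.left hp.left)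
  der := Der.eqind hA.der ha.der hP.der hb.der hp.der hs.der
  rel hσ := by
    have kP := hP.closed hσ
    rw [Expr.EqFam_subst] at kP
    have ks := hs.closed hσ
    simp only [Expr.subst, Expr.eqFam_subst] at ks
    have := JTm.el_eqind (hA.closed hσ) (ha.closed hσ) kP (hb.closed hσ) (hp.closed hσ) ks
    rw [← Expr.eqFam_subst] at this
    exact this

protected theorem JTm.eqind_refl {α : ℕ} {A a P s : Expr n}
    (hA : JTm ℓ Γ A A (tp α)) (ha : JTm ℓ Γ a a (tm α A)) (hP : JTm ℓ Γ P P (EqFam α A a))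
    (hs : JTm ℓ Γ s s (tm α (Expr.eqFam α A a P a (Expr.refl α A a)))) :
    JTm ℓ Γ s (Expr.eqind α A a P a (Expr.refl α A a) s)
      (tm α (Expr.eqFam α A a P a (Expr.refl α A a))) :=
  hs.of_exp (Der.eqind_refl hA.der ha.der hP.der hs.der) fun _ _ h => .eqind (.val .refl) h

/-! ### The empty type and the unit type -/

protected theorem JTm.empty (h0 : 0 < ℓ) (hc : JCtx ℓ Γ) : JTm ℓ Γ empty empty (tp 0) where
  ty := JTy.tp (by exact_mod_cast h0) hc
  der := Der.empty h0 hc.der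
  rel _ := Univ.intro (Der.empty h0 Der.ctx_nil) (.empty h0) (.empty h0)

protected theorem JTm.unit (h0 : 0 < ℓ) (hc : JCtx ℓ Γ) : JTm ℓ Γ unit unit (tp 0) where
  ty := JTy.tp (by exact_mod_cast h0) hc
  der := Der.unit h0 hc.der
  rel _ := Univ.intro (Der.unit h0 Der.ctx_nil) (.unit h0) (.unit h0)

protected theorem JTm.nat (h0 : 0 < ℓ) (hc : JCtx ℓ Γ) : JTm ℓ Γ nat nat (tp 0) where
  ty := JTy.tp (by exact_mod_cast h0) hc
  der := Der.nat h0 hc.der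
  rel _ := Univ.intro (Der.nat h0 Der.ctx_nil) (.nat h0) (.nat h0)

/-- Recovers the side condition on levels, which the elimination rules do not state, from the
well-formedness of `tp 0` inside the judgement of `B`. -/
theorem JTm.pos_of_fam {A B B' : Expr n} (hB : JTm ℓ Γ B B' (Fam 0 A)) : 0 < ℓ := by
  have : ((0 : ℕ) : ℕ∞) < ℓ := hB.ty.judg_left.2
  exact_mod_cast this

protected theorem JTm.exfalso {B B' x x' : Expr n} (hB : JTm ℓ Γ B B' (Fam 0 Expr.empty))
    (hx : JTm ℓ Γ x x' (tm 0 Expr.empty)) :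
    JTm ℓ Γ (exfalso B x) (exfalso B' x') (tm 0 (Expr.fam 0 Expr.empty B x)) where
  ty := JTy.tm (JTm.fam (JTm.empty hB.pos_of_fam hB.ty.ctx) hB.left hx.left)
  der := Der.exfalso hB.der hx.der
  rel {σ τ} hs := by
    have h : El ℓ 0 Expr.empty (x.subst σ) (x'.subst τ) := hx.rel hs
    rw [El_empty hB.pos_of_fam] at h
    exact h.elim

protected theorem JTm.star (h0 : 0 < ℓ) (hc : JCtx ℓ Γ) : JTm ℓ Γ star star (tm 0 unit) where
  ty := JTy.tm (JTm.unit h0 hc)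
  der := Der.star h0 hc.der
  rel _ := by
    have h : El ℓ 0 Expr.unit Expr.star Expr.star := by
      rw [El_unit h0]
      have hd := Der.star h0 Der.ctx_nil
      exact ⟨⟨.val .star, hd⟩, .val .star, hd⟩
    exact h

theorem JTm.el_unitind {B B' b b' x x' : Expr 0} (hB : JTm ℓ .nil B B' (Fam 0 Expr.unit))
    (hb : JTm ℓ .nil b b' (tm 0 (Expr.fam 0 Expr.unit B Expr.star)))
    (hx : JTm ℓ .nil x x' (tm 0 Expr.unit)) :
    El ℓ 0 (Expr.fam 0 Expr.unit B x) (unitind B b x) (unitind B' b' x') := by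
  have h0 := hB.pos_of_fam
  have hU : JTm ℓ .nil Expr.unit Expr.unit (tp 0) := JTm.unit h0 JCtx.nil
  have rx := hx.el_closed
  rw [El_unit h0] at rx
  have ds := Der.star h0 Der.ctx_nil
  have hxs : JTm ℓ .nil x Expr.star (tm 0 Expr.unit) := by
    refine JTm.of_el hU ?_
    rw [El_unit h0]
    exact ⟨rx.1, .val .star, ds⟩
  have u := (JTm.fam hU hB.left hxs).univ_closed
  have r := hb.el_closed
  rw [← u.El_eq] at r
  refine u.good.exp₂ r (fun _ h => .unitind rx.1.1 h) (fun _ h => .unitind rx.2.1 h) ?_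
    (Der.unitind hB.der hb.der hx.der)
  refine Der.tm_conv ?_ (Der.tm u.der).ty_symm
  exact (Der.unitind_star hB.left.der hb.left.der).tm_symm.tm_trans
    (Der.unitind hB.left.der hb.left.der hxs.symm.der)

protected theorem JTm.unitind {B B' b b' x x' : Expr n} (hB : JTm ℓ Γ B B' (Fam 0 Expr.unit))
    (hb : JTm ℓ Γ b b' (tm 0 (Expr.fam 0 Expr.unit B Expr.star)))
    (hx : JTm ℓ Γ x x' (tm 0 Expr.unit)) :
    JTm ℓ Γ (unitind B b x) (unitind B' b' x') (tm 0 (Expr.fam 0 Expr.unit B x)) where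
  ty := JTy.tm (JTm.fam (JTm.unit hB.pos_of_fam hB.ty.ctx) hB.left hx.left)
  der := Der.unitind hB.der hb.der hx.der
  rel hs := JTm.el_unitind (hB.closed hs) (hb.closed hs) (hx.closed hs)

protected theorem JTm.unitind_star {B b : Expr n} (hB : JTm ℓ Γ B B (Fam 0 Expr.unit))
    (hb : JTm ℓ Γ b b (tm 0 (Expr.fam 0 Expr.unit B Expr.star))) :
    JTm ℓ Γ (Expr.unitind B b Expr.star) b (tm 0 (Expr.fam 0 Expr.unit B Expr.star)) :=
  (hb.of_exp (Der.unitind_star hB.der hb.der).tm_symm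
    fun _ _ h => .unitind (.val .star) h).symm

/-! ### Natural numbers -/

protected theorem JTm.zero (h0 : 0 < ℓ) (hc : JCtx ℓ Γ) : JTm ℓ Γ zero zero (tm 0 nat) where
  ty := JTy.tm (JTm.nat h0 hc)
  der := Der.zero h0 hc.der
  rel _ := by
    have h : El ℓ 0 Expr.nat Expr.zero Expr.zero := by
      rw [El_nat h0]
      have hd := Der.zero h0 Der.ctx_nil
      exact .zero (.val .zero) (.val .zero) hd hd
    exact h

protected theorem JTm.suc {x x' : Expr n} (hx : JTm ℓ Γ x x' (tm 0 nat)) :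
    JTm ℓ Γ (suc x) (suc x') (tm 0 nat) where
  ty := hx.ty
  der := Der.suc hx.der
  rel {σ τ} hs := by
    have hd := Der.suc (hx.close hs)
    have r : El ℓ 0 Expr.nat (x.subst σ) (x'.subst τ) := hx.rel hs
    have h0 : 0 < ℓ := by
      obtain ⟨_, hR, _⟩ := r
      exact_mod_cast hR.level_lt
    have h : El ℓ 0 Expr.nat (Expr.suc (x.subst σ)) (Expr.suc (x'.subst τ)) := by
      rw [El_nat h0] at r ⊢
      exact .suc (.val .suc) (.val .suc) hd.tm_left hd.tm_right r
    exact h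

theorem JTy.stepAt {B B' : Expr n} (hB : JTm ℓ Γ B B' (Fam 0 Expr.nat)) :
    JTy ℓ (Γ.snoc (tm 0 Expr.nat)) (StepAt B) (StepAt B') := by
  have h0 := hB.pos_of_fam
  have hN := JTy.tm (JTm.nat h0 hB.ty.ctx)
  have hc := JCtx.snoc hN
  have hF := JTm.fam (JTm.nat h0 hc) (hB.wk hN) (JTm.var hc 0)
  have hc' := JCtx.snoc (JTy.tm hF).left
  exact JTy.lfPi (JTy.tm hF) (JTy.tm (JTm.fam (JTm.nat h0 hc')
    ((hB.wk hN).wk (JTy.tm hF).left) (JTm.suc (JTm.var hc' 1))))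

theorem Expr.stepAt_inst (B x : Expr n) : (StepAt B).inst x =
    lfPi (tm 0 (Expr.fam 0 Expr.nat B x)) (tm 0 (Expr.fam 0 Expr.nat B.wk (Expr.suc x.wk))) := by
  simp only [StepAt, Expr.fam, Expr.inst_eq, Expr.subst, Expr.wk_subst_cons, Expr.subst_id,
    cons_zero, Expr.wk_subst_upSub]
  rfl

theorem Expr.step_type_inst (B x y : Expr n) :
    (tm 0 (Expr.fam 0 Expr.nat B.wk (Expr.suc x.wk))).inst y =
      tm 0 (Expr.fam 0 Expr.nat B (Expr.suc x)) := by
  simp only [Expr.fam, Expr.inst_eq, Expr.subst, Expr.wk_subst_cons, Expr.subst_id]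

theorem Expr.Step_subst {m : ℕ} (ρ : Fin n → Expr m) (B : Expr n) :
    (Step B).subst ρ = Step (B.subst ρ) := by
  simp only [Step, StepAt, Expr.fam, Expr.subst, Expr.wk_subst_upSub]
  rfl

theorem JTm.step {B B' bs bs' x x' y y' : Expr n} (hB : JTm ℓ Γ B B' (Fam 0 Expr.nat))
    (hbs : JTm ℓ Γ bs bs' (Step B)) (hx : JTm ℓ Γ x x' (tm 0 Expr.nat))
    (hy : JTm ℓ Γ y y' (tm 0 (Expr.fam 0 Expr.nat B x))) :
    JTm ℓ Γ (step B bs x y) (step B' bs' x' y')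
      (tm 0 (Expr.fam 0 Expr.nat B (Expr.suc x))) := by
  have h0 := hB.pos_of_fam
  have hN := JTm.nat h0 hB.ty.ctx
  have h₁ := JTm.lfApp (JTy.tm hN) (JTy.stepAt hB) hbs hx
  rw [Expr.stepAt_inst] at h₁
  have hF := JTy.tm (JTm.fam hN hB hx)
  have hc := JCtx.snoc hF.left
  have h₂ := JTm.lfApp hF (JTy.tm (JTm.fam (JTm.nat h0 hc) (hB.wk hF.left)
    (JTm.suc (hx.wk hF.left)))) h₁ hy
  rwa [Expr.step_type_inst] at h₂

/-- Induction on `NatR`: related numbers evaluate to the same constructor, so the two eliminators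
unfold in step. A number is validly equal to its canonical form, so the motive has the same relation
at both. -/
theorem JTm.el_ind {B B' bz bz' bs bs' x x' : Expr 0} (hB : JTm ℓ .nil B B' (Fam 0 Expr.nat))
    (hz : JTm ℓ .nil bz bz' (tm 0 (Expr.fam 0 Expr.nat B Expr.zero)))
    (hbs : JTm ℓ .nil bs bs' (Step B)) (hx : NatR ℓ x x') :
    El ℓ 0 (Expr.fam 0 Expr.nat B x) (ind B bz bs x) (ind B' bz' bs' x') := by
  have h0 := hB.pos_of_fam
  have hN : JTm ℓ .nil Expr.nat Expr.nat (tp 0) := JTm.nat h0 JCtx.nil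
  have of_nat : ∀ {x x' : Expr 0}, NatR ℓ x x' → JTm ℓ .nil x x' (tm 0 Expr.nat) := by
    intro x x' h
    refine JTm.of_el hN ?_
    rwa [El_nat h0]
  induction hx with
  | @zero x x' h₁ h₂ h₃ h₄ =>
    have dz := Der.zero h0 Der.ctx_nil
    have kx : JTm ℓ .nil x Expr.zero (tm 0 Expr.nat) := of_nat (.zero h₁ (.val .zero) h₃ dz)
    have u := (JTm.fam hN hB.left kx).univ_closed
    have r := hz.el_closed
    rw [← u.El_eq] at r
    refine u.good.exp₂ r (fun _ h => .ind_zero h₁ h) (fun _ h => .ind_zero h₂ h) ?_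
      (Der.ind hB.der hz.der hbs.der (h₃.tm_trans h₄.tm_symm))
    refine Der.tm_conv ?_ (Der.tm u.der).ty_symm
    exact (Der.ind_zero hB.left.der hz.left.der hbs.left.der).tm_symm.tm_trans
      (Der.ind hB.left.der hz.left.der hbs.left.der h₃.tm_symm)
  | @suc t t' x x' h₁ h₂ h₃ h₄ h ih =>
    have kx := of_nat h
    have ds := Der.suc kx.der
    have kt : JTm ℓ .nil t (Expr.suc x) (tm 0 Expr.nat) :=
      of_nat (.suc h₁ (.val .suc) h₃ ds.tm_left (good_NatR.left h))
    have u := (JTm.fam hN hB.left kt).univ_closed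
    -- The induction hypothesis makes the recursive calls a valid argument for the step function.
    have ky := JTm.of_el (JTm.fam hN hB.left kx.left) ih
    have r := (JTm.step hB hbs kx ky).el_closed
    rw [← u.El_eq] at r
    refine u.good.exp₂ r (fun _ h => .ind_suc h₁ h) (fun _ h => .ind_suc h₂ h) ?_
      (Der.ind hB.der hz.der hbs.der ((h₃.tm_trans ds).tm_trans h₄.tm_symm))
    refine Der.tm_conv ?_ (Der.tm u.der).ty_symm
    exact (Der.ind_suc hB.left.der hz.left.der hbs.left.der kx.left.der).tm_symm.tm_trans
      (Der.ind hB.left.der hz.left.der hbs.left.der h₃.tm_symm)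

section
variable {B B' bz bz' bs bs' x x' : Expr n}

protected theorem JTm.ind (hB : JTm ℓ Γ B B' (Fam 0 Expr.nat))
    (hz : JTm ℓ Γ bz bz' (tm 0 (Expr.fam 0 Expr.nat B Expr.zero)))
    (hbs : JTm ℓ Γ bs bs' (Step B)) (hx : JTm ℓ Γ x x' (tm 0 Expr.nat)) :
    JTm ℓ Γ (ind B bz bs x) (ind B' bz' bs' x') (tm 0 (Expr.fam 0 Expr.nat B x)) where
  ty := JTy.tm (JTm.fam (JTm.nat hB.pos_of_fam hB.ty.ctx) hB.left hx.left)
  der := Der.ind hB.der hz.der hbs.der hx.der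
  rel {σ τ} hs := by
    have ks := hbs.closed hs
    rw [Expr.Step_subst] at ks
    have kx := (hx.closed hs).el_closed
    have kx' : NatR ℓ (x.subst σ) (x'.subst τ) := by rw [← El_nat hB.pos_of_fam]; exact kx
    exact JTm.el_ind (hB.closed hs) (hz.closed hs) ks kx'

protected theorem JTm.ind_zero (hB : JTm ℓ Γ B B (Fam 0 Expr.nat))
    (hz : JTm ℓ Γ bz bz (tm 0 (Expr.fam 0 Expr.nat B Expr.zero)))
    (hbs : JTm ℓ Γ bs bs (Step B)) :
    JTm ℓ Γ (Expr.ind B bz bs Expr.zero) bz (tm 0 (Expr.fam 0 Expr.nat B Expr.zero)) :=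
  (hz.of_exp (Der.ind_zero hB.der hz.der hbs.der).tm_symm
    fun _ _ h => .ind_zero (.val .zero) h).symm

protected theorem JTm.ind_suc (hB : JTm ℓ Γ B B (Fam 0 Expr.nat))
    (hz : JTm ℓ Γ bz bz (tm 0 (Expr.fam 0 Expr.nat B Expr.zero)))
    (hbs : JTm ℓ Γ bs bs (Step B)) (hx : JTm ℓ Γ x x (tm 0 Expr.nat)) :
    JTm ℓ Γ (Expr.ind B bz bs (Expr.suc x)) (Expr.step B bs x (Expr.ind B bz bs x))
      (tm 0 (Expr.fam 0 Expr.nat B (Expr.suc x))) := by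
  have hd := Der.ind_suc hB.der hz.der hbs.der hx.der
  refine ((JTm.step hB hbs hx (JTm.ind hB hz hbs hx)).of_exp hd.tm_symm fun σ v h => ?_).symm
  refine .ind_suc (.val .suc) ?_
  rw [show (Expr.step B bs x (Expr.ind B bz bs x)).subst σ =
    Expr.step (B.subst σ) (bs.subst σ) (x.subst σ)
      (Expr.ind (B.subst σ) (bz.subst σ) (bs.subst σ) (x.subst σ)) by
    simp only [Expr.step, StepAt, Expr.fam, Expr.subst, Expr.wk_subst_upSub]; rfl] at h
  exact h

end

end

/-! ### Soundness and canonicity -/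

section
variable {ℓ : ℕ∞}

/-- Derivable assertions are valid. -/
theorem Der.valid {a : Assertion} (h : Der ℓ a) : J ℓ a := by
  induction h with
  | ctx_nil => exact JCtx.nil
  | ctx_snoc _ _ _ h => exact JCtx.snoc h
  | var i _ h => exact JTm.var h i
  | ty_symm _ h => exact JTy.symm h
  | ty_trans _ _ h h' => exact JTy.trans h h'
  | tm_symm _ h => exact JTm.symm h
  | tm_trans _ _ h h' => exact JTm.trans h h'
  | tm_conv _ _ h h' => exact JTm.conv h h'
  | ty_subst _ _ _ hc h h' => exact JTy.subst hc h h'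
  | tm_subst _ _ _ hc h h' => exact JTm.subst hc h h'
  | lfUnit _ h => exact JTy.lfUnit h
  | lfStar _ h => exact JTm.lfStar h
  | lfUnit_eta _ h => exact JTm.lfUnit_eta h
  | lfPi _ _ hA hB => exact JTy.lfPi hA hB
  | lfLam _ _ _ hA hB ht => exact JTm.lfLam hA hB ht
  | lfApp _ _ _ _ hA hB hf ha => exact JTm.lfApp hA hB hf ha
  | lfPi_beta _ _ _ _ hA hB ht ha => exact JTm.lfPi_beta hA hB ht ha
  | lfPi_eta _ _ _ hA hB hf => exact JTm.lfPi_eta hA hB hf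
  | lfSig _ _ hA hB => exact JTy.lfSig hA hB
  | lfPair _ _ _ _ hA hB ha hb => exact JTm.lfPair hA hB ha hb
  | lfFst _ _ _ hA hB hp => exact JTm.lfFst hA hB hp
  | lfSnd _ _ _ hA hB hp => exact JTm.lfSnd hA hB hp
  | lfSig_fst _ _ _ _ hA hB ha hb => exact JTm.lfSig_fst hA hB ha hb
  | lfSig_snd _ _ _ _ hA hB ha hb => exact JTm.lfSig_snd hA hB ha hb
  | lfSig_eta _ _ _ hA hB hp => exact JTm.lfSig_eta hA hB hp
  | lfEq _ _ _ hA ha hb => exact JTy.lfEq hA ha hb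
  | lfRefl _ _ hA ha => exact JTm.lfRefl hA ha
  | lfEq_reflection _ _ _ _ hA ha hb hp => exact JTm.lfEq_reflection hA ha hb hp
  | lfEq_eta _ _ _ _ hA ha hb hp => exact JTm.lfEq_eta hA ha hb hp
  | tp hα _ h => exact JTy.tp hα h
  | tm _ h => exact JTy.tm h
  | lift hαβ hβ _ h => exact JTm.lift hαβ hβ h
  | lift_self _ h => exact JTm.lift_self h
  | lift_lift hαβ hβγ hγ _ h => exact JTm.lift_lift hαβ hβγ hγ h
  | tm_lift hαβ hβ _ h => exact JTy.tm_lift hαβ hβ h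
  | lift_inj hαβ hβ _ _ _ hA hB h => exact JTm.lift_inj hαβ hβ hA hB h
  | sigma _ _ hA hB => exact JTm.sigma hA hB
  | pair _ _ _ hA hB hx => exact JTm.pair hA hB hx
  | unpair _ _ _ hA hB hy => exact JTm.unpair hA hB hy
  | unpair_pair _ _ _ hA hB hx => exact JTm.unpair_pair hA hB hx
  | pair_unpair _ _ _ hA hB hy => exact JTm.pair_unpair hA hB hy
  | lift_sigma hαβ hβ _ _ hA hB => exact JTm.lift_sigma hαβ hβ hA hB
  | pair_lift hαβ hβ _ _ _ hA hB hx => exact JTm.pair_lift hαβ hβ hA hB hx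
  | eq _ _ _ hA ha hb => exact JTm.eq hA ha hb
  | refl _ _ hA ha => exact JTm.refl hA ha
  | eqind _ _ _ _ _ _ hA ha hP hb hp hs => exact JTm.eqind hA ha hP hb hp hs
  | eqind_refl _ _ _ _ hA ha hP hs => exact JTm.eqind_refl hA ha hP hs
  | lift_eq hαβ hβ _ _ _ hA ha hb => exact JTm.lift_eq hαβ hβ hA ha hb
  | refl_lift hαβ hβ _ _ hA ha => exact JTm.refl_lift hαβ hβ hA ha
  | pi hα _ _ hA hB => exact JTm.pi hα hA hB
  | abs hα _ _ _ hA hB hf => exact JTm.abs hα hA hB hf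
  | unabs hα _ _ _ hA hB hg => exact JTm.unabs hα hA hB hg
  | unabs_abs hα _ _ _ hA hB hf => exact JTm.unabs_abs hα hA hB hf
  | abs_unabs hα _ _ _ hA hB hg => exact JTm.abs_unabs hα hA hB hg
  | lift_pi hα hαβ hβ _ _ hA hB => exact JTm.lift_pi hα hαβ hβ hA hB
  | abs_lift hα hαβ hβ _ _ _ hA hB hf => exact JTm.abs_lift hα hαβ hβ hA hB hf
  | empty h0 _ h => exact JTm.empty h0 h
  | exfalso _ _ hB hx => exact JTm.exfalso hB hx
  | unit h0 _ h => exact JTm.unit h0 h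
  | star h0 _ h => exact JTm.star h0 h
  | unitind _ _ _ hB hb hx => exact JTm.unitind hB hb hx
  | unitind_star _ _ hB hb => exact JTm.unitind_star hB hb
  | nat h0 _ h => exact JTm.nat h0 h
  | zero h0 _ h => exact JTm.zero h0 h
  | suc _ h => exact JTm.suc h
  | ind _ _ _ _ hB hz hbs hx => exact JTm.ind hB hz hbs hx
  | ind_zero _ _ _ hB hz hbs => exact JTm.ind_zero hB hz hbs
  | ind_suc _ _ _ _ hB hz hbs hx => exact JTm.ind_suc hB hz hbs hx
  | univ hα _ h => exact JTm.univ_type hα h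
  | tm_univ hα _ h => exact JTy.tm_univ hα h

/-- The numeral `n`. -/
def numeralExpr {k : ℕ} : ℕ → Expr k
  | 0 => .zero
  | n + 1 => .suc (numeralExpr n)

theorem numeralExpr_subst {k m : ℕ} (σ : Fin k → Expr m) (n : ℕ) :
    (numeralExpr n).subst σ = numeralExpr n := by
  induction n with
  | zero => rfl
  | succ n ih => exact congrArg Expr.suc ih

/-- Each layer of `NatR` records a judgemental equality with zero or a successor; congruence of the
successor chains them together. -/
theorem NatR.exists_numeral {t u : Expr 0} (h : NatR ℓ t u) :
    ∃ n, D ℓ t (numeralExpr n) (tm 0 nat) := by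
  induction h with
  | zero _ _ h => exact ⟨0, h⟩
  | suc _ _ h _ _ ih =>
    obtain ⟨n, hn⟩ := ih
    exact ⟨n + 1, h.tm_trans (Der.suc hn)⟩

/-- Canonicity for closed terms of the type of natural numbers. -/
theorem Der.exists_numeral {t : Expr 0} (h0 : 0 < ℓ) (h : D ℓ t t (Expr.tm 0 Expr.nat)) :
    ∃ n, D ℓ t (numeralExpr n) (Expr.tm 0 Expr.nat) := by
  have hv : JTm ℓ .nil t t (Expr.tm 0 Expr.nat) := h.valid
  have r := hv.el_closed
  rw [El_nat h0] at r
  exact r.exists_numeral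

/-- A term in a variable of the unit judgement is equal to the one obtained by substituting the
element of the unit judgement. -/
theorem Der.eq_subst_lfStar {t u A : Expr 1}
    (h : Der ℓ (tmEq (Ctx.nil.snoc Expr.lfUnit) t u A)) :
    Der ℓ (tmEq (Ctx.nil.snoc Expr.lfUnit) t (u.subst fun _ => Expr.lfStar) A) := by
  have hc : Der ℓ (Assertion.ctx (Ctx.nil.snoc Expr.lfUnit)) :=
    Der.ctx_snoc Der.ctx_nil (Der.lfUnit Der.ctx_nil)
  have := Der.tm_subst (σ := Expr.var) (τ := fun _ => Expr.lfStar) hc (fun i => ?_) h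
  · rwa [Expr.subst_id, Expr.subst_id] at this
  · obtain rfl : i = 0 := Fin.fin_one_eq_zero i
    rw [Expr.subst_id]
    exact Der.lfUnit_eta (Der.var 0 hc)

/-- Composing with the successor morphism substitutes into `suc (var 0)`, so the categorical
numerals are represented by the syntactic ones. -/
theorem Tpr.numeral_eq (hℓ : 2 ≤ ℓ) (n : ℕ) :
    ∃ h, Tpr.numeral hℓ n =
      Quotient.mk _ (⟨numeralExpr n, h⟩ : Tpr.RawHom (Tpr.one ℓ) (Tpr.tmN hℓ)) := by
  induction n with
  | zero => exact ⟨_, rfl⟩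
  | succ n ih =>
    obtain ⟨h, e⟩ := ih
    refine ⟨Der.suc h, ?_⟩
    rw [Tpr.numeral, e]
    rfl

end

end PRTT

theorem mainTheorem2 (ℓ : ℕ∞) (hℓ : 2 ≤ ℓ) (m : PRTT.Tpr.one ℓ ⟶ PRTT.Tpr.tmN hℓ) :
    ∃ n : ℕ, m = PRTT.Tpr.numeral hℓ n := by
  refine Quotient.inductionOn m fun t => ?_
  obtain ⟨t, ht⟩ := t
  have h0 : 0 < ℓ := lt_of_lt_of_le (by norm_num) hℓ
  -- A global element is a term in one variable of the unit judgement; instantiating the variable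
  -- produces the closed term to which canonicity applies.
  have hs : PRTT.D ℓ (t.inst .lfStar) (t.inst .lfStar) (.tm 0 .nat) :=
    PRTT.Der.tm_inst ht (PRTT.Der.lfStar PRTT.Der.ctx_nil)
  obtain ⟨n, hn⟩ := PRTT.Der.exists_numeral h0 hs
  obtain ⟨h, e⟩ := PRTT.Tpr.numeral_eq hℓ n
  refine ⟨n, ?_⟩
  rw [e]
  refine Quotient.sound ?_
  -- By η for the unit judgement nothing was lost: the original term equals the weakening of its
  -- closed instance, and the closed equality can be weakened too.
  have h₁ := PRTT.Der.eq_subst_lfStar ht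
  have h₂ := PRTT.Der.tm_wk (PRTT.Tpr.one ℓ).der_ctx hn
  have e₁ : (t.inst .lfStar).wk = t.subst fun _ => .lfStar := by
    rw [PRTT.Expr.inst_eq, PRTT.Expr.wk, PRTT.Expr.rename_subst]
    congr 1
    funext i
    obtain rfl : i = 0 := Fin.fin_one_eq_zero i
    rfl
  have e₂ : (PRTT.numeralExpr n : PRTT.Expr 0).wk = PRTT.numeralExpr n := by
    rw [PRTT.Expr.wk_eq_subst, PRTT.numeralExpr_subst]
  rw [e₁, e₂] at h₂
  exact PRTT.Der.tm_trans h₁ h₂
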